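/- Let $\mathcal P_{X\to BW}:\{0,1\}\to\mathscr S(\mathcal H_B\otimes\mathcal H_W)$, $x\mapsto\pi^{(x)}_{BW}$, be a classical-quantum channel with finite-dimensional outputs, used without memory, with marginals $\sigma_x=\mathrm{Tr}_W\,\pi^{(x)}_{BW}$ (Bob) and $\omega_x=\mathrm{Tr}_B\,\pi^{(x)}_{BW}$ (Willie), and innocent input $0$. Assume $\mathrm{supp}(\sigma_1)\subseteq\mathrm{supp}(\sigma_0)$, $\mathrm{supp}(\omega_1)\subseteq\mathrm{supp}(\omega_0)$ and $\omega_1\neq\omega_0$. A code of length $n$ without key assistance consists of a finite set $\mathcal M$ of secret messages, a finite set $\mathcal L$ of public messages (both non-empty), an encoder $f:\mathcal M\times\mathcal L\to\{0,1\}^n$, and a POVM $\{\Lambda^{(m,\ell)}\}_{(m,\ell)\in\mathcal M\times\mathcal L}$ on $\mathcal H_B^{\otimes n}$. Let $\rho^{(m,\ell)}_{B^n}=\bigotimes_i\sigma_{f_i(m,\ell)}$, $\rho^{(m,\ell)}_{W^n}=\bigotimes_i\omega_{f_i(m,\ell)}$, $\rho^{(m)}_{W^n}=\frac1{|\mathcal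 L|}\sum_\ell\rho^{(m,\ell)}_{W^n}$ and $\overline\rho_{W^n}=\frac1{|\mathcal M|}\sum_m\rho^{(m)}_{W^n}$. Logarithms are natural, $\|\cdot\|_1$ is the trace norm, and $D(\rho\|\sigma)=\mathrm{Tr}[\rho(\log\rho-\log\sigma)]$ if $\mathrm{supp}(\rho)\subseteq\mathrm{supp}(\sigma)$, and $+\infty$ otherwise. A rate $L_{\mathrm S}>0$ is achievable without key assistance if for all $\varepsilon,\delta_{\mathrm{cov}},\delta_{\mathrm{sec}}>0$ and all sufficiently large $n$ there is such a code with $\log|\mathcal M|\ge\sqrt{n\,\delta_{\mathrm{cov}}}\,L_{\mathrm S}$ and (i) $\frac1{|\mathcal M||\mathcal L|}\sum_{m,\ell}\bigl(1-\mathrm{Tr}[\Lambda^{(m,\ell)}\rho^{(m,\ell)}_{B^n}]\bigr)\le\varepsilon$; (ii) $D(\overline\rho_{W^n}\|\omega_0^{\otimes n})\le\delta_{\mathrm{cov}}$; (iii) $\frac1{|\mathcal M|}\sum_m\|\rho^{(m)}_{W^n}-\breve\rho\|_1\le\delta_{\mathrm{sec}}$ for some state $\breve\rho$ on $\mathcal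 H_W^{\otimes n}$ that does not depend on $m$. The covert secrecy capacity without key assistance $C_{\mathrm S}(\mathcal P)$ is the supremum of all achievable rates ($0$ if there is none). Then $$C_{\mathrm S}(\mathcal P)=\frac{[D(\sigma_1\|\sigma_0)-D(\omega_1\|\omega_0)]_+}{\sqrt{\tfrac12\chi^2(\omega_1\|\omega_0)}},$$ where $[t]_+=\max(0,t)$ and, for the spectral decomposition $\sigma=\sum_i\lambda_i\Pi_i$ over the distinct positive eigenvalues of $\sigma$, $$\chi^2(\rho\|\sigma)=\sum_{i\ne j}\frac{\log\lambda_i-\log\lambda_j}{\lambda_i-\lambda_j}\mathrm{Tr}[(\rho-\sigma)\Pi_i(\rho-\sigma)\Pi_j]+\sum_i\frac1{\lambda_i}\mathrm{Tr}[(\rho-\sigma)\Pi_i(\rho-\sigma)\Pi_i].$$ Moreover, the converse holds even under weak secrecy: if (iii) is replaced by $I(\mathbf m;W^n)\le\delta_{\mathrm{sec}}\log|\mathcal M|$, with the quantum mutual information of the state $\frac1{|\mathcal M|}\sum_m|m\rangle\langle m|\otimes\rho^{(m)}_{W^n}$, then no achievable rate exceeds the right-hand side of the formula for $C_{\mathrm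 S}(\mathcal P)$. -/

import Mathlib

open scoped ENNReal ComplexOrder

namespace CovertSecrecy

noncomputable section

/-! ### Quantum states, entropies and divergences on finite-dimensional systems

An operator on the Hilbert space `ℂ^A` (with `A` a finite index type) is a matrix
`Matrix A A ℂ`; the tensor product of the systems `A` and `B` is indexed by `A × B`. -/

/-- Density operators: positive semidefinite with unit trace. -/
def IsDensity {A : Type*} [Fintype A] (ρ : Matrix A A ℂ) : Prop :=
  ρ.PosSemidef ∧ ρ.trace = 1

/-- Partial trace over the second factor. -/
def partialTraceRight {A B : Type*} [Fintype B] (ρ : Matrix (A × B) (A × B) ℂ) :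
    Matrix A A ℂ :=
  Matrix.of fun a a' => ∑ b, ρ (a, b) (a', b)

/-- Partial trace over the first factor. -/
def partialTraceLeft {A B : Type*} [Fintype A] (ρ : Matrix (A × B) (A × B) ℂ) :
    Matrix B B ℂ :=
  Matrix.of fun b b' => ∑ a, ρ (a, b) (a, b')

/-- The support of a Hermitian operator, i.e. the orthogonal complement of its kernel, which is
its range. -/
def supp {A : Type*} [Fintype A] (ρ : Matrix A A ℂ) : Submodule ℂ (A → ℂ) :=
  LinearMap.range ρ.mulVecLin

/-- The trace norm `‖Q‖₁ = tr √(Q† Q)`. -/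
def traceNorm {A : Type*} [Fintype A] [DecidableEq A] (Q : Matrix A A ℂ) : ℝ :=
  (cfc Real.sqrt (Q.conjTranspose * Q)).trace.re

/-- The logarithm of a positive semidefinite operator, taken on its support
(eigenvalue `0` is sent to `0`). -/
def matLog {A : Type*} [Fintype A] [DecidableEq A] (ρ : Matrix A A ℂ) : Matrix A A ℂ :=
  cfc Real.log ρ

open Classical in
/-- The quantum (Umegaki) relative entropy `D(ρ‖σ)`, in nats. -/
def relEntropy {A : Type*} [Fintype A] [DecidableEq A] (ρ σ : Matrix A A ℂ) : EReal :=
  if supp ρ ≤ supp σ then (((ρ * (matLog ρ - matLog σ)).trace.re : ℝ) : EReal) else ⊤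

/-- The spectral projection of a Hermitian operator onto its eigenspace with eigenvalue `a`. -/
def spectralProj {A : Type*} [Fintype A] [DecidableEq A] (σ : Matrix A A ℂ) (a : ℝ) :
    Matrix A A ℂ :=
  cfc (fun x : ℝ => if x = a then (1 : ℝ) else 0) σ

/-- The finite set of distinct non-zero eigenvalues of a positive semidefinite operator. -/
def posSpectrum {A : Type*} [Fintype A] [DecidableEq A] (σ : Matrix A A ℂ) : Finset ℝ :=
  σ.finite_real_spectrum.toFinset.filter fun a => 0 < a

/-- The quantum chi-square divergence `χ²(ρ‖σ)` for states with `supp ρ ⊆ supp σ`, through the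
spectral decomposition of `σ` on its support. -/
def chiSq {A : Type*} [Fintype A] [DecidableEq A] (ρ σ : Matrix A A ℂ) : ℝ :=
  (∑ a ∈ posSpectrum σ, ∑ b ∈ (posSpectrum σ).erase a,
    (Real.log a - Real.log b) / (a - b) *
      ((ρ - σ) * spectralProj σ a * (ρ - σ) * spectralProj σ b).trace.re) +
  ∑ a ∈ posSpectrum σ,
    1 / a * ((ρ - σ) * spectralProj σ a * (ρ - σ) * spectralProj σ a).trace.re

/-- The von Neumann entropy, in nats. -/
def vonNeumannEntropy {A : Type*} [Fintype A] [DecidableEq A] (ρ : Matrix A A ℂ) : ℝ :=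
  -(ρ * matLog ρ).trace.re

/-- The quantum mutual information `I(A;B) = H(A) + H(B) - H(AB)` of a bipartite state. -/
def mutualInfo {A B : Type*} [Fintype A] [DecidableEq A] [Fintype B] [DecidableEq B]
    (ρ : Matrix (A × B) (A × B) ℂ) : ℝ :=
  vonNeumannEntropy (partialTraceRight ρ) + vonNeumannEntropy (partialTraceLeft ρ)
    - vonNeumannEntropy ρ

/-- The `n`-fold tensor power `ρ^{⊗ n}`. -/
def tensorPow {A : Type*} (ρ : Matrix A A ℂ) (n : ℕ) :
    Matrix (Fin n → A) (Fin n → A) ℂ :=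
  Matrix.of fun a a' => ∏ i, ρ (a i) (a' i)

/-! ### Classical-quantum channels and codes -/

/-- A classical-quantum channel `X → BW`: every classical input is sent to a joint state of
Bob and Willie. -/
structure CQChannel (X B W : Type*) [Fintype B] [Fintype W] where
  /-- The output state `π_{BW}^{(x)}`. -/
  state : X → Matrix (B × W) (B × W) ℂ
  isDensity : ∀ x, IsDensity (state x)

section Coding

variable {X B W : Type*} [Fintype B] [DecidableEq B] [Fintype W] [DecidableEq W]

/-- Bob's output `σ_x`. -/
def CQChannel.bob (P : CQChannel X B W) (x : X) : Matrix B B ℂ :=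
  partialTraceRight (P.state x)

/-- Willie's output `ω_x`. -/
def CQChannel.willie (P : CQChannel X B W) (x : X) : Matrix W W ℂ :=
  partialTraceLeft (P.state x)

/-- The output `⨂ᵢ π_{BW}^{(xᵢ)}` of `n` memoryless uses of the channel on the sequence `x`, with
the factors grouped as `Bⁿ` and `Wⁿ`. -/
def CQChannel.output (P : CQChannel X B W) {n : ℕ} (x : Fin n → X) :
    Matrix ((Fin n → B) × (Fin n → W)) ((Fin n → B) × (Fin n → W)) ℂ :=
  Matrix.of fun p q => ∏ i, P.state (x i) (p.1 i, p.2 i) (q.1 i, q.2 i)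

/-- A classical secrecy code of blocklength `n` with `M` secret messages, `L` public messages and
`K` keys: a deterministic encoder and, for every key, a decoding measurement (POVM) on `Bⁿ`. -/
structure SecrecyCode (X B : Type*) [Fintype B] [DecidableEq B] (M L K n : ℕ) where
  enc : Fin M → Fin L → Fin K → Fin n → X
  dec : Fin K → Fin M × Fin L → Matrix (Fin n → B) (Fin n → B) ℂ
  dec_posSemidef : ∀ k ml, (dec k ml).PosSemidef
  dec_sum : ∀ k, ∑ ml, dec k ml = 1

namespace SecrecyCode

variable {M L K n : ℕ} (C : SecrecyCode X B M L K n) (P : CQChannel X B W)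

/-- Bob's state `ρ_{Bⁿ}^{(m,ℓ,k)}`. -/
def bobState (m : Fin M) (l : Fin L) (k : Fin K) : Matrix (Fin n → B) (Fin n → B) ℂ :=
  partialTraceRight (P.output (C.enc m l k))

/-- Willie's state `ρ_{Wⁿ}^{(m,ℓ,k)}`. -/
def willieState (m : Fin M) (l : Fin L) (k : Fin K) : Matrix (Fin n → W) (Fin n → W) ℂ :=
  partialTraceLeft (P.output (C.enc m l k))

/-- The average probability that Bob decodes the pair `(m, ℓ)` incorrectly. -/
def avgError : ℝ :=
  1 / ((M : ℝ) * L * K) * ∑ m, ∑ l, ∑ k,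
    (1 - (C.dec k (m, l) * C.bobState P m l k).trace.re)

/-- Willie's state `ρ_{Wⁿ}^{(m)}` given the secret message `m`. -/
def willieGiven (m : Fin M) : Matrix (Fin n → W) (Fin n → W) ℂ :=
  (1 / ((L : ℂ) * K)) • ∑ l, ∑ k, C.willieState P m l k

/-- Willie's average state when Alice transmits. -/
def willieAvg : Matrix (Fin n → W) (Fin n → W) ℂ :=
  (1 / (M : ℂ)) • ∑ m, C.willieGiven P m

/-- The joint classical-quantum state of the uniform secret message and Willie's output,
`(1/M) ∑ₘ |m⟩⟨m| ⊗ ρ_{Wⁿ}^{(m)}`. -/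
def messageWillie :
    Matrix (Fin M × (Fin n → W)) (Fin M × (Fin n → W)) ℂ :=
  Matrix.of fun p q =>
    if p.1 = q.1 then (1 / (M : ℂ)) * C.willieGiven P p.1 p.2 q.2 else 0

/-- Decoding reliability. -/
def Reliable (ε : ℝ) : Prop := C.avgError P ≤ ε

/-- Covertness: `D(ρ̄_{Wⁿ} ‖ ω₀^{⊗ n}) ≤ δ`, with `0` the innocent input. -/
def Covert [Zero X] (δ : ℝ) : Prop :=
  relEntropy (C.willieAvg P) (tensorPow (P.willie 0) n) ≤ (δ : EReal)

/-- Secrecy: the average leakage distance to some constant state is at most `δ`. -/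
def Secret (δ : ℝ) : Prop :=
  ∃ τ : Matrix (Fin n → W) (Fin n → W) ℂ, IsDensity τ ∧
    1 / (M : ℝ) * ∑ m, traceNorm (C.willieGiven P m - τ) ≤ δ

/-- Weak secrecy: `I(m; Wⁿ) ≤ β log M`. -/
def WeaklySecret (β : ℝ) : Prop :=
  mutualInfo (C.messageWillie P) ≤ β * Real.log M

end SecrecyCode

variable [Zero X]

/-- The covert secrecy rate `r` is achievable without key assistance (a single key value, public
message of arbitrary size): for all `ε, δcov, δsec > 0` and all large `n` there is a code with
`log M ≥ √(n δcov) r` that is reliable, covert and secret. -/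
def CQChannel.Achievable (P : CQChannel X B W) (r : ℝ) : Prop :=
  ∀ ε δcov δsec : ℝ, 0 < ε → 0 < δcov → 0 < δsec → ∀ᶠ n : ℕ in Filter.atTop,
    ∃ M L : ℕ, 0 < M ∧ 0 < L ∧ Real.sqrt (n * δcov) * r ≤ Real.log M ∧
      ∃ C : SecrecyCode X B M L 1 n,
        C.Reliable P ε ∧ C.Covert P δcov ∧ C.Secret P δsec

/-- The same with secrecy replaced by weak secrecy: `I(m; Wⁿ) / log M` can be made arbitrarily
small. -/
def CQChannel.WeaklyAchievable (P : CQChannel X B W) (r : ℝ) : Prop :=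
  ∀ ε δcov β : ℝ, 0 < ε → 0 < δcov → 0 < β → ∀ᶠ n : ℕ in Filter.atTop,
    ∃ M L : ℕ, 0 < M ∧ 0 < L ∧ Real.sqrt (n * δcov) * r ≤ Real.log M ∧
      ∃ C : SecrecyCode X B M L 1 n,
        C.Reliable P ε ∧ C.Covert P δcov ∧ C.WeaklySecret P β

/-- The covert secrecy capacity without key assistance: the supremum, in `[0, ∞]`, of all
achievable positive rates. -/
def CQChannel.capacity (P : CQChannel X B W) : ℝ≥0∞ :=
  ⨆ r : {r : ℝ // 0 < r ∧ P.Achievable r}, ENNReal.ofReal r.1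

/-- The covert secrecy capacity without key assistance under weak secrecy. -/
def CQChannel.weakCapacity (P : CQChannel X B W) : ℝ≥0∞ :=
  ⨆ r : {r : ℝ // 0 < r ∧ P.WeaklyAchievable r}, ENNReal.ofReal r.1

end Coding

end

end CovertSecrecy

/-! Write D_B = D(σ₁‖σ₀), D_W = D(ω₁‖ω₀) and χ = χ²(ω₁‖ω₀). Both directions are governed by the
Hamming weight of the codewords: a word of weight k has divergence k·D_B from σ₀^⊗n at Bob and k·D_W
from ω₀^⊗n at Willie. Let A be the average weight of a code.

Converse. Each POVM element is a test of its codeword state against σ₀^⊗n, and all elements together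
have mass 1 under σ₀^⊗n; hence log(ML) ≲ A·D_B (`SecrecyCode.log_card_le`). At Willie, A·D_W equals
the covertness divergence plus the Holevo quantity of the whole codebook, and the latter is the
leakage of the secret message plus a conditional part that is at most log L
(`SecrecyCode.covert_bounds`). The leakage is small compared with log M: directly under weak
secrecy, through an Alicki-Fannes type bound under trace-norm secrecy (`holevo_le_of_traceNorm`).
Subtracting, log M ≲ A(D_B - D_W). Covertness limits A: Klein's inequality against the n-th power of
(1-b)ω₀ + bω₁ bounds the covertness divergence from below by an affine function of A
(`relEnt_mixture_ge`), and b = √(2/(nχ)) yields A ≲ √n / √(χ/2) for covertness level 1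
(`tendsto_weight_bound`). Level 1 suffices, since achievability demands codes at every level.
`rate_le_of_codes` combines these bounds.

Achievability. Draw ML independent words with Bernoulli(α) letters, α = a/√n, where a²χ/2 < δ_cov,
and log L slightly above a√n·D_W. Bob's error is controlled by Audenaert's test, the Hayashi-Nagaoka
inequality and the quasi-entropy tr ρ^(1-t)σ^t at a small fixed t > 0 (`exists_decoders`,
`exists_bob_exponent`); it vanishes when log(ML) stays below a√n·D_B. Willie's subcode states
approach the product state of the mixture by soft covering, proved by pinching along type classes
and the same quasi-entropy at a negative exponent (`sum_codebook_relEnt_le`,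
`exists_willie_exponent`). The mixture itself costs n·D((1-α)ω₀ + αω₁ ‖ ω₀) → a²χ/2. One scalar cost
collects reliability, covertness and secrecy, so a bound on its expectation selects one good
codebook (`exists_codebook`, `exists_code`).

Both directions use the expansion D((1-b)ω₀ + bω₁ ‖ ω₀) ~ χb²/2 (`second_order`), obtained from
divided differences of the logarithm after compressing to the support of ω₀. Traces of two functions
of operators are reduced throughout to double sums over eigenvalue pairs weighted by squared
eigenvector overlaps, so that scalar inequalities suffice. -/

namespace CovertSecrecy
open Matrix
open scoped MatrixOrder Matrix.Norms.L2Operator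

noncomputable section

set_option linter.unusedSectionVars false

/-! ### Diagonalization by isometries and functional calculus -/

section Diagonalization

variable {n I J : Type*} [Fintype n] [DecidableEq n] [Fintype I] [DecidableEq I]
  [Fintype J] [DecidableEq J]

/-- Real diagonal matrix. -/
def dg (a : I → ℝ) : Matrix I I ℂ := diagonal fun i => (a i : ℂ)

lemma dg_conjTranspose (a : I → ℝ) : (dg a)ᴴ = dg a := by
  simp [dg, diagonal_conjTranspose, Pi.star_def]

lemma dg_mul (a b : I → ℝ) : dg a * dg b = dg (fun i => a i * b i) := by
  simp [dg, diagonal_mul_diagonal]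

/-- `A = V diag(a) Vᴴ` with `V` an isometry. -/
structure IsDiag (A : Matrix n n ℂ) (V : Matrix n I ℂ) (a : I → ℝ) : Prop where
  iso : Vᴴ * V = 1
  eq : A = V * dg a * Vᴴ

variable {A B : Matrix n n ℂ} {V : Matrix n I ℂ} {a : I → ℝ}

lemma IsDiag.isHermitian (h : IsDiag A V a) : A.IsHermitian := by
  rw [h.eq, IsHermitian, conjTranspose_mul, conjTranspose_mul, dg_conjTranspose,
    conjTranspose_conjTranspose, Matrix.mul_assoc]

lemma conj_dg_mul (hV : Vᴴ * V = 1) (f g : I → ℝ) :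
    V * dg f * Vᴴ * (V * dg g * Vᴴ) = V * dg (fun i => f i * g i) * Vᴴ := by
  calc _ = V * dg f * (Vᴴ * V) * dg g * Vᴴ := by simp only [Matrix.mul_assoc]
    _ = _ := by rw [hV, Matrix.mul_one, Matrix.mul_assoc V, dg_mul]

/-- The factor `A` in front absorbs the constant term of `q`: as `V * Vᴴ` need not be the identity,
a constant alone has no such form. -/
lemma IsDiag.mul_aeval (h : IsDiag A V a) (q : Polynomial ℝ) :
    A * Polynomial.aeval A q = V * dg (fun i => a i * q.eval (a i)) * Vᴴ := by
  induction q using Polynomial.induction_on' with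
  | add p q hp hq =>
    rw [map_add, Matrix.mul_add, hp, hq, ← Matrix.add_mul, ← Matrix.mul_add]
    congr 2
    ext i j
    by_cases hij : i = j <;> simp [dg, hij, Polynomial.eval_add, mul_add]
  | monomial k c =>
    have hk : ∀ k : ℕ, A * A ^ k = V * dg (fun i => a i * a i ^ k) * Vᴴ := by
      intro k
      induction k with
      | zero => simpa using h.eq
      | succ k ih =>
        rw [pow_succ', ih]
        conv_lhs => rw [h.eq]
        rw [conj_dg_mul h.iso]
        congr 3
        ext i
        ring
    rw [Polynomial.aeval_monomial]
    rw [Algebra.algebraMap_eq_smul_one, Matrix.smul_mul, Matrix.one_mul, Matrix.mul_smul, hk,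
      ← Matrix.smul_mul, ← Matrix.mul_smul]
    congr 2
    ext i j
    by_cases hij : i = j <;> simp [dg, hij, Polynomial.eval_monomial]
    ring

lemma exists_polynomial_interp (s : Finset ℝ) (f : ℝ → ℝ) :
    ∃ p : Polynomial ℝ, ∀ x ∈ s, p.eval x = f x :=
  ⟨Lagrange.interpolate s id f, fun _ hx =>
    Lagrange.eval_interpolate_at_node (v := id) f (Set.injOn_id _) hx⟩

/-- The spectrum is finite, so interpolation turns every function into a polynomial and functional
calculus into algebra. -/
lemma cfc_eq_aeval (hA : A.IsHermitian) {f : ℝ → ℝ} {p : Polynomial ℝ}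
    (hp : ∀ x ∈ spectrum ℝ A, p.eval x = f x) : cfc f A = Polynomial.aeval A p := by
  rw [← cfc_polynomial p A hA]
  exact cfc_congr fun _ hx => (hp _ hx).symm

/-- Functional calculus of a matrix diagonalized by an isometry, for functions vanishing at `0`. -/
lemma IsDiag.cfc (h : IsDiag A V a) {f : ℝ → ℝ} (hf : f 0 = 0) :
    IsDiag (_root_.cfc f A) V (fun i => f (a i)) := by
  refine ⟨h.iso, ?_⟩
  classical
  -- The node `0` makes `p` divisible by `X`, as `mul_aeval` requires; the nodes `a i` give the
  -- values on the right-hand side.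
  obtain ⟨p, hp⟩ := exists_polynomial_interp
    (insert 0 (A.finite_real_spectrum.toFinset ∪ Finset.univ.image a)) f
  rw [cfc_eq_aeval h.isHermitian (p := p) fun x hx => hp x (by simp [hx])]
  have h0 : p.eval 0 = 0 := by rw [hp 0 (by simp), hf]
  obtain ⟨q, rfl⟩ : Polynomial.X ∣ p := Polynomial.X_dvd_iff.2 (by
    rwa [Polynomial.coeff_zero_eq_eval_zero])
  rw [map_mul, Polynomial.aeval_X, h.mul_aeval]
  congr 3
  ext i
  rw [← hp (a i) (by simp)]
  simp

/-- Once `V * Vᴴ = 1`, constants are diagonalized too, so `f` is split as `f - f 0` plus a constant.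
-/
lemma IsDiag.cfc_of_unitary (h : IsDiag A V a) (hV : V * Vᴴ = 1) (f : ℝ → ℝ) :
    IsDiag (_root_.cfc f A) V (fun i => f (a i)) := by
  refine ⟨h.iso, ?_⟩
  have h1 := (h.cfc (f := fun x => f x - f 0) (by simp)).eq
  have h2 : _root_.cfc f A = _root_.cfc (fun x => f x - f 0) A + (f 0 : ℂ) • 1 := by
    have : f = fun x => (f x - f 0) + f 0 := by ext; simp
    have hs : (spectrum ℝ A).Finite := A.finite_real_spectrum
    have hsa : IsSelfAdjoint A := h.isHermitian
    conv_lhs => rw [this]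
    rw [cfc_add A (fun x => f x - f 0) (fun _ => f 0) (hs.continuousOn _) (hs.continuousOn _),
      cfc_const _ _ hsa, Algebra.algebraMap_eq_smul_one]
    simp
  have h3 : (f 0 : ℂ) • (1 : Matrix n n ℂ) = V * dg (fun _ : I => f 0) * Vᴴ := by
    have : dg (fun _ : I => f 0) = (f 0 : ℂ) • 1 := by
      ext i j; by_cases hij : i = j <;> simp [dg, hij]
    rw [this, Matrix.mul_smul, Matrix.mul_one, Matrix.smul_mul, hV]
  rw [h2, h1, h3, ← Matrix.add_mul, ← Matrix.mul_add]
  congr 2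
  ext i j
  by_cases hij : i = j <;> simp [dg, hij]

lemma IsDiag.unitary {U : Matrix n n ℂ} {a : n → ℝ} (h : IsDiag A U a) : U * Uᴴ = 1 :=
  mul_eq_one_comm.1 h.iso

lemma IsDiag.cfc_sq {U : Matrix n n ℂ} {a : n → ℝ} (h : IsDiag A U a) (f : ℝ → ℝ) :
    IsDiag (_root_.cfc f A) U (fun i => f (a i)) :=
  h.cfc_of_unitary h.unitary f

lemma exists_isDiag (hA : A.IsHermitian) : ∃ (U : Matrix n n ℂ) (a : n → ℝ), IsDiag A U a := by
  refine ⟨hA.eigenvectorUnitary, hA.eigenvalues, ?_, ?_⟩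
  · exact Unitary.coe_star_mul_self hA.eigenvectorUnitary
  · conv_lhs => rw [hA.spectral_theorem]
    rfl

lemma IsDiag.apply_diag (h : IsDiag A V a) (i : I) : (Vᴴ * A * V) i i = (a i : ℂ) := by
  have : Vᴴ * A * V = dg a := by
    calc _ = (Vᴴ * V) * dg a * (Vᴴ * V) := by rw [h.eq]; simp only [Matrix.mul_assoc]
      _ = _ := by rw [h.iso, Matrix.one_mul, Matrix.mul_one]
  rw [this]; simp [dg]

lemma posSemidef_diag_re_nonneg {m : Type*} [Fintype m] [DecidableEq m] {X : Matrix n n ℂ}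
    (hX : X.PosSemidef) (W : Matrix n m ℂ) (j : m) : 0 ≤ ((Wᴴ * X * W) j j).re := by
  have := (hX.conjTranspose_mul_mul_same W).diag_nonneg (i := j)
  exact (Complex.le_def.1 this).1

lemma IsDiag.nonneg (h : IsDiag A V a) (hA : A.PosSemidef) (i : I) : 0 ≤ a i := by
  have := posSemidef_diag_re_nonneg hA V i
  rwa [h.apply_diag, Complex.ofReal_re] at this

lemma dg_posSemidef {a : I → ℝ} (ha : ∀ i, 0 ≤ a i) : (dg a).PosSemidef := by
  refine PosSemidef.diagonal fun i => ?_
  simpa using ha i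

lemma conj_dg_posSemidef {m : Type*} [Fintype m] {a : I → ℝ} (ha : ∀ i, 0 ≤ a i)
    (V : Matrix m I ℂ) : (V * dg a * Vᴴ).PosSemidef :=
  (dg_posSemidef ha).mul_mul_conjTranspose_same V

lemma IsDiag.posSemidef (h : IsDiag A V a) (ha : ∀ i, 0 ≤ a i) : A.PosSemidef := by
  rw [h.eq]; exact conj_dg_posSemidef ha V

lemma IsDiag.pos (h : IsDiag A V a) (hA : A.PosDef) (i : I) : 0 < a i := by
  have hinj : Function.Injective V.mulVec := by
    intro x y hxy
    have := congrArg (Vᴴ.mulVec) hxy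
    simpa [mulVec_mulVec, h.iso] using this
  have := (hA.conjTranspose_mul_mul_same hinj).diag_pos (i := i)
  rw [h.apply_diag] at this
  exact_mod_cast this

lemma IsDiag.posDef {U : Matrix n n ℂ} {a : n → ℝ} (h : IsDiag A U a) (ha : ∀ i, 0 < a i) :
    A.PosDef := by
  have hd : (dg a).PosDef := PosDef.diagonal fun i => by simpa using ha i
  rw [h.eq]
  refine hd.mul_mul_conjTranspose_same ?_
  intro x y hxy
  have := congrArg (vecMul · Uᴴᴴ) hxy
  have hu := h.unitary
  have := congrArg (vecMul · Uᴴ) hxy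
  simpa [vecMul_vecMul, hu] using this

end Diagonalization

/-! ### Eigenvector overlaps -/

section Overlap

variable {m n I J : Type*} [Fintype m] [Fintype n] [DecidableEq n] [Fintype I] [DecidableEq I]
  [Fintype J] [DecidableEq J]

/-- Squared moduli of the entries of `Vᴴ W`. -/
def ov (V : Matrix n I ℂ) (W : Matrix n J ℂ) (i : I) (j : J) : ℝ :=
  Complex.normSq ((Vᴴ * W) i j)

lemma ov_nonneg (V : Matrix n I ℂ) (W : Matrix n J ℂ) (i : I) (j : J) : 0 ≤ ov V W i j :=
  Complex.normSq_nonneg _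

/-- The source of the Nussbaum-Szkoła picture: traces of two non-commuting operators become
classical sums with non-negative weights, on which scalar inequalities can be applied termwise. -/
lemma trace_conj_dg_mul_conj_dg (V : Matrix n I ℂ) (W : Matrix n J ℂ) (f : I → ℝ) (g : J → ℝ) :
    (V * dg f * Vᴴ * (W * dg g * Wᴴ)).trace
      = ((∑ i, ∑ j, f i * g j * ov V W i j : ℝ) : ℂ) := by
  have h1 : (V * dg f * Vᴴ * (W * dg g * Wᴴ)).trace
      = (dg f * (Vᴴ * W) * (dg g * (Vᴴ * W)ᴴ)).trace := by
    rw [conjTranspose_mul, conjTranspose_conjTranspose]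
    calc _ = (V * (dg f * Vᴴ * (W * dg g * Wᴴ))).trace := by simp only [Matrix.mul_assoc]
      _ = _ := by rw [trace_mul_comm]; simp only [Matrix.mul_assoc]
  rw [h1]
  set X := Vᴴ * W
  simp only [trace, diag_apply]
  push_cast
  refine Finset.sum_congr rfl fun i _ => ?_
  rw [mul_apply]
  refine Finset.sum_congr rfl fun j _ => ?_
  simp only [dg, diagonal_mul, conjTranspose_apply, ov, Complex.normSq_eq_conj_mul_self]
  simp only [X]
  simp
  ring

lemma trace_conj_dg_mul (V : Matrix n I ℂ) (f : I → ℝ) (X : Matrix n n ℂ) :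
    (V * dg f * Vᴴ * X).trace = ∑ i, (f i : ℂ) * (Vᴴ * X * V) i i := by
  have : (V * dg f * Vᴴ * X).trace = (dg f * (Vᴴ * X * V)).trace := by
    rw [Matrix.mul_assoc, Matrix.mul_assoc, trace_mul_comm]; simp only [Matrix.mul_assoc]
  rw [this]
  simp [trace, dg, diagonal_mul]

lemma sum_mul_ov (V : Matrix n I ℂ) (W : Matrix n J ℂ) (f : I → ℝ) (j : J) :
    ((∑ i, f i * ov V W i j : ℝ) : ℂ) = (Wᴴ * (V * dg f * Vᴴ) * W) j j := by
  have : Wᴴ * (V * dg f * Vᴴ) * W = (Vᴴ * W)ᴴ * dg f * (Vᴴ * W) := by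
    rw [conjTranspose_mul, conjTranspose_conjTranspose]; simp only [Matrix.mul_assoc]
  rw [this, mul_apply]
  push_cast
  refine Finset.sum_congr rfl fun i _ => ?_
  simp only [dg, mul_diagonal, conjTranspose_apply, ov, Complex.normSq_eq_conj_mul_self]
  simp
  ring

lemma ov_comm (V : Matrix n I ℂ) (W : Matrix n J ℂ) (i : I) (j : J) : ov V W i j = ov W V j i := by
  unfold ov
  have : (Wᴴ * V) j i = star ((Vᴴ * W) i j) := by
    rw [← conjTranspose_apply, conjTranspose_mul, conjTranspose_conjTranspose]
  rw [this]; simp [Complex.normSq_conj]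

lemma sum_ov_left {V : Matrix n I ℂ} {W : Matrix n J ℂ} (hV : V * Vᴴ = 1) (hW : Wᴴ * W = 1)
    (j : J) : ∑ i, ov V W i j = 1 := by
  have := sum_mul_ov V W (fun _ => 1) j
  have h1 : dg (fun _ : I => (1 : ℝ)) = 1 := by simp [dg]
  rw [h1, Matrix.mul_one, hV, Matrix.mul_one, hW] at this
  simp only [one_mul, one_apply_eq] at this
  exact_mod_cast this

lemma sum_ov_right {V : Matrix n I ℂ} {W : Matrix n J ℂ} (hV : Vᴴ * V = 1) (hW : W * Wᴴ = 1)
    (i : I) : ∑ j, ov V W i j = 1 := by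
  simp_rw [ov_comm V W]
  exact sum_ov_left hW hV i

lemma IsDiag.trace_mul {A B : Matrix n n ℂ} {V : Matrix n I ℂ} {W : Matrix n J ℂ} {a : I → ℝ}
    {b : J → ℝ} (hA : IsDiag A V a) (hB : IsDiag B W b) :
    (A * B).trace.re = ∑ i, ∑ j, a i * b j * ov V W i j := by
  rw [hA.eq, hB.eq, trace_conj_dg_mul_conj_dg, Complex.ofReal_re]

lemma IsDiag.trace_re {A : Matrix n n ℂ} {V : Matrix n I ℂ} {a : I → ℝ} (hA : IsDiag A V a) :
    A.trace.re = ∑ i, a i := by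
  rw [hA.eq, trace_mul_comm, ← Matrix.mul_assoc, hA.iso, Matrix.one_mul]
  simp [trace, dg]

lemma trace_mul_nonneg {A B : Matrix n n ℂ} (hA : A.PosSemidef) (hB : B.PosSemidef) :
    0 ≤ (A * B).trace.re := by
  obtain ⟨U, a, h⟩ := exists_isDiag hA.1
  obtain ⟨U', b, h'⟩ := exists_isDiag hB.1
  rw [h.trace_mul h']
  exact Finset.sum_nonneg fun i _ => Finset.sum_nonneg fun j _ =>
    mul_nonneg (mul_nonneg (h.nonneg hA i) (h'.nonneg hB j)) (ov_nonneg _ _ _ _)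

lemma trace_mul_le_of_le {A B C : Matrix n n ℂ} (hA : A.PosSemidef) (h : B ≤ C) :
    (A * B).trace.re ≤ (A * C).trace.re := by
  have := trace_mul_nonneg hA (le_iff.1 h)
  rw [Matrix.mul_sub, trace_sub, Complex.sub_re] at this
  linarith

end Overlap

/-! ### Relative entropy, Klein's inequality and the Holevo bound -/

section Entropy

variable {m n I J : Type*} [Fintype m] [DecidableEq m] [Fintype n] [DecidableEq n]
  [Fintype I] [DecidableEq I] [Fintype J] [DecidableEq J]

/-- `Re tr (ρ log σ)`. -/
def crossLog (ρ σ : Matrix n n ℂ) : ℝ := (ρ * matLog σ).trace.re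

/-- The value of the relative entropy when the supports are nested. -/
def relEnt (ρ σ : Matrix n n ℂ) : ℝ := crossLog ρ ρ - crossLog ρ σ

lemma re_trace_mul_sub_log (ρ σ : Matrix n n ℂ) :
    (ρ * (matLog ρ - matLog σ)).trace.re = relEnt ρ σ := by
  simp [relEnt, crossLog, Matrix.mul_sub]

lemma crossLog_add (ρ ρ' σ : Matrix n n ℂ) :
    crossLog (ρ + ρ') σ = crossLog ρ σ + crossLog ρ' σ := by
  simp [crossLog, Matrix.add_mul]

lemma crossLog_smul (c : ℝ) (ρ σ : Matrix n n ℂ) :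
    crossLog ((c : ℂ) • ρ) σ = c * crossLog ρ σ := by
  simp [crossLog]

lemma crossLog_sum {K : Type*} (s : Finset K) (ρ : K → Matrix n n ℂ) (σ : Matrix n n ℂ) :
    crossLog (∑ k ∈ s, ρ k) σ = ∑ k ∈ s, crossLog (ρ k) σ := by
  simp [crossLog, Matrix.sum_mul, trace_sum]

lemma IsDiag.log {A : Matrix n n ℂ} {V : Matrix n I ℂ} {a : I → ℝ} (h : IsDiag A V a) :
    IsDiag (matLog A) V (fun i => Real.log (a i)) :=
  h.cfc Real.log_zero

lemma IsDiag.crossLog_eq {σ : Matrix n n ℂ} {W : Matrix n I ℂ} {s : I → ℝ} (h : IsDiag σ W s)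
    (ρ : Matrix n n ℂ) : crossLog ρ σ = ∑ j, Real.log (s j) * ((Wᴴ * ρ * W) j j).re := by
  rw [crossLog, trace_mul_comm, h.log.eq, trace_conj_dg_mul]
  simp

lemma IsDiag.crossLog_self {ρ : Matrix n n ℂ} {V : Matrix n I ℂ} {r : I → ℝ} (h : IsDiag ρ V r) :
    crossLog ρ ρ = ∑ i, r i * Real.log (r i) := by
  rw [h.crossLog_eq]
  refine Finset.sum_congr rfl fun i _ => ?_
  rw [h.apply_diag, Complex.ofReal_re, mul_comm]

lemma IsDiag.sum_overlap {ρ : Matrix n n ℂ} {V : Matrix n I ℂ} {r : I → ℝ} (h : IsDiag ρ V r)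
    (W : Matrix n J ℂ) (j : J) : ∑ i, r i * ov V W i j = ((Wᴴ * ρ * W) j j).re := by
  have := sum_mul_ov V W r j
  rw [← h.eq] at this
  rw [← this, Complex.ofReal_re]

/-- A scalar inequality below the integrand of the relative entropy, tested on all pairs of
eigenvalues, bounds the relative entropy. -/
lemma sum_le_relEnt {ρ σ : Matrix n n ℂ} {V W : Matrix n n ℂ} {r s : n → ℝ}
    (hρ : IsDiag ρ V r) (hσ : IsDiag σ W s) (hr : ∀ i, 0 ≤ r i) (hs : ∀ j, 0 ≤ s j)
    (hac : ∀ j, s j = 0 → ((Wᴴ * ρ * W) j j).re = 0) {k : ℝ → ℝ → ℝ}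
    (hk : ∀ x y, 0 ≤ x → 0 < y → k x y ≤ x * Real.log x - x * Real.log y) (hk0 : k 0 0 ≤ 0) :
    ∑ i, ∑ j, k (r i) (s j) * ov V W i j ≤ relEnt ρ σ := by
  have h1 : relEnt ρ σ
      = ∑ i, ∑ j, (r i * Real.log (r i) - r i * Real.log (s j)) * ov V W i j := by
    rw [relEnt, hρ.crossLog_self, hσ.crossLog_eq]
    simp_rw [sub_mul, Finset.sum_sub_distrib]
    congr 1
    · refine Finset.sum_congr rfl fun i _ => ?_
      rw [← Finset.mul_sum, sum_ov_right hρ.iso hσ.unitary, mul_one]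
    · rw [Finset.sum_comm]
      refine Finset.sum_congr rfl fun j _ => ?_
      rw [← hρ.sum_overlap, Finset.mul_sum]
      exact Finset.sum_congr rfl fun i _ => by ring
  rw [h1]
  refine Finset.sum_le_sum fun i _ => Finset.sum_le_sum fun j _ => ?_
  -- At a zero eigenvalue of `σ`, absolute continuity makes `r i * ov V W i j` vanish; the condition
  -- on `k 0 0` serves the case `r i = 0`.
  rcases (hs j).eq_or_lt with h0 | h0
  · have hz := hac j h0.symm
    rw [← hρ.sum_overlap] at hz
    have hz' := (Finset.sum_eq_zero_iff_of_nonneg fun i _ =>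
      mul_nonneg (hr i) (ov_nonneg V W i j)).1 hz i (Finset.mem_univ _)
    rcases mul_eq_zero.1 hz' with h | h
    · rw [← h0, h]
      simp only [Real.log_zero, mul_zero, sub_zero, zero_mul]
      exact mul_nonpos_of_nonpos_of_nonneg hk0 (ov_nonneg _ _ _ _)
    · simp [h]
  · exact mul_le_mul_of_nonneg_right (hk _ _ (hr i) h0) (ov_nonneg _ _ _ _)

lemma mul_log_sub_ge {x y : ℝ} (hx : 0 ≤ x) (hy : 0 < y) :
    x - y ≤ x * Real.log x - x * Real.log y := by
  rcases hx.eq_or_lt with rfl | hx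
  · simp; exact hy.le
  · have := Real.log_le_sub_one_of_pos (div_pos hy hx)
    rw [Real.log_div hy.ne' hx.ne'] at this
    have h2 := mul_le_mul_of_nonneg_left this hx.le
    have : x * (y / x - 1) = y - x := by field_simp
    linarith

/-- Klein's inequality. -/
lemma klein {ρ σ : Matrix n n ℂ} {W : Matrix n n ℂ} {s : n → ℝ}
    (hρ : ρ.PosSemidef) (hσ : σ.PosSemidef) (hW : IsDiag σ W s)
    (hac : ∀ j, s j = 0 → ((Wᴴ * ρ * W) j j).re = 0) :
    ρ.trace.re - σ.trace.re ≤ relEnt ρ σ := by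
  obtain ⟨V, r, hV⟩ := exists_isDiag hρ.1
  have := sum_le_relEnt hV hW (hV.nonneg hρ) (hW.nonneg hσ) hac (k := fun x y => x - y)
    (fun x y hx hy => mul_log_sub_ge hx hy) (by simp)
  refine le_trans (le_of_eq ?_) this
  simp_rw [sub_mul, Finset.sum_sub_distrib]
  congr 1
  · rw [hV.trace_re]
    exact Finset.sum_congr rfl fun i _ => by
      rw [← Finset.mul_sum, sum_ov_right hV.iso hW.unitary, mul_one]
  · rw [hW.trace_re, Finset.sum_comm]
    exact Finset.sum_congr rfl fun i _ => by
      rw [← Finset.mul_sum, sum_ov_left hV.unitary hW.iso, mul_one]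

/-- On a null eigenvector of `σ` the quadratic form of `ρ` is squeezed between `0` and `c * 0`. -/
lemma IsDiag.ac_of_le {ρ σ : Matrix n n ℂ} {W : Matrix n I ℂ} {s : I → ℝ} (hW : IsDiag σ W s)
    (hρ : ρ.PosSemidef) {c : ℝ} (h : ρ ≤ (c : ℂ) • σ) (j : I) (hj : s j = 0) :
    ((Wᴴ * ρ * W) j j).re = 0 := by
  have h1 := posSemidef_diag_re_nonneg hρ W j
  have h2 := posSemidef_diag_re_nonneg (le_iff.1 h) W j
  rw [Matrix.mul_sub, Matrix.sub_mul, Matrix.mul_smul, Matrix.smul_mul, Matrix.sub_apply, Matrix.smul_apply,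
    hW.apply_diag, hj] at h2
  simp at h2
  linarith

lemma klein_posDef {ρ σ : Matrix n n ℂ} (hρ : ρ.PosSemidef) (hσ : σ.PosDef) :
    ρ.trace.re - σ.trace.re ≤ relEnt ρ σ := by
  obtain ⟨W, s, hW⟩ := exists_isDiag hσ.1
  exact klein hρ hσ.posSemidef hW fun j hj => absurd hj (hW.pos hσ j).ne'

lemma klein_of_le {ρ σ : Matrix n n ℂ} (hρ : ρ.PosSemidef) (hσ : σ.PosSemidef) {c : ℝ}
    (h : ρ ≤ (c : ℂ) • σ) : ρ.trace.re - σ.trace.re ≤ relEnt ρ σ := by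
  obtain ⟨W, s, hW⟩ := exists_isDiag hσ.1
  exact klein hρ hσ hW (hW.ac_of_le hρ h)

/-- Operator monotonicity of the logarithm, traced against a positive operator. The positivity of
`A` is what forces the regularizations by `η • 1` below. -/
lemma crossLog_mono {ρ A B : Matrix n n ℂ} (hρ : ρ.PosSemidef) (hA : A.PosDef) (h : A ≤ B) :
    crossLog ρ A ≤ crossLog ρ B :=
  trace_mul_le_of_le hρ (CFC.log_le_log h (isStrictlyPositive_iff_posDef.2 hA))

lemma crossLog_smul_right {ρ σ : Matrix n n ℂ} (hσ : σ.PosDef) {c : ℝ} (hc : 0 < c) :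
    crossLog ρ ((c : ℂ) • σ) = Real.log c * ρ.trace.re + crossLog ρ σ := by
  obtain ⟨W, s, hW⟩ := exists_isDiag hσ.1
  have h2 : IsDiag ((c : ℂ) • σ) W (fun i => c * s i) := by
    refine ⟨hW.iso, ?_⟩
    rw [hW.eq, ← Matrix.smul_mul, ← Matrix.mul_smul]
    congr 2
    ext i j; by_cases h : i = j <;> simp [dg, h]
  have h3 : ρ.trace.re = ∑ j, ((Wᴴ * ρ * W) j j).re := by
    have : ρ.trace = (Wᴴ * ρ * W).trace := by
      rw [Matrix.mul_assoc, trace_mul_comm, Matrix.mul_assoc, hW.unitary, Matrix.mul_one]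
    rw [this, trace, Complex.re_sum]; rfl
  rw [h2.crossLog_eq, hW.crossLog_eq, h3, Finset.mul_sum, ← Finset.sum_add_distrib]
  refine Finset.sum_congr rfl fun j _ => ?_
  rw [Real.log_mul hc.ne' (hW.pos hσ j).ne', add_mul]

/-- Concavity of `A ↦ tr (ρ log A)`. -/
lemma sum_crossLog_le {K : Type*} (s : Finset K) {ρ : Matrix n n ℂ} (hρ : ρ.PosSemidef) (w : K → ℝ)
    (hw : ∀ k ∈ s, 0 ≤ w k) (hw1 : ∑ k ∈ s, w k = 1) (A : K → Matrix n n ℂ)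
    (hA : ∀ k ∈ s, (A k).PosDef) :
    ∑ k ∈ s, w k * crossLog ρ (A k) ≤ crossLog ρ (∑ k ∈ s, (w k : ℂ) • A k) := by
  have h := (CFC.concaveOn_log (A := Matrix n n ℂ)).le_map_sum hw hw1
    (p := A) (fun k hk => isStrictlyPositive_iff_posDef.2 (hA k hk))
  have h2 := trace_mul_le_of_le hρ h
  have e : ∑ k ∈ s, w k • A k = ∑ k ∈ s, (w k : ℂ) • A k := by
    refine Finset.sum_congr rfl fun k _ => ?_
    ext i j; simp
  rw [e] at h2
  refine le_trans (le_of_eq ?_) h2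
  rw [Matrix.mul_sum, trace_sum, Complex.re_sum]
  refine Finset.sum_congr rfl fun k _ => ?_
  rw [Matrix.mul_smul, trace_smul, Complex.real_smul, Complex.re_ofReal_mul]
  rfl

lemma IsDiag.add_one {ρ V : Matrix n n ℂ} {r : n → ℝ} (h : IsDiag ρ V r) (η : ℝ) :
    IsDiag (ρ + (η : ℂ) • 1) V (fun i => r i + η) := by
  refine ⟨h.iso, ?_⟩
  have : (η : ℂ) • (1 : Matrix n n ℂ) = V * dg (fun _ => η) * Vᴴ := by
    have e : dg (fun _ : n => η) = (η : ℂ) • 1 := by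
      ext i j; by_cases hij : i = j <;> simp [dg, hij]
    rw [e, Matrix.mul_smul, Matrix.mul_one, Matrix.smul_mul, h.unitary]
  rw [this]
  conv_lhs => rw [h.eq]
  rw [← Matrix.add_mul, ← Matrix.mul_add]
  congr 2
  ext i j; by_cases hij : i = j <;> simp [dg, hij]

-- Continuity of `x log x` at `0`; it removes the regularization by `η • 1` from bounds that were
-- proved for positive definite operators.
open Filter Topology in
lemma tendsto_crossLog_self {ρ : Matrix n n ℂ} (hρ : ρ.IsHermitian) :
    Tendsto (fun η : ℝ => crossLog (ρ + (η : ℂ) • 1) (ρ + (η : ℂ) • 1)) (𝓝[>] 0)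
      (𝓝 (crossLog ρ ρ)) := by
  obtain ⟨V, r, h⟩ := exists_isDiag hρ
  have e : (fun η : ℝ => crossLog (ρ + (η : ℂ) • 1) (ρ + (η : ℂ) • 1))
      = fun η => ∑ i, (r i + η) * Real.log (r i + η) := by
    ext η; rw [(h.add_one η).crossLog_self]
  have hc : Continuous fun η => ∑ i, (r i + η) * Real.log (r i + η) :=
    continuous_finsetSum _ fun i _ =>
      Real.continuous_mul_log.comp (continuous_const.add continuous_id)
  rw [e, h.crossLog_self]
  have := hc.tendsto 0
  simp only [add_zero] at this
  exact this.mono_left nhdsWithin_le_nhds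

lemma posDef_add_smul_one {ρ : Matrix n n ℂ} (hρ : ρ.PosSemidef) {η : ℝ} (hη : 0 < η) :
    (ρ + (η : ℂ) • 1).PosDef := by
  obtain ⟨V, r, h⟩ := exists_isDiag hρ.1
  exact (h.add_one η).posDef fun i => add_pos_of_nonneg_of_pos (h.nonneg hρ i) hη

lemma trace_add_smul_one (ρ : Matrix n n ℂ) (η : ℝ) :
    (ρ + (η : ℂ) • 1).trace.re = ρ.trace.re + η * Fintype.card n := by
  simp [trace_add]

lemma sum_weight_add_smul_one {K : Type*} (s : Finset K) (w : K → ℝ) (hw1 : ∑ k ∈ s, w k = 1)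
    (ρ : K → Matrix n n ℂ) (η : ℝ) :
    ∑ k ∈ s, (w k : ℂ) • (ρ k + (η : ℂ) • (1 : Matrix n n ℂ))
      = ∑ k ∈ s, (w k : ℂ) • ρ k + (η : ℂ) • 1 := by
  simp_rw [smul_add, Finset.sum_add_distrib]
  rw [← Finset.sum_smul, ← Complex.ofReal_sum, hw1]
  simp

lemma smul_posSemidef {ρ : Matrix n n ℂ} (hρ : ρ.PosSemidef) {c : ℝ} (hc : 0 ≤ c) :
    ((c : ℂ) • ρ).PosSemidef := hρ.smul (by exact_mod_cast hc)

lemma le_inv_smul_of_smul_le {ρ σ : Matrix n n ℂ} {c : ℝ} (hc : 0 < c) (h : (c : ℂ) • ρ ≤ σ) :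
    ρ ≤ ((c⁻¹ : ℝ) : ℂ) • σ := by
  have h2 := smul_posSemidef (le_iff.1 h) (inv_nonneg.2 hc.le)
  rw [smul_sub, smul_smul, ← Complex.ofReal_mul, inv_mul_cancel₀ hc.ne', Complex.ofReal_one,
    one_smul] at h2
  exact le_iff.2 h2

lemma sum_smul_posSemidef {K : Type*} (s : Finset K) {w : K → ℝ} (hw : ∀ k ∈ s, 0 ≤ w k)
    {ρ : K → Matrix n n ℂ} (hρ : ∀ k ∈ s, (ρ k).PosSemidef) :
    (∑ k ∈ s, (w k : ℂ) • ρ k).PosSemidef :=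
  posSemidef_sum _ fun k hk => smul_posSemidef (hρ k hk) (hw k hk)

lemma smul_le_sum {K : Type*} (s : Finset K) {w : K → ℝ} (hw : ∀ k ∈ s, 0 ≤ w k)
    {ρ : K → Matrix n n ℂ} (hρ : ∀ k ∈ s, (ρ k).PosSemidef) {k : K} (hk : k ∈ s) :
    (w k : ℂ) • ρ k ≤ ∑ k ∈ s, (w k : ℂ) • ρ k :=
  Finset.single_le_sum (f := fun k => (w k : ℂ) • ρ k)
    (fun k hk => nonneg_iff_posSemidef.2 (smul_posSemidef (hρ k hk) (hw k hk))) hk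

/-- Concavity of the entropy: `∑ w tr ρ log ρ ≥ tr ρ̄ log ρ̄`. -/
lemma crossLog_self_sum_le {K : Type*} (s : Finset K) {w : K → ℝ} (hw : ∀ k ∈ s, 0 ≤ w k)
    (hw1 : ∑ k ∈ s, w k = 1)
    {ρ : K → Matrix n n ℂ} (hρ : ∀ k ∈ s, (ρ k).PosSemidef) :
    crossLog (∑ k ∈ s, (w k : ℂ) • ρ k) (∑ k ∈ s, (w k : ℂ) • ρ k)
      ≤ ∑ k ∈ s, w k * crossLog (ρ k) (ρ k) := by
  have hP := sum_smul_posSemidef s hw hρ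
  set ρb := ∑ k ∈ s, (w k : ℂ) • ρ k with hρb
  have h1 : ∀ k ∈ s, w k * ((ρ k).trace.re - ρb.trace.re) ≤ w k * relEnt (ρ k) ρb := by
    intro k hk
    rcases (hw k hk).eq_or_lt with h0 | h0
    · rw [← h0]; simp
    · refine mul_le_mul_of_nonneg_left ?_ h0.le
      refine klein_of_le (hρ k hk) hP (c := (w k)⁻¹) ?_
      exact le_inv_smul_of_smul_le h0 (smul_le_sum s hw hρ hk)
  have h2 := Finset.sum_le_sum h1
  simp only [relEnt, mul_sub, Finset.sum_sub_distrib] at h2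
  have e1 : ∑ k ∈ s, w k * (ρ k).trace.re = ρb.trace.re := by
    rw [hρb, trace_sum, Complex.re_sum]
    exact Finset.sum_congr rfl fun k _ => by simp [trace_smul]
  have e2 : ∑ k ∈ s, w k * crossLog (ρ k) ρb = crossLog ρb ρb := by
    conv_rhs => rw [hρb, crossLog_sum]
    exact Finset.sum_congr rfl fun k _ => by rw [crossLog_smul]
  have e3 : ∑ k ∈ s, w k * ρb.trace.re = ρb.trace.re := by rw [← Finset.sum_mul, hw1, one_mul]
  rw [e1, e2, e3] at h2
  linarith

open Filter Topology in
/-- The Holevo quantity of an ensemble of `L` equiprobable states is at most `log L`. -/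
lemma holevo_le_log {L : ℕ} (hL : 0 < L) {ρ : Fin L → Matrix n n ℂ} (hρ : ∀ l, (ρ l).PosSemidef)
    (htr : ∀ l, (ρ l).trace.re = 1) :
    ∑ l, (L : ℝ)⁻¹ * crossLog (ρ l) (ρ l)
      - crossLog (∑ l, (((L : ℝ)⁻¹ : ℝ) : ℂ) • ρ l) (∑ l, (((L : ℝ)⁻¹ : ℝ) : ℂ) • ρ l)
      ≤ Real.log L := by
  have hL' : (0 : ℝ) < L := by exact_mod_cast hL
  have hw1 : ∑ _l : Fin L, (L : ℝ)⁻¹ = 1 := by simp [hL'.ne']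
  set ρb := ∑ l, (((L : ℝ)⁻¹ : ℝ) : ℂ) • ρ l with hρb
  have hPb : ρb.PosSemidef := sum_smul_posSemidef _ (fun _ _ => by positivity) fun l _ => hρ l
  -- The bound is proved for operators shifted by `η`, whose trace is `1 + η * card n`, and then `η`
  -- tends to `0`.
  have key : ∀ η : ℝ, 0 < η →
      ∑ l, (L : ℝ)⁻¹ * crossLog (ρ l + (η : ℂ) • 1) (ρ l + (η : ℂ) • 1)
        - crossLog (ρb + (η : ℂ) • 1) (ρb + (η : ℂ) • 1)
        ≤ Real.log L * (1 + η * Fintype.card n) := by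
    intro η hη
    have e1 := sum_weight_add_smul_one Finset.univ _ hw1 ρ η
    rw [← hρb] at e1
    have hpd : ∀ l, (ρ l + (η : ℂ) • 1).PosDef := fun l => posDef_add_smul_one (hρ l) hη
    have hb := posDef_add_smul_one hPb hη
    set X := ρb + (η : ℂ) • (1 : Matrix n n ℂ)
    have h1 : ∀ l, crossLog (ρ l + (η : ℂ) • 1) (ρ l + (η : ℂ) • 1)
        ≤ Real.log L * (1 + η * Fintype.card n) + crossLog (ρ l + (η : ℂ) • 1) X := by
      intro l
      -- Each member of a uniform ensemble is at most `L` times the average; operator monotonicity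
      -- turns the factor into `log L`.
      have hle : (ρ l + (η : ℂ) • 1) ≤ ((L : ℝ) : ℂ) • X := by
        have h2 := smul_le_sum Finset.univ (w := fun _ : Fin L => (L : ℝ)⁻¹)
          (ρ := fun l => ρ l + (η : ℂ) • 1) (fun _ _ => by positivity)
          (fun l _ => (hpd l).posSemidef) (Finset.mem_univ l)
        rw [e1] at h2
        simpa using le_inv_smul_of_smul_le (inv_pos.2 hL') h2
      refine (crossLog_mono (hpd l).posSemidef (hpd l) hle).trans (le_of_eq ?_)
      rw [crossLog_smul_right hb hL', trace_add_smul_one, htr]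
    have h2 : crossLog X X = ∑ l, (L : ℝ)⁻¹ * crossLog (ρ l + (η : ℂ) • 1) X := by
      conv_lhs => rw [← e1, crossLog_sum, e1]
      exact Finset.sum_congr rfl fun l _ => by rw [crossLog_smul]
    rw [h2, ← Finset.sum_sub_distrib]
    calc _ ≤ ∑ _l : Fin L, (L : ℝ)⁻¹ * (Real.log L * (1 + η * Fintype.card n)) := by
          refine Finset.sum_le_sum fun l _ => ?_
          rw [← mul_sub]
          exact mul_le_mul_of_nonneg_left (by linarith [h1 l]) (by positivity)
      _ = _ := by rw [← Finset.sum_mul, hw1, one_mul]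
  have t1 : Tendsto (fun η : ℝ =>
      ∑ l, (L : ℝ)⁻¹ * crossLog (ρ l + (η : ℂ) • 1) (ρ l + (η : ℂ) • 1)
        - crossLog (ρb + (η : ℂ) • 1) (ρb + (η : ℂ) • 1)) (𝓝[>] 0)
      (𝓝 (∑ l, (L : ℝ)⁻¹ * crossLog (ρ l) (ρ l) - crossLog ρb ρb)) :=
    (tendsto_finsetSum _ fun l _ => (tendsto_crossLog_self (hρ l).1).const_mul _).sub
      (tendsto_crossLog_self hPb.1)
  have t2 : Tendsto (fun η : ℝ => Real.log L * (1 + η * Fintype.card n)) (𝓝[>] 0)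
      (𝓝 (Real.log L)) := by
    have : Continuous fun η : ℝ => Real.log L * (1 + η * Fintype.card n) := by fun_prop
    have := this.tendsto 0
    simp only [zero_mul, add_zero, mul_one] at this
    exact this.mono_left nhdsWithin_le_nhds
  exact le_of_tendsto_of_tendsto t1 t2 (eventually_mem_nhdsWithin.mono fun η hη => key η hη)

end Entropy

/-! ### Continuity of the Holevo quantity in trace norm -/

section Continuity

variable {m n I J : Type*} [Fintype m] [DecidableEq m] [Fintype n] [DecidableEq n]
  [Fintype I] [DecidableEq I] [Fintype J] [DecidableEq J]

lemma trace_re_pos [Nonempty n] {P : Matrix n n ℂ} (hP : P.PosDef) : 0 < P.trace.re := by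
  obtain ⟨V, r, h⟩ := exists_isDiag hP.1
  rw [h.trace_re]
  exact Finset.sum_pos (fun i _ => h.pos hP i) Finset.univ_nonempty

lemma posDef_add {P Q : Matrix n n ℂ} (hP : P.PosDef) (hQ : Q.PosSemidef) : (P + Q).PosDef :=
  hP.add_posSemidef hQ

lemma le_add_posSemidef (P : Matrix n n ℂ) {Q : Matrix n n ℂ} (hQ : Q.PosSemidef) : P ≤ P + Q := by
  rw [le_iff]; simpa using hQ

/-- Both `P` and `Q` lie below `P + Q`, and the logarithm is operator monotone. -/
lemma crossLog_self_add_ge {P Q : Matrix n n ℂ} (hP : P.PosDef) (hQ : Q.PosDef) :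
    crossLog P P + crossLog Q Q ≤ crossLog (P + Q) (P + Q) := by
  rw [crossLog_add]
  refine add_le_add (crossLog_mono hP.posSemidef hP (le_add_posSemidef P hQ.posSemidef))
    (crossLog_mono hQ.posSemidef hQ ?_)
  rw [add_comm]; exact le_add_posSemidef Q hP.posSemidef

/-- Klein's inequality after `X` is rescaled to the trace of `P`. -/
lemma crossLog_le_of_trace [Nonempty n] {P X : Matrix n n ℂ} (hP : P.PosDef) (hX : X.PosDef) :
    crossLog P X ≤ crossLog P P + P.trace.re * (Real.log X.trace.re - Real.log P.trace.re) := by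
  have hp := trace_re_pos hP
  have hx := trace_re_pos hX
  have hc : 0 < P.trace.re / X.trace.re := div_pos hp hx
  have hk := klein_posDef hP.posSemidef (hX.smul (a := ((P.trace.re / X.trace.re : ℝ) : ℂ))
    (by exact_mod_cast hc))
  rw [relEnt, crossLog_smul_right hX hc, Real.log_div hp.ne' hx.ne'] at hk
  have : (((P.trace.re / X.trace.re : ℝ) : ℂ) • X).trace.re = P.trace.re := by
    rw [trace_smul, smul_eq_mul, Complex.re_ofReal_mul]; field_simp
  rw [this] at hk
  nlinarith

/-- A converse to superadditivity: the defect is an entropy of the two traces alone, hence free of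
the dimension. -/
lemma crossLog_self_add_le [Nonempty n] {P Q : Matrix n n ℂ} (hP : P.PosDef) (hQ : Q.PosDef) :
    crossLog (P + Q) (P + Q) ≤ crossLog P P + crossLog Q Q
      + ((P.trace.re + Q.trace.re) * Real.log (P.trace.re + Q.trace.re)
        - P.trace.re * Real.log P.trace.re - Q.trace.re * Real.log Q.trace.re) := by
  have hX := posDef_add hP hQ.posSemidef
  have h1 := crossLog_le_of_trace hP hX
  have h2 := crossLog_le_of_trace hQ hX
  rw [trace_add, Complex.add_re] at h1 h2
  rw [crossLog_add]
  linarith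

/-- Holevo quantity of the perturbations `T + R m` of a fixed operator. -/
lemma holevo_perturb_le {M : ℕ} (hM : 0 < M) {T : Matrix n n ℂ} (hT : T.PosDef)
    {R : Fin M → Matrix n n ℂ} (hR : ∀ m, (R m).PosSemidef) :
    ∑ m, (M : ℝ)⁻¹ * crossLog (T + R m) (T + R m)
      - crossLog (∑ m, (((M : ℝ)⁻¹ : ℝ) : ℂ) • (T + R m)) (∑ m, (((M : ℝ)⁻¹ : ℝ) : ℂ) • (T + R m))
      ≤ Real.log M * ∑ m, (M : ℝ)⁻¹ * (R m).trace.re := by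
  have hM' : (0 : ℝ) < M := by exact_mod_cast hM
  have hw1 : ∑ _l : Fin M, (M : ℝ)⁻¹ = 1 := by simp [hM'.ne']
  have hpd : ∀ m, (T + R m).PosDef := fun m => posDef_add hT (hR m)
  have hb : (∑ m, (((M : ℝ)⁻¹ : ℝ) : ℂ) • (T + R m)).PosDef := by
    have : ∑ m, (((M : ℝ)⁻¹ : ℝ) : ℂ) • (T + R m) = T + ∑ m, (((M : ℝ)⁻¹ : ℝ) : ℂ) • R m := by
      simp_rw [smul_add, Finset.sum_add_distrib, ← Finset.sum_smul, ← Complex.ofReal_sum, hw1]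
      simp
    rw [this]
    exact posDef_add hT (sum_smul_posSemidef _ (fun _ _ => by positivity) fun m _ => hR m)
  have hle : ∀ m, T + R m ≤ ((M : ℝ) : ℂ) • ∑ m, (((M : ℝ)⁻¹ : ℝ) : ℂ) • (T + R m) := by
    intro m
    simpa using le_inv_smul_of_smul_le (inv_pos.2 hM') (smul_le_sum Finset.univ
      (w := fun _ : Fin M => (M : ℝ)⁻¹) (ρ := fun m => T + R m) (fun _ _ => by positivity)
          (fun l _ => (hpd l).posSemidef) (Finset.mem_univ m))
  -- The fixed part `T` contributes nothing positive, by concavity of the logarithm; only the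
  -- perturbations `R m` pay, through `T + R m ≤ M • X`.
  have hconc := sum_crossLog_le Finset.univ hT.posSemidef (fun _ : Fin M => (M : ℝ)⁻¹)
    (fun _ _ => by positivity) hw1 (fun m => T + R m) (fun m _ => hpd m)
  set X := ∑ m, (((M : ℝ)⁻¹ : ℝ) : ℂ) • (T + R m) with hX
  have h2 : crossLog X X = ∑ m, (M : ℝ)⁻¹ * crossLog (T + R m) X := by
    conv_lhs => rw [hX, crossLog_sum, ← hX]
    exact Finset.sum_congr rfl fun l _ => by rw [crossLog_smul]
  have h3 : ∀ m, crossLog (R m) (T + R m) ≤ Real.log M * (R m).trace.re + crossLog (R m) X := by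
    intro m
    refine (crossLog_mono (hR m) (hpd m) (hle m)).trans (le_of_eq ?_)
    rw [crossLog_smul_right hb hM']
  have h4 : ∑ _m : Fin M, (M : ℝ)⁻¹ * crossLog T X = crossLog T X := by
    rw [← Finset.sum_mul, hw1, one_mul]
  have h5 : ∑ m, (M : ℝ)⁻¹ * crossLog (R m) (T + R m)
      ≤ ∑ m, (M : ℝ)⁻¹ * (Real.log M * (R m).trace.re + crossLog (R m) X) :=
    Finset.sum_le_sum fun m _ => mul_le_mul_of_nonneg_left (h3 m) (by positivity)
  rw [h2]
  simp only [crossLog_add _ (R _), mul_add, Finset.sum_add_distrib] at *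
  rw [h4]
  have h6 : ∑ m, (M : ℝ)⁻¹ * (Real.log M * (R m).trace.re)
      = Real.log M * ∑ m, (M : ℝ)⁻¹ * (R m).trace.re := by
    rw [Finset.mul_sum]; exact Finset.sum_congr rfl fun m _ => by ring
  linarith

lemma IsDiag.traceNorm {Q V : Matrix n n ℂ} {q : n → ℝ} (h : IsDiag Q V q) :
    traceNorm Q = ∑ i, |q i| := by
  have h2 : IsDiag (Qᴴ * Q) V (fun i => q i * q i) := by
    refine ⟨h.iso, ?_⟩
    rw [h.isHermitian]
    conv_lhs => rw [h.eq]
    rw [conj_dg_mul h.iso]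
  rw [CovertSecrecy.traceNorm, (h2.cfc Real.sqrt_zero).trace_re]
  exact Finset.sum_congr rfl fun i _ => by rw [Real.sqrt_mul_self_eq_abs]

/-- Jordan decomposition of a difference of two states. -/
lemma exists_jordan {ρ τ : Matrix n n ℂ} (hρ : ρ.PosSemidef) (hτ : τ.PosSemidef)
    (h1 : ρ.trace.re = τ.trace.re) :
    ∃ P N : Matrix n n ℂ, P.PosSemidef ∧ N.PosSemidef ∧ ρ + N = τ + P ∧
      P.trace.re = traceNorm (ρ - τ) / 2 ∧ N.trace.re = traceNorm (ρ - τ) / 2 := by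
  obtain ⟨V, q, h⟩ := exists_isDiag (hρ.1.sub hτ.1)
  have hp := h.cfc_sq (fun x => max x 0)
  have hn := h.cfc_sq (fun x => max (-x) 0)
  refine ⟨_, _, hp.posSemidef fun i => le_max_right _ _, hn.posSemidef fun i => le_max_right _ _,
    ?_, ?_, ?_⟩
  · have : ρ - τ = cfc (fun x : ℝ => max x 0) (ρ - τ) - cfc (fun x : ℝ => max (-x) 0) (ρ - τ) := by
      rw [hp.eq, hn.eq, ← Matrix.sub_mul, ← Matrix.mul_sub]
      conv_lhs => rw [h.eq]
      congr 2
      ext i j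
      by_cases hij : i = j
      · subst hij
        simp only [dg, diagonal_apply_eq, Matrix.sub_apply]
        rw [← Complex.ofReal_sub]
        congr 1
        rcases le_total 0 (q i) with h | h <;> simp [h]
      · simp [dg, hij]
    rw [eq_sub_iff_add_eq] at this
    rw [← sub_eq_iff_eq_add']
    rw [← this]; abel
  all_goals
    have ht := h.trace_re
    rw [trace_sub, Complex.sub_re, h1, sub_self] at ht
    first
    | rw [hp.trace_re] | rw [hn.trace_re]
    rw [h.traceNorm]
    have e : ∀ x : ℝ, max x 0 = (|x| + x) / 2 ∧ max (-x) 0 = (|x| - x) / 2 := fun x => by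
      rcases le_total 0 x with h | h
      · simp [h, abs_of_nonneg]
      · simp [h, abs_of_nonpos]; ring
    first
    | simp only [(e _).2, ← Finset.sum_div, Finset.sum_sub_distrib, ← ht, sub_zero]
    | simp only [(e _).1, ← Finset.sum_div, Finset.sum_add_distrib, ← ht, add_zero]

/-- Crude but sufficient: the first term is at most `(1 + t) * t ≤ 2` and the second at most `1`.
Any absolute constant is negligible beside `√n`. -/
lemma entropy_gap_bound {t : ℝ} (h0 : 0 ≤ t) (h1 : t ≤ 1) :
    (1 + t) * Real.log (1 + t) - t * Real.log t ≤ 3 := by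
  have a1 : Real.log (1 + t) ≤ t := by
    have := Real.log_le_sub_one_of_pos (show 0 < 1 + t by linarith); linarith
  have a2 : -(t * Real.log t) ≤ 1 := by
    rcases h0.eq_or_lt with h | h
    · simp [← h]
    · have := Real.one_sub_inv_le_log_of_pos h
      have := mul_le_mul_of_nonneg_left this h0
      rw [mul_sub, mul_inv_cancel₀ h.ne'] at this
      linarith
  nlinarith

open Filter Topology in
/-- Alicki-Fannes type bound: if the states `ρ m` are on average close in trace norm to a common
state, then their Holevo quantity is small compared with `log M`. -/
lemma holevo_le_of_traceNorm {M : ℕ} (hM : 0 < M) {ρ : Fin M → Matrix n n ℂ} {τ : Matrix n n ℂ}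
    (hρ : ∀ m, (ρ m).PosSemidef) (hρ1 : ∀ m, (ρ m).trace.re = 1) (hτ : τ.PosSemidef)
    (hτ1 : τ.trace.re = 1) {δ : ℝ} (hδ1 : δ ≤ 1)
    (hδ : ∑ m, (M : ℝ)⁻¹ * traceNorm (ρ m - τ) ≤ δ) :
    ∑ m, (M : ℝ)⁻¹ * crossLog (ρ m) (ρ m)
      - crossLog (∑ m, (((M : ℝ)⁻¹ : ℝ) : ℂ) • ρ m) (∑ m, (((M : ℝ)⁻¹ : ℝ) : ℂ) • ρ m)
      ≤ δ * Real.log M + 3 := by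
  have hM' : (0 : ℝ) < M := by exact_mod_cast hM
  have hw1 : ∑ _l : Fin M, (M : ℝ)⁻¹ = 1 := by simp [hM'.ne']
  have hne : Nonempty n := by
    by_contra h
    rw [not_nonempty_iff] at h
    simp [trace] at hτ1
  -- Since `ρ m + N m = τ + P m`, the enlarged ensemble is a perturbation of the fixed `τ` and has
  -- Holevo quantity at most `t * log M`. Removing `N m` again costs only an entropy term in `t`, by
  -- superadditivity for each `m` and its near-converse for the average.
  choose P N hP hN hPN hPt hNt using fun m => exists_jordan (hρ m) hτ ((hρ1 m).trans hτ1.symm)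
  set t := ∑ m, (M : ℝ)⁻¹ * (traceNorm (ρ m - τ) / 2) with ht
  have htδ : t ≤ δ / 2 := by
    have : t = (∑ m, (M : ℝ)⁻¹ * traceNorm (ρ m - τ)) / 2 := by
      rw [ht, Finset.sum_div]; exact Finset.sum_congr rfl fun m _ => by ring
    linarith
  have ht0 : 0 ≤ t := by
    refine Finset.sum_nonneg fun m _ => mul_nonneg (by positivity) ?_
    rw [← hPt m]
    obtain ⟨V, r, h⟩ := exists_isDiag (hP m).1
    rw [h.trace_re]
    exact Finset.sum_nonneg fun i _ => h.nonneg (hP m) i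
  set ρb := ∑ m, (((M : ℝ)⁻¹ : ℝ) : ℂ) • ρ m with hρb
  set Nb := ∑ m, (((M : ℝ)⁻¹ : ℝ) : ℂ) • N m with hNb
  have hρbP : ρb.PosSemidef := sum_smul_posSemidef _ (fun _ _ => by positivity) fun l _ => hρ l
  have hNbP : Nb.PosSemidef := sum_smul_posSemidef _ (fun _ _ => by positivity) fun l _ => hN l
  have hρb1 : ρb.trace.re = 1 := by
    rw [hρb, trace_sum, Complex.re_sum]
    simp_rw [trace_smul, smul_eq_mul, Complex.re_ofReal_mul, hρ1, mul_one, hw1]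
  have hNb1 : Nb.trace.re = t := by
    rw [hNb, trace_sum, Complex.re_sum]
    simp_rw [trace_smul, smul_eq_mul, Complex.re_ofReal_mul, hNt, ht]
  set d := (Fintype.card n : ℝ)
  let g : ℝ → ℝ := fun η => Real.log M * t
    + (((1 + η * d) + (t + η * d)) * Real.log ((1 + η * d) + (t + η * d))
      - (1 + η * d) * Real.log (1 + η * d) - (t + η * d) * Real.log (t + η * d))
  have key : ∀ η : ℝ, 0 < η →
      ∑ m, (M : ℝ)⁻¹ * crossLog (ρ m + (η : ℂ) • 1) (ρ m + (η : ℂ) • 1)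
        - crossLog (ρb + (η : ℂ) • 1) (ρb + (η : ℂ) • 1) ≤ g η := by
    intro η hη
    have hρη : ∀ m, (ρ m + (η : ℂ) • 1).PosDef := fun m => posDef_add_smul_one (hρ m) hη
    have hNη : ∀ m, (N m + (η : ℂ) • 1).PosDef := fun m => posDef_add_smul_one (hN m) hη
    -- The shift is `2 * η` because `ρ m` and `N m` are each shifted by `η`.
    have hTη : (τ + ((2 * η : ℝ) : ℂ) • 1).PosDef := posDef_add_smul_one hτ (by positivity)
    have hX : ∀ m, (ρ m + (η : ℂ) • 1) + (N m + (η : ℂ) • 1)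
        = (τ + ((2 * η : ℝ) : ℂ) • 1) + P m := by
      intro m
      have : ((2 * η : ℝ) : ℂ) • (1 : Matrix n n ℂ) = (η : ℂ) • 1 + (η : ℂ) • 1 := by
        rw [← add_smul]; push_cast; ring_nf
      rw [this]
      have h := hPN m
      calc _ = (ρ m + N m) + ((η : ℂ) • 1 + (η : ℂ) • 1) := by abel
        _ = _ := by rw [h]; abel
    have a1 := holevo_perturb_le hM hTη hP
    simp_rw [← hX] at a1
    have e1 := sum_weight_add_smul_one Finset.univ _ hw1 ρ η
    have e2 := sum_weight_add_smul_one Finset.univ _ hw1 N η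
    have e3 : ∑ m, (((M : ℝ)⁻¹ : ℝ) : ℂ) • ((ρ m + (η : ℂ) • 1) + (N m + (η : ℂ) • 1))
        = (ρb + (η : ℂ) • 1) + (Nb + (η : ℂ) • 1) := by
      rw [← e1, ← e2, ← Finset.sum_add_distrib]
      simp_rw [smul_add]
    rw [e3] at a1
    have a2 := crossLog_self_add_le (posDef_add_smul_one hρbP hη) (posDef_add_smul_one hNbP hη)
    rw [trace_add_smul_one, trace_add_smul_one, hρb1, hNb1] at a2
    have a3 := crossLog_self_sum_le Finset.univ (w := fun _ : Fin M => (M : ℝ)⁻¹)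
      (fun _ _ => by positivity) hw1 (fun m _ => (hNη m).posSemidef)
    rw [e2] at a3
    have a4 : ∑ m, (M : ℝ)⁻¹ * (crossLog (ρ m + (η : ℂ) • 1) (ρ m + (η : ℂ) • 1)
          + crossLog (N m + (η : ℂ) • 1) (N m + (η : ℂ) • 1))
        ≤ ∑ m, (M : ℝ)⁻¹ * crossLog ((ρ m + (η : ℂ) • 1) + (N m + (η : ℂ) • 1))
          ((ρ m + (η : ℂ) • 1) + (N m + (η : ℂ) • 1)) :=
      Finset.sum_le_sum fun m _ =>
        mul_le_mul_of_nonneg_left (crossLog_self_add_ge (hρη m) (hNη m)) (by positivity)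
    simp_rw [mul_add, Finset.sum_add_distrib] at a4
    simp_rw [hPt] at a1
    rw [← ht] at a1
    simp only [g]
    linarith
  have t1 : Tendsto (fun η : ℝ =>
      ∑ m, (M : ℝ)⁻¹ * crossLog (ρ m + (η : ℂ) • 1) (ρ m + (η : ℂ) • 1)
        - crossLog (ρb + (η : ℂ) • 1) (ρb + (η : ℂ) • 1)) (𝓝[>] 0)
      (𝓝 (∑ m, (M : ℝ)⁻¹ * crossLog (ρ m) (ρ m) - crossLog ρb ρb)) :=
    (tendsto_finsetSum _ fun l _ => (tendsto_crossLog_self (hρ l).1).const_mul _).sub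
      (tendsto_crossLog_self hρbP.1)
  have t2 : Tendsto g (𝓝[>] 0) (𝓝 (g 0)) := by
    have hc : Continuous g := by
      refine continuous_const.add (((?_ : Continuous _).sub ?_).sub ?_)
      all_goals exact Real.continuous_mul_log.comp (by fun_prop)
    exact (hc.tendsto 0).mono_left nhdsWithin_le_nhds
  have h := le_of_tendsto_of_tendsto t1 t2 (eventually_mem_nhdsWithin.mono fun η hη => key η hη)
  refine h.trans ?_
  have hg0 : g 0 = Real.log M * t + ((1 + t) * Real.log (1 + t) - t * Real.log t) := by
    simp [g]
  rw [hg0]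
  have h1 := entropy_gap_bound ht0 (by linarith)
  have h2 : 0 ≤ Real.log M := Real.log_natCast_nonneg M
  nlinarith

end Continuity

/-! ### Hypothesis testing and a Pinsker-type inequality -/

section Tests

variable {m n I J : Type*} [Fintype m] [DecidableEq m] [Fintype n] [DecidableEq n]
  [Fintype I] [DecidableEq I] [Fintype J] [DecidableEq J]

lemma normSq_add_mul_min_le (a b : ℂ) {r s : ℝ} (hr : 0 ≤ r) (hs : 0 ≤ s) :
    min r s * Complex.normSq (a + b) ≤ 2 * (r * Complex.normSq a + s * Complex.normSq b) := by
  have h1 : Complex.normSq (a + b) ≤ 2 * (Complex.normSq a + Complex.normSq b) := by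
    have h2 := Complex.normSq_add a b
    have h3 := Complex.normSq_sub a b
    have h4 := Complex.normSq_nonneg (a - b)
    linarith
  have h5 : 0 ≤ min r s := le_min hr hs
  have h6 := mul_le_mul_of_nonneg_left h1 h5
  have h7 := mul_le_mul_of_nonneg_right (min_le_left r s) (Complex.normSq_nonneg a)
  have h8 := mul_le_mul_of_nonneg_right (min_le_right r s) (Complex.normSq_nonneg b)
  linarith

/-- `tr (A X B Xᴴ)` in eigenbases, for `Xᴴ = X`. -/
lemma trace_mul_mul_mul {A B : Matrix n n ℂ} {V W : Matrix n n ℂ} {a b : n → ℝ}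
    (hA : IsDiag A V a) (hB : IsDiag B W b) {X : Matrix n n ℂ} (hX : X.IsHermitian) :
    (A * X * B * X).trace.re = ∑ i, ∑ j, a i * b j * Complex.normSq ((Vᴴ * X * W) i j) := by
  have h1 : A * X * B * X = V * dg a * Vᴴ * (X * W * dg b * (X * W)ᴴ) := by
    rw [conjTranspose_mul, hX, ← hA.eq]
    conv_lhs => rw [hB.eq]
    simp only [Matrix.mul_assoc]
  rw [h1, trace_conj_dg_mul_conj_dg, Complex.ofReal_re]
  simp only [ov, Matrix.mul_assoc]

lemma sq_le_self_of_le_one {T : Matrix n n ℂ} (hT : T.PosSemidef) (hT1 : T ≤ 1) : T * T ≤ T := by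
  obtain ⟨V, t, h⟩ := exists_isDiag hT.1
  rw [le_iff]
  have h1 : ∀ i, t i ≤ 1 := by
    intro i
    have h2 := posSemidef_diag_re_nonneg (le_iff.1 hT1) V i
    rw [Matrix.mul_sub, Matrix.sub_mul, Matrix.sub_apply, h.apply_diag, Matrix.mul_one, h.iso] at h2
    simp at h2
    exact h2
  have h3 : T - T * T = V * dg (fun i => t i - t i * t i) * Vᴴ := by
    conv_lhs => rw [h.eq]
    rw [conj_dg_mul h.iso, ← Matrix.sub_mul, ← Matrix.mul_sub]
    congr 2
    ext i j; by_cases hij : i = j <;> simp [dg, hij]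
  rw [h3]
  refine conj_dg_posSemidef (fun i => ?_) V
  have := h.nonneg hT i
  nlinarith [h1 i]

/-- The errors of a quantum test are bounded below by the Nussbaum-Szkoła distributions. -/
lemma sum_min_ov_le {ρ σ T : Matrix n n ℂ} {V W : Matrix n n ℂ} {r s : n → ℝ}
    (hρ : IsDiag ρ V r) (hσ : IsDiag σ W s) (hr : ∀ i, 0 ≤ r i) (hs : ∀ j, 0 ≤ s j)
    (hT : T.PosSemidef) (hT1 : T ≤ 1) :
    ∑ i, ∑ j, min (r i) (s j) * ov V W i j
      ≤ 2 * (((1 - T) * ρ).trace.re + (T * σ).trace.re) := by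
  have hS : (1 - T).PosSemidef := le_iff.1 hT1
  have hS1 : 1 - T ≤ 1 := by rw [le_iff]; simpa using hT
  -- Squares of tests arise when overlaps are expanded; they are bounded by the tests themselves.
  have a1 : (ρ * (1 - T) * 1 * (1 - T)).trace.re ≤ ((1 - T) * ρ).trace.re := by
    have := trace_mul_le_of_le (hρ.posSemidef hr) (sq_le_self_of_le_one hS hS1)
    rw [trace_mul_comm (1 - T) ρ, Matrix.mul_one, Matrix.mul_assoc]
    exact this
  have a2 : (1 * T * σ * T).trace.re ≤ (T * σ).trace.re := by
    have := trace_mul_le_of_le (hσ.posSemidef hs) (sq_le_self_of_le_one hT hT1)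
    rw [trace_mul_comm T σ, Matrix.one_mul, trace_mul_comm, ← Matrix.mul_assoc, trace_mul_comm]
    exact this
  have hone : ∀ {U : Matrix n n ℂ} {u : n → ℝ} {A : Matrix n n ℂ}, IsDiag A U u →
      IsDiag (1 : Matrix n n ℂ) U (fun _ => 1) := fun h =>
    ⟨h.iso, by simp [dg, h.unitary]⟩
  rw [trace_mul_mul_mul hρ (hone hσ) hS.1] at a1
  rw [trace_mul_mul_mul (hone hρ) hσ hT.1] at a2
  simp only [one_mul, mul_one] at a1 a2
  have a3 : ∑ i, ∑ j, min (r i) (s j) * ov V W i j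
      ≤ ∑ i, ∑ j, 2 * (r i * Complex.normSq ((Vᴴ * (1 - T) * W) i j)
        + s j * Complex.normSq ((Vᴴ * T * W) i j)) := by
    refine Finset.sum_le_sum fun i _ => Finset.sum_le_sum fun j _ => ?_
    -- Inserting `1 = (1 - T) + T` into the overlap splits it into two amplitudes, one for each kind
    -- of error.
    have : (Vᴴ * W) i j = (Vᴴ * (1 - T) * W) i j + (Vᴴ * T * W) i j := by
      rw [← Matrix.add_apply, ← Matrix.add_mul, ← Matrix.mul_add]; simp
    rw [ov, this]
    exact normSq_add_mul_min_le _ _ (hr i) (hs j)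
  simp only [← Finset.mul_sum, Finset.sum_add_distrib] at a1 a2 a3
  linarith

lemma IsDiag.smul {A : Matrix n n ℂ} {V : Matrix n I ℂ} {a : I → ℝ} (h : IsDiag A V a) (c : ℝ) :
    IsDiag ((c : ℂ) • A) V (fun i => c * a i) := by
  refine ⟨h.iso, ?_⟩
  rw [h.eq, ← Matrix.smul_mul, ← Matrix.mul_smul]
  congr 2
  ext i j; by_cases hij : i = j <;> simp [dg, hij]

/-- Converse hypothesis-testing bound. -/
lemma log_mul_le_relEnt {ρ σ T : Matrix n n ℂ} {W : Matrix n n ℂ} {s : n → ℝ}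
    (hρ : ρ.PosSemidef) (hσ : σ.PosSemidef) (hρ1 : ρ.trace.re = 1) (hσ1 : σ.trace.re = 1)
    (hW : IsDiag σ W s) (hac : ∀ j, s j = 0 → ((Wᴴ * ρ * W) j j).re = 0)
    (hT : T.PosSemidef) (hT1 : T ≤ 1) {K : ℝ} (hK : 1 ≤ K) :
    Real.log K * (1 - 2 * (((1 - T) * ρ).trace.re + K * (T * σ).trace.re)) - 1
      ≤ relEnt ρ σ := by
  obtain ⟨V, r, hV⟩ := exists_isDiag hρ.1
  have hr := hV.nonneg hρ
  have hs := hW.nonneg hσ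
  have hK0 : 0 < K := by linarith
  have hlK : 0 ≤ Real.log K := Real.log_nonneg hK
  -- Where `x ≥ K * y`, the log-likelihood ratio is at least `log K`; elsewhere the minimum equals
  -- `x` and the estimate `x - y ≤ x log (x / y)` remains. The loss `- y` sums to the final `- 1`.
  have a1 := sum_le_relEnt hV hW hr hs hac
    (k := fun x y => Real.log K * (x - min x (K * y)) - y) (by
      intro x y hx hy
      rcases le_or_gt (K * y) x with h | h
      · have hx' : 0 < x := lt_of_lt_of_le (by positivity) h
        have h2 := Real.log_le_log (by positivity) h
        rw [Real.log_mul hK0.ne' hy.ne'] at h2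
        have h3 := mul_le_mul_of_nonneg_left h2 hx
        have h4 : 0 ≤ Real.log K * min x (K * y) := by positivity
        nlinarith
      · rw [min_eq_left h.le]
        have := mul_log_sub_ge hx hy
        simp; linarith) (by simp)
  have a2 := sum_min_ov_le hV (hW.smul K) hr (fun j => mul_nonneg hK0.le (hs j)) hT hT1
  have e1 : ∑ i, ∑ j, (Real.log K * (r i - min (r i) (K * s j)) - s j) * ov V W i j
      = Real.log K * (1 - ∑ i, ∑ j, min (r i) (K * s j) * ov V W i j) - 1 := by
    have b1 : ∑ i, ∑ j, r i * ov V W i j = 1 := by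
      rw [← hρ1, hV.trace_re]
      exact Finset.sum_congr rfl fun i _ => by
        rw [← Finset.mul_sum, sum_ov_right hV.iso hW.unitary, mul_one]
    have b2 : ∑ i, ∑ j, s j * ov V W i j = 1 := by
      rw [← hσ1, hW.trace_re, Finset.sum_comm]
      exact Finset.sum_congr rfl fun i _ => by
        rw [← Finset.mul_sum, sum_ov_left hV.unitary hW.iso, mul_one]
    simp only [sub_mul, mul_assoc, Finset.sum_sub_distrib, ← Finset.mul_sum] at b1 b2 ⊢
    rw [b1, b2]
  rw [e1] at a1
  have e2 : (T * ((K : ℂ) • σ)).trace.re = K * (T * σ).trace.re := by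
    rw [Matrix.mul_smul, trace_smul, smul_eq_mul, Complex.re_ofReal_mul]
  rw [e2] at a2
  nlinarith

/-- A linearized Pinsker inequality. -/
lemma traceNorm_le_relEnt {ρ σ : Matrix n n ℂ} {W : Matrix n n ℂ} {s : n → ℝ}
    (hρ : ρ.PosSemidef) (hσ : σ.PosSemidef) (hρ1 : ρ.trace.re = 1) (hσ1 : σ.trace.re = 1)
    (hW : IsDiag σ W s) (hac : ∀ j, s j = 0 → ((Wᴴ * ρ * W) j j).re = 0) {c : ℝ} (hc : 0 < c) :
    traceNorm (ρ - σ) ≤ c / 2 * relEnt ρ σ + 2 / c := by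
  obtain ⟨V, r, hV⟩ := exists_isDiag hρ.1
  have hr := hV.nonneg hρ
  have hs := hW.nonneg hσ
  have hA := hV.cfc_sq Real.sqrt
  have hB := hW.cfc_sq Real.sqrt
  set A := cfc Real.sqrt ρ
  set B := cfc Real.sqrt σ
  have hAA : A * A = ρ := by
    rw [hA.eq, conj_dg_mul hA.iso]
    conv_rhs => rw [hV.eq]
    congr 3; ext i; exact Real.mul_self_sqrt (hr i)
  have hBB : B * B = σ := by
    rw [hB.eq, conj_dg_mul hB.iso]
    conv_rhs => rw [hW.eq]
    congr 3; ext i; exact Real.mul_self_sqrt (hs i)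
  set f := (A * B).trace.re with hf
  have hfe : f = ∑ i, ∑ j, √(r i) * √(s j) * ov V W i j := hA.trace_mul hB
  -- From `log u ≤ u - 1` at `u = √y / √x`; the quantity `f` is the affinity `tr √ρ √σ`.
  have a1 : 2 * (1 - f) ≤ relEnt ρ σ := by
    have := sum_le_relEnt hV hW hr hs hac (k := fun x y => 2 * (x - √x * √y)) (by
      intro x y hx hy
      rcases hx.eq_or_lt with rfl | hx'
      · simp
      · have h1 := Real.log_le_sub_one_of_pos (div_pos (Real.sqrt_pos.2 hy) (Real.sqrt_pos.2 hx'))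
        rw [Real.log_div (Real.sqrt_pos.2 hy).ne' (Real.sqrt_pos.2 hx').ne', Real.log_sqrt hx,
          Real.log_sqrt hy.le] at h1
        have h2 := mul_le_mul_of_nonneg_left h1 hx
        have h3 : x * (√y / √x - 1) = √x * √y - x := by
          have : x = √x * √x := (Real.mul_self_sqrt hx).symm
          have h0 : √x ≠ 0 := (Real.sqrt_pos.2 hx').ne'
          calc x * (√y / √x - 1) = (√x * √x) * (√y / √x) - x := by rw [← this]; ring
            _ = _ := by field_simp
        nlinarith) (by simp)
    refine le_trans (le_of_eq ?_) this
    have b1 : ∑ i, ∑ j, r i * ov V W i j = 1 := by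
      rw [← hρ1, hV.trace_re]
      exact Finset.sum_congr rfl fun i _ => by
        rw [← Finset.mul_sum, sum_ov_right hV.iso hW.unitary, mul_one]
    simp only [mul_assoc, sub_mul, Finset.sum_sub_distrib, ← Finset.mul_sum] at b1 hfe ⊢
    rw [b1, hfe]
  have hXX : ((A - B) * (A - B)).trace.re = 2 - 2 * f := by
    simp only [Matrix.mul_sub, Matrix.sub_mul, hAA, hBB, trace_sub, Complex.sub_re, hρ1, hσ1,
      trace_mul_comm B A]
    rw [← hf]; ring
  have hYY : ((A + B) * (A + B)).trace.re = 2 + 2 * f := by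
    simp only [Matrix.mul_add, Matrix.add_mul, hAA, hBB, trace_add, Complex.add_re, hρ1, hσ1,
      trace_mul_comm B A]
    rw [← hf]; ring
  have hAh := hA.isHermitian
  have hBh := hB.isHermitian
  have hX2 : 0 ≤ ((A - B) * (A - B)).trace.re := by
    have : (A - B) * (A - B) = (A - B)ᴴ * (A - B) := by rw [(hAh.sub hBh)]
    rw [this]
    exact (Complex.le_def.1 (posSemidef_conjTranspose_mul_self (A - B)).trace_nonneg).1
  have hf1 : f ≤ 1 := by linarith
  obtain ⟨U, q, hU⟩ := exists_isDiag (hρ.1.sub hσ.1)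
  rw [hU.traceNorm]
  -- As `2(ρ - σ)` is the anticommutator of `A - B` and `A + B`, completing a square gives `Z ± 2(ρ
  -- - σ) ≥ 0`. So `Z / 2` dominates `|ρ - σ|` on the diagonal of its eigenbasis, and a free weight
  -- `c` replaces Cauchy-Schwarz.
  set Z : Matrix n n ℂ := (c : ℂ) • ((A - B) * (A - B)) + ((c⁻¹ : ℝ) : ℂ) • ((A + B) * (A + B)) with hZ
  have hpm : ∀ e : ℝ, e = 1 ∨ e = -1 → (Z + ((2 * e : ℝ) : ℂ) • (ρ - σ)).PosSemidef := by
    intro e he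
    have hee : e * e = 1 := by rcases he with rfl | rfl <;> norm_num
    set Y : Matrix n n ℂ := ((√c : ℝ) : ℂ) • (A - B) + ((e * (√c)⁻¹ : ℝ) : ℂ) • (A + B) with hY
    have hYh : Yᴴ = Y := by
      rw [hY, conjTranspose_add, conjTranspose_smul, conjTranspose_smul, hAh.sub hBh, hAh.add hBh]
      simp
    have hsc : √c ≠ 0 := (Real.sqrt_pos.2 hc).ne'
    have k1 : ((√c : ℝ) : ℂ) * ((√c : ℝ) : ℂ) = c := by
      rw [← Complex.ofReal_mul, Real.mul_self_sqrt hc.le]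
    have k2 : ((e * (√c)⁻¹ : ℝ) : ℂ) * ((e * (√c)⁻¹ : ℝ) : ℂ) = ((c⁻¹ : ℝ) : ℂ) := by
      rw [← Complex.ofReal_mul]; congr 1
      rw [mul_mul_mul_comm, hee, ← mul_inv, Real.mul_self_sqrt hc.le, one_mul]
    have k3 : ((√c : ℝ) : ℂ) * ((e * (√c)⁻¹ : ℝ) : ℂ) = (e : ℂ) := by
      rw [← Complex.ofReal_mul]; congr 1; field_simp
    have : Z + ((2 * e : ℝ) : ℂ) • (ρ - σ) = Yᴴ * Y := by
      have hexp : ∀ (x y : ℂ) (X' Y' : Matrix n n ℂ), (x • X' + y • Y') * (x • X' + y • Y')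
          = (x * x) • (X' * X') + (y * y) • (Y' * Y') + (x * y) • (X' * Y' + Y' * X') := by
        intro x y X' Y'
        simp only [Matrix.add_mul, Matrix.mul_add, Matrix.smul_mul, Matrix.mul_smul]
        module
      have hcomm : (A - B) * (A + B) + (A + B) * (A - B) = (2 : ℂ) • (ρ - σ) := by
        rw [← hAA, ← hBB]
        simp only [Matrix.sub_mul, Matrix.add_mul, Matrix.mul_sub, Matrix.mul_add]
        module
      rw [hYh, hY, hexp, k1, k2, k3, hcomm, smul_smul, hZ]
      push_cast
      rw [mul_comm (2 : ℂ)]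
    rw [this]
    exact posSemidef_conjTranspose_mul_self Y
  have hq : ∀ i, |q i| ≤ ((Uᴴ * Z * U) i i).re / 2 := by
    intro i
    have e : ∀ e : ℝ, e = 1 ∨ e = -1 → 0 ≤ ((Uᴴ * Z * U) i i).re + 2 * e * q i := by
      intro e he
      have := posSemidef_diag_re_nonneg (hpm e he) U i
      rw [Matrix.mul_add, Matrix.add_mul, Matrix.mul_smul, Matrix.smul_mul, Matrix.add_apply,
        Matrix.smul_apply, hU.apply_diag, smul_eq_mul, ← Complex.ofReal_mul, Complex.add_re,
        Complex.ofReal_re] at this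
      exact this
    rw [abs_le]
    constructor
    · linarith [e 1 (Or.inl rfl)]
    · linarith [e (-1) (Or.inr rfl)]
  have htr : ∑ i, ((Uᴴ * Z * U) i i).re = Z.trace.re := by
    have : Z.trace = (Uᴴ * Z * U).trace := by
      rw [Matrix.mul_assoc, trace_mul_comm, Matrix.mul_assoc, hU.unitary, Matrix.mul_one]
    rw [this, trace, Complex.re_sum]; rfl
  have hZt : Z.trace.re = c * (2 - 2 * f) + c⁻¹ * (2 + 2 * f) := by
    rw [hZ, trace_add, trace_smul, trace_smul, Complex.add_re, smul_eq_mul, smul_eq_mul,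
      Complex.re_ofReal_mul, Complex.re_ofReal_mul, hXX, hYY]
  have hci : 0 < c⁻¹ := inv_pos.2 hc
  calc ∑ i, |q i| ≤ ∑ i, ((Uᴴ * Z * U) i i).re / 2 := Finset.sum_le_sum fun i _ => hq i
    _ = (c * (2 - 2 * f) + c⁻¹ * (2 + 2 * f)) / 2 := by rw [← Finset.sum_div, htr, hZt]
    _ ≤ _ := by
      have h1 := mul_le_mul_of_nonneg_left a1 hc.le
      have h2 : c⁻¹ * (2 + 2 * f) ≤ c⁻¹ * 4 := mul_le_mul_of_nonneg_left (by linarith) hci.le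
      rw [div_eq_mul_inv 2 c]
      linarith

end Tests

/-! ### Invariance under isometries -/

section Isometry

variable {m n I : Type*} [Fintype m] [DecidableEq m] [Fintype n] [DecidableEq n]
  [Fintype I] [DecidableEq I]

lemma IsDiag.conj {A : Matrix n n ℂ} {U : Matrix n I ℂ} {a : I → ℝ} (h : IsDiag A U a)
    {V : Matrix m n ℂ} (hV : Vᴴ * V = 1) : IsDiag (V * A * Vᴴ) (V * U) a := by
  constructor
  · rw [conjTranspose_mul, Matrix.mul_assoc, ← Matrix.mul_assoc Vᴴ, hV, Matrix.one_mul, h.iso]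
  · rw [h.eq, conjTranspose_mul]; simp only [Matrix.mul_assoc]

lemma cfc_conj {A : Matrix n n ℂ} (hA : A.IsHermitian) {V : Matrix m n ℂ} (hV : Vᴴ * V = 1)
    {f : ℝ → ℝ} (hf : f 0 = 0) : cfc f (V * A * Vᴴ) = V * cfc f A * Vᴴ := by
  obtain ⟨U, a, h⟩ := exists_isDiag hA
  rw [((h.conj hV).cfc hf).eq, (h.cfc hf).eq, conjTranspose_mul]
  simp only [Matrix.mul_assoc]

lemma conj_mul_conj {V : Matrix m n ℂ} (hV : Vᴴ * V = 1) (A B : Matrix n n ℂ) :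
    V * A * Vᴴ * (V * B * Vᴴ) = V * (A * B) * Vᴴ := by
  calc _ = V * A * (Vᴴ * V) * B * Vᴴ := by simp only [Matrix.mul_assoc]
    _ = _ := by rw [hV, Matrix.mul_one]; simp only [Matrix.mul_assoc]

lemma trace_conj {V : Matrix m n ℂ} (hV : Vᴴ * V = 1) (A : Matrix n n ℂ) :
    (V * A * Vᴴ).trace = A.trace := by
  rw [trace_mul_comm, ← Matrix.mul_assoc, hV, Matrix.one_mul]

lemma crossLog_conj {V : Matrix m n ℂ} (hV : Vᴴ * V = 1) (ρ : Matrix n n ℂ) {σ : Matrix n n ℂ}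
    (hσ : σ.IsHermitian) : crossLog (V * ρ * Vᴴ) (V * σ * Vᴴ) = crossLog ρ σ := by
  rw [crossLog, matLog, cfc_conj hσ hV Real.log_zero, conj_mul_conj hV, trace_conj hV]; rfl

lemma relEnt_conj {V : Matrix m n ℂ} (hV : Vᴴ * V = 1) {ρ σ : Matrix n n ℂ} (hρ : ρ.IsHermitian)
    (hσ : σ.IsHermitian) : relEnt (V * ρ * Vᴴ) (V * σ * Vᴴ) = relEnt ρ σ := by
  rw [relEnt, crossLog_conj hV _ hρ, crossLog_conj hV _ hσ, relEnt]

lemma traceNorm_conj {V : Matrix m n ℂ} (hV : Vᴴ * V = 1) (Q : Matrix n n ℂ) :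
    traceNorm (V * Q * Vᴴ) = traceNorm Q := by
  have h1 : (V * Q * Vᴴ)ᴴ * (V * Q * Vᴴ) = V * (Qᴴ * Q) * Vᴴ := by
    have : (V * Q * Vᴴ)ᴴ = V * Qᴴ * Vᴴ := by
      simp [conjTranspose_mul, Matrix.mul_assoc]
    rw [this, conj_mul_conj hV]
  rw [traceNorm, h1, cfc_conj (isHermitian_conjTranspose_mul_self Q) hV Real.sqrt_zero,
    trace_conj hV]; rfl

end Isometry

/-! ### Tensor products and additivity -/

section Tensor

variable {A B C I X : Type*} [Fintype A] [DecidableEq A] [Fintype B] [DecidableEq B]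
  [Fintype C] [DecidableEq C] [Fintype I] [DecidableEq I] [Fintype X] [DecidableEq X] {n : ℕ}

/-- The tensor product of a finite family of matrices. -/
def tensorFam (ρ : Fin n → Matrix A B ℂ) : Matrix (Fin n → A) (Fin n → B) ℂ :=
  Matrix.of fun a b => ∏ i, ρ i (a i) (b i)

lemma tensorFam_apply (ρ : Fin n → Matrix A B ℂ) (a : Fin n → A) (b : Fin n → B) :
    tensorFam ρ a b = ∏ i, ρ i (a i) (b i) := rfl

lemma tensorPow_eq (ρ : Matrix A A ℂ) (n : ℕ) : tensorPow ρ n = tensorFam fun _ : Fin n => ρ := rfl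

lemma sum_prod_eq {R : Type*} [CommSemiring R] (f : Fin n → I → R) :
    ∑ j : Fin n → I, ∏ i, f i (j i) = ∏ i, ∑ k, f i k := by
  rw [Finset.prod_univ_sum, Fintype.piFinset_univ]

lemma tensorFam_mul (ρ : Fin n → Matrix A B ℂ) (σ : Fin n → Matrix B C ℂ) :
    tensorFam ρ * tensorFam σ = tensorFam fun i => ρ i * σ i := by
  ext a c
  simp only [mul_apply, tensorFam_apply, ← Finset.prod_mul_distrib]
  exact sum_prod_eq fun i k => ρ i (a i) k * σ i k (c i)

lemma tensorFam_conjTranspose (ρ : Fin n → Matrix A B ℂ) :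
    (tensorFam ρ)ᴴ = tensorFam fun i => (ρ i)ᴴ := by
  ext a b
  simp [conjTranspose_apply, tensorFam_apply]

lemma tensorFam_dg (d : Fin n → I → ℝ) :
    tensorFam (fun i => dg (d i)) = dg fun j => ∏ i, d i (j i) := by
  ext a b
  rw [tensorFam_apply]
  by_cases h : a = b
  · subst h; simp [dg]
  · obtain ⟨i, hi⟩ := Function.ne_iff.1 h
    rw [Finset.prod_eq_zero (Finset.mem_univ i)]
    · simp [dg, h]
    · simp [dg, hi]

lemma tensorFam_one : tensorFam (fun _ : Fin n => (1 : Matrix A A ℂ)) = 1 := by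
  have h : (1 : Matrix A A ℂ) = dg fun _ => 1 := by simp [dg]
  rw [h, tensorFam_dg]
  simp [dg]

lemma trace_tensorFam (ρ : Fin n → Matrix A A ℂ) :
    (tensorFam ρ).trace = ∏ i, (ρ i).trace := by
  simp only [trace, diag_apply, tensorFam_apply]
  exact sum_prod_eq fun i k => ρ i k k

lemma IsDiag.tensorFam {ρ : Fin n → Matrix A A ℂ} {V : Fin n → Matrix A I ℂ} {a : Fin n → I → ℝ}
    (h : ∀ i, IsDiag (ρ i) (V i) (a i)) :
    IsDiag (tensorFam ρ) (tensorFam V) fun j => ∏ i, a i (j i) := by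
  constructor
  · rw [tensorFam_conjTranspose, tensorFam_mul]
    simp_rw [(h _).iso]
    exact tensorFam_one
  · rw [tensorFam_conjTranspose, ← tensorFam_dg, tensorFam_mul, tensorFam_mul]
    simp_rw [← (h _).eq]

lemma tensorFam_posSemidef {ρ : Fin n → Matrix A A ℂ} (h : ∀ i, (ρ i).PosSemidef) :
    (tensorFam ρ).PosSemidef := by
  choose V a hV using fun i => exists_isDiag (h i).1
  exact (IsDiag.tensorFam hV).posSemidef fun j =>
    Finset.prod_nonneg fun i _ => (hV i).nonneg (h i) (j i)

lemma tensorFam_posDef {ρ : Fin n → Matrix A A ℂ} (h : ∀ i, (ρ i).PosDef) :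
    (tensorFam ρ).PosDef := by
  choose V a hV using fun i => exists_isDiag (h i).1
  exact (IsDiag.tensorFam hV).posDef fun j =>
    Finset.prod_pos fun i _ => (hV i).pos (h i) (j i)

lemma sum_weight_tensorFam (w : X → ℝ) (ρ : X → Matrix A A ℂ) :
    ∑ x : Fin n → X, ((∏ i, w (x i) : ℝ) : ℂ) • tensorFam (fun i => ρ (x i))
      = tensorFam fun _ => ∑ x, (w x : ℂ) • ρ x := by
  ext a b
  simp only [Matrix.sum_apply, Matrix.smul_apply, tensorFam_apply, smul_eq_mul]
  push_cast
  simp_rw [← Finset.prod_mul_distrib]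
  exact sum_prod_eq fun i k => (w k : ℂ) * ρ k (a i) (b i)

lemma IsDiag.diag_conj_re {ρ : Matrix A A ℂ} (hρ : ρ.IsHermitian) (W : Matrix A I ℂ) (j : I) :
    (((Wᴴ * ρ * W) j j).re : ℂ) = (Wᴴ * ρ * W) j j :=
  (isHermitian_conjTranspose_mul_mul W hρ).coe_re_apply_self j

lemma diag_tensorFam_conj {ρ : Fin n → Matrix A A ℂ} (hρ : ∀ i, (ρ i).IsHermitian)
    (W : Fin n → Matrix A I ℂ) (j : Fin n → I) :
    (((tensorFam W)ᴴ * tensorFam ρ * tensorFam W) j j).re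
      = ∏ i, (((W i)ᴴ * ρ i * W i) (j i) (j i)).re := by
  rw [tensorFam_conjTranspose, tensorFam_mul, tensorFam_mul, tensorFam_apply]
  rw [Finset.prod_congr rfl fun i _ => (IsDiag.diag_conj_re (hρ i) (W i) (j i)).symm,
    ← Complex.ofReal_prod, Complex.ofReal_re]

/-- Marginalization of a product weight to one coordinate. -/
lemma sum_prod_mul_single {p : Fin n → I → ℝ} (hp : ∀ i, ∑ k, p i k = 1) (i₀ : Fin n) (g : I → ℝ) :
    ∑ j : Fin n → I, (∏ i, p i (j i)) * g (j i₀) = ∑ k, p i₀ k * g k := by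
  have h1 : ∀ j : Fin n → I, (∏ i, p i (j i)) * g (j i₀)
      = ∏ i, (p i (j i) * if i = i₀ then g (j i) else 1) := by
    intro j
    rw [Finset.prod_mul_distrib]
    simp
  simp_rw [h1]
  rw [sum_prod_eq fun i k => p i k * if i = i₀ then g k else 1, Finset.prod_eq_single i₀]
  · simp
  · intro i _ hi
    simp [hi, hp]
  · simp

/-- The logarithm of the product splits except where some `s i k` vanishes; there the weight
vanishes as well, so the convention `log 0 = 0` does no harm. -/
lemma sum_prod_mul_log {p s : Fin n → I → ℝ} (hp : ∀ i, ∑ k, p i k = 1)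
    (hs : ∀ i k, s i k = 0 → p i k = 0) :
    ∑ j : Fin n → I, Real.log (∏ i, s i (j i)) * ∏ i, p i (j i)
      = ∑ i, ∑ k, Real.log (s i k) * p i k := by
  have h1 : ∀ j : Fin n → I, Real.log (∏ i, s i (j i)) * ∏ i, p i (j i)
      = ∑ i₀, (∏ i, p i (j i)) * Real.log (s i₀ (j i₀)) := by
    intro j
    by_cases h : ∃ i, s i (j i) = 0
    · obtain ⟨i, hi⟩ := h
      rw [Finset.prod_eq_zero (f := fun i => p i (j i)) (Finset.mem_univ i) (hs _ _ hi)]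
      simp
    · push Not at h
      rw [Real.log_prod fun i _ => h i, Finset.sum_mul]
      exact Finset.sum_congr rfl fun i _ => mul_comm _ _
  simp_rw [h1]
  rw [Finset.sum_comm]
  refine Finset.sum_congr rfl fun i₀ _ => ?_
  rw [sum_prod_mul_single hp i₀ fun k => Real.log (s i₀ k)]
  exact Finset.sum_congr rfl fun k _ => mul_comm _ _

/-- In the product eigenbasis of the second family, the diagonal of the first is a product of
unit-sum weights, so additivity is the classical one. -/
lemma crossLog_tensorFam {ρ σ : Fin n → Matrix A A ℂ} {W : Fin n → Matrix A A ℂ}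
    {s : Fin n → A → ℝ} (hρ : ∀ i, (ρ i).IsHermitian) (hρ1 : ∀ i, (ρ i).trace.re = 1)
    (hW : ∀ i, IsDiag (σ i) (W i) (s i))
    (hac : ∀ i j, s i j = 0 → (((W i)ᴴ * ρ i * W i) j j).re = 0) :
    crossLog (tensorFam ρ) (tensorFam σ) = ∑ i, crossLog (ρ i) (σ i) := by
  rw [(IsDiag.tensorFam hW).crossLog_eq]
  simp_rw [(hW _).crossLog_eq, diag_tensorFam_conj hρ]
  refine sum_prod_mul_log (p := fun i k => (((W i)ᴴ * ρ i * W i) k k).re) (fun i => ?_) hac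
  rw [← hρ1 i]
  have : (ρ i).trace = ((W i)ᴴ * ρ i * W i).trace := by
    rw [Matrix.mul_assoc, trace_mul_comm, Matrix.mul_assoc, (hW i).unitary, Matrix.mul_one]
  rw [this, trace, Complex.re_sum]; rfl

lemma crossLog_self_tensorFam {ρ : Fin n → Matrix A A ℂ} (hρ : ∀ i, (ρ i).IsHermitian)
    (hρ1 : ∀ i, (ρ i).trace.re = 1) :
    crossLog (tensorFam ρ) (tensorFam ρ) = ∑ i, crossLog (ρ i) (ρ i) := by
  choose V a hV using fun i => exists_isDiag (hρ i)
  exact crossLog_tensorFam hρ hρ1 hV fun i j hj => by rw [(hV i).apply_diag, hj]; simp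

end Tensor

/-! ### Marginals of the memoryless channel -/

section Channel

variable {X B W : Type*} [Fintype B] [DecidableEq B] [Fintype W] [DecidableEq W]

lemma partialTraceRight_posSemidef {ρ : Matrix (B × W) (B × W) ℂ} (h : ρ.PosSemidef) :
    (partialTraceRight ρ).PosSemidef := by
  have : partialTraceRight ρ = ∑ w, ρ.submatrix (fun b => (b, w)) (fun b => (b, w)) := by
    ext a b; simp [partialTraceRight, Matrix.sum_apply]
  rw [this]
  exact posSemidef_sum _ fun w _ => h.submatrix _

lemma partialTraceLeft_posSemidef {ρ : Matrix (B × W) (B × W) ℂ} (h : ρ.PosSemidef) :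
    (partialTraceLeft ρ).PosSemidef := by
  have : partialTraceLeft ρ = ∑ b, ρ.submatrix (fun w => (b, w)) (fun w => (b, w)) := by
    ext a b; simp [partialTraceLeft, Matrix.sum_apply]
  rw [this]
  exact posSemidef_sum _ fun w _ => h.submatrix _

lemma partialTraceRight_trace (ρ : Matrix (B × W) (B × W) ℂ) :
    (partialTraceRight ρ).trace = ρ.trace := by
  simp [partialTraceRight, trace, Fintype.sum_prod_type]

lemma partialTraceLeft_trace (ρ : Matrix (B × W) (B × W) ℂ) :
    (partialTraceLeft ρ).trace = ρ.trace := by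
  simp [partialTraceLeft, trace, Fintype.sum_prod_type_right]

lemma CQChannel.bob_isDensity (P : CQChannel X B W) (x : X) : IsDensity (P.bob x) :=
  ⟨partialTraceRight_posSemidef (P.isDensity x).1,
    (partialTraceRight_trace _).trans (P.isDensity x).2⟩

lemma CQChannel.willie_isDensity (P : CQChannel X B W) (x : X) : IsDensity (P.willie x) :=
  ⟨partialTraceLeft_posSemidef (P.isDensity x).1,
    (partialTraceLeft_trace _).trans (P.isDensity x).2⟩

lemma partialTraceRight_output (P : CQChannel X B W) {n : ℕ} (x : Fin n → X) :
    partialTraceRight (P.output x) = tensorFam fun i => P.bob (x i) := by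
  ext a b
  simp only [partialTraceRight, CQChannel.output, CQChannel.bob, tensorFam_apply, of_apply]
  exact sum_prod_eq fun i k => P.state (x i) (a i, k) (b i, k)

lemma partialTraceLeft_output (P : CQChannel X B W) {n : ℕ} (x : Fin n → X) :
    partialTraceLeft (P.output x) = tensorFam fun i => P.willie (x i) := by
  ext a b
  simp only [partialTraceLeft, CQChannel.output, CQChannel.willie, tensorFam_apply, of_apply]
  exact sum_prod_eq fun i k => P.state (x i) (k, a i) (k, b i)

end Channel

/-! ### Supports and absolute continuity -/

section Support

variable {A I : Type*} [Fintype A] [DecidableEq A] [Fintype I] [DecidableEq I] {n : ℕ}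

/-- Absolute continuity of `ρ` with respect to an operator with eigenvectors `W` and
eigenvalues `s`. -/
def AbsCont (ρ : Matrix A A ℂ) (W : Matrix A I ℂ) (s : I → ℝ) : Prop :=
  ∀ j, s j = 0 → ((Wᴴ * ρ * W) j j).re = 0

/-- From `Wᴴ * σ = dg s * Wᴴ`, the coordinate `j` of every vector in the range of `σ` vanishes when
`s j = 0`. -/
lemma absCont_of_supp {ρ σ : Matrix A A ℂ} {W : Matrix A I ℂ} {s : I → ℝ} (hW : IsDiag σ W s)
    (h : supp ρ ≤ supp σ) : AbsCont ρ W s := by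
  intro j hj
  have hmem : ρ *ᵥ (fun a => W a j) ∈ supp σ := h ⟨_, rfl⟩
  obtain ⟨u, hu⟩ := hmem
  have h1 : (Wᴴ * ρ * W) j j = (Wᴴ *ᵥ (ρ *ᵥ fun a => W a j)) j := by
    rw [mulVec_mulVec]; rfl
  have h2 : Wᴴ * σ = dg s * Wᴴ := by
    rw [hW.eq, ← Matrix.mul_assoc, ← Matrix.mul_assoc, hW.iso, Matrix.one_mul]
  rw [h1, ← hu, mulVecLin_apply, mulVec_mulVec, h2, ← mulVec_mulVec, dg, mulVec_diagonal, hj]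
  simp

lemma AbsCont.self {σ : Matrix A A ℂ} {W : Matrix A I ℂ} {s : I → ℝ} (hW : IsDiag σ W s) :
    AbsCont σ W s := fun j hj => by rw [hW.apply_diag, hj]; simp

lemma AbsCont.sum_smul {K : Type*} (t : Finset K) {ρ : K → Matrix A A ℂ} {W : Matrix A I ℂ}
    {s : I → ℝ} (w : K → ℝ) (h : ∀ k ∈ t, AbsCont (ρ k) W s) :
    AbsCont (∑ k ∈ t, (w k : ℂ) • ρ k) W s := by
  intro j hj
  rw [Matrix.mul_sum, Matrix.sum_mul, Matrix.sum_apply, Complex.re_sum]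
  refine Finset.sum_eq_zero fun k hk => ?_
  rw [Matrix.mul_smul, Matrix.smul_mul, Matrix.smul_apply, smul_eq_mul, Complex.re_ofReal_mul,
    h k hk j hj, mul_zero]

lemma AbsCont.tensorFam {ρ : Fin n → Matrix A A ℂ} (hρ : ∀ i, (ρ i).IsHermitian)
    {W : Fin n → Matrix A I ℂ} {s : Fin n → I → ℝ} (h : ∀ i, AbsCont (ρ i) (W i) (s i)) :
    AbsCont (tensorFam ρ) (tensorFam W) fun j => ∏ i, s i (j i) := by
  intro j hj
  rw [diag_tensorFam_conj hρ]
  obtain ⟨i, _, hi⟩ := Finset.prod_eq_zero_iff.1 hj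
  exact Finset.prod_eq_zero (Finset.mem_univ i) (h i _ hi)

lemma relEnt_self (ρ : Matrix A A ℂ) : relEnt ρ ρ = 0 := sub_self _

lemma relEntropy_of_supp {ρ σ : Matrix A A ℂ} (h : supp ρ ≤ supp σ) :
    relEntropy ρ σ = ((relEnt ρ σ : ℝ) : EReal) := by
  rw [relEntropy, if_pos h, re_trace_mul_sub_log]

lemma relEnt_le_of_relEntropy_le {ρ σ : Matrix A A ℂ} {δ : ℝ} (h : relEntropy ρ σ ≤ (δ : EReal)) :
    relEnt ρ σ ≤ δ := by
  unfold relEntropy at h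
  split_ifs at h with hs
  · rw [re_trace_mul_sub_log] at h
    exact_mod_cast h
  · simp at h

lemma IsDensity.re_trace {ρ : Matrix A A ℂ} (h : IsDensity ρ) : ρ.trace.re = 1 := by
  rw [h.2]; rfl

lemma relEnt_nonneg_of_supp {ρ σ : Matrix A A ℂ} (hρ : IsDensity ρ) (hσ : IsDensity σ)
    (h : supp ρ ≤ supp σ) : 0 ≤ relEnt ρ σ := by
  obtain ⟨W, s, hW⟩ := exists_isDiag hσ.1.1
  have := klein hρ.1 hσ.1 hW (absCont_of_supp hW h)
  rwa [hρ.re_trace, hσ.re_trace, sub_self] at this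

end Support

/-! ### Codeword states and their weight -/

section Codewords

variable {A : Type*} [Fintype A] [DecidableEq A] {n : ℕ}

/-- Hamming weight of a binary word, as a real number. -/
def wt (x : Fin n → Fin 2) : ℝ := ∑ i, ((x i : ℕ) : ℝ)

lemma wt_nonneg (x : Fin n → Fin 2) : 0 ≤ wt x := Finset.sum_nonneg fun _ _ => by positivity

/-- Any function on two letters is affine in the letter; this is why only the weight of a word
enters the additive quantities. -/
lemma sum_fin_two_apply (f : Fin 2 → ℝ) (x : Fin n → Fin 2) :
    ∑ i, f (x i) = n * f 0 + wt x * (f 1 - f 0) := by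
  have : ∀ a : Fin 2, f a = f 0 + ((a : ℕ) : ℝ) * (f 1 - f 0) := by
    intro a; fin_cases a <;> simp
  simp_rw [fun i => this (x i)]
  rw [Finset.sum_add_distrib, ← Finset.sum_mul]
  simp [wt]

/-- The product state belonging to a codeword. -/
def wordState (o : Fin 2 → Matrix A A ℂ) (x : Fin n → Fin 2) : Matrix (Fin n → A) (Fin n → A) ℂ :=
  tensorFam fun i => o (x i)

variable {o : Fin 2 → Matrix A A ℂ}

lemma wordState_isDensity (ho : ∀ a, IsDensity (o a)) (x : Fin n → Fin 2) :
    IsDensity (wordState o x) :=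
  ⟨tensorFam_posSemidef fun i => (ho _).1, by simp [wordState, trace_tensorFam, (ho _).2]⟩

lemma tensorPow_isDensity {ρ : Matrix A A ℂ} (h : IsDensity ρ) (n : ℕ) :
    IsDensity (tensorPow ρ n) :=
  ⟨tensorFam_posSemidef fun _ => h.1, by simp [tensorPow_eq, trace_tensorFam, h.2]⟩

lemma crossLog_wordState_pow (ho : ∀ a, IsDensity (o a)) {σ W : Matrix A A ℂ} {s : A → ℝ}
    (hW : IsDiag σ W s) (hac : ∀ a, AbsCont (o a) W s) (x : Fin n → Fin 2) :
    crossLog (wordState o x) (tensorPow σ n)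
      = n * crossLog (o 0) σ + wt x * (crossLog (o 1) σ - crossLog (o 0) σ) := by
  rw [wordState, tensorPow_eq, crossLog_tensorFam (fun i => (ho _).1.1) (fun i => (ho _).re_trace)
    (fun _ => hW) (fun i => hac _)]
  exact sum_fin_two_apply (fun a => crossLog (o a) σ) x

lemma crossLog_wordState_self (ho : ∀ a, IsDensity (o a)) (x : Fin n → Fin 2) :
    crossLog (wordState o x) (wordState o x)
      = n * crossLog (o 0) (o 0) + wt x * (crossLog (o 1) (o 1) - crossLog (o 0) (o 0)) := by
  rw [wordState, crossLog_self_tensorFam (fun i => (ho _).1.1) (fun i => (ho _).re_trace)]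
  exact sum_fin_two_apply (fun a => crossLog (o a) (o a)) x

lemma absCont_zero_one (hs : supp (o 1) ≤ supp (o 0)) {W : Matrix A A ℂ} {s : A → ℝ}
    (hW : IsDiag (o 0) W s) (a : Fin 2) : AbsCont (o a) W s := by
  fin_cases a
  · exact AbsCont.self hW
  · exact absCont_of_supp hW hs

lemma relEnt_wordState (ho : ∀ a, IsDensity (o a)) (hs : supp (o 1) ≤ supp (o 0))
    (x : Fin n → Fin 2) :
    relEnt (wordState o x) (tensorPow (o 0) n) = wt x * relEnt (o 1) (o 0) := by
  obtain ⟨W, s, hW⟩ := exists_isDiag (ho 0).1.1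
  rw [relEnt, crossLog_wordState_self ho,
    crossLog_wordState_pow ho hW (absCont_zero_one hs hW), relEnt]
  ring

/-- Bernoulli mixture of two operators. -/
def mix (o : Fin 2 → Matrix A A ℂ) (b : ℝ) : Matrix A A ℂ :=
  ((1 - b : ℝ) : ℂ) • o 0 + (b : ℂ) • o 1

lemma mix_isDensity (ho : ∀ a, IsDensity (o a)) {b : ℝ} (h0 : 0 ≤ b) (h1 : b ≤ 1) :
    IsDensity (mix o b) := by
  refine ⟨(smul_posSemidef (ho 0).1 (by linarith)).add (smul_posSemidef (ho 1).1 h0), ?_⟩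
  rw [mix, trace_add, trace_smul, trace_smul, (ho 0).2, (ho 1).2]
  simp

lemma absCont_mix (ho : ∀ a, IsDensity (o a)) {b : ℝ} (h0 : 0 < b) (h1 : b < 1)
    {W : Matrix A A ℂ} {s : A → ℝ} (hW : IsDiag (mix o b) W s) (a : Fin 2) :
    AbsCont (o a) W s := by
  intro j hj
  have h := AbsCont.self hW j hj
  rw [mix, Matrix.mul_add, Matrix.add_mul, Matrix.mul_smul, Matrix.mul_smul, Matrix.smul_mul,
    Matrix.smul_mul, Matrix.add_apply, Matrix.smul_apply, Matrix.smul_apply, smul_eq_mul,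
    smul_eq_mul, Complex.add_re, Complex.re_ofReal_mul, Complex.re_ofReal_mul] at h
  have p0 := posSemidef_diag_re_nonneg (ho 0).1 W j
  have p1 := posSemidef_diag_re_nonneg (ho 1).1 W j
  have q0 : 0 ≤ (1 - b) * ((Wᴴ * o 0 * W) j j).re := mul_nonneg (by linarith) p0
  have q1 : 0 ≤ b * ((Wᴴ * o 1 * W) j j).re := mul_nonneg h0.le p1
  fin_cases a
  · have : (1 - b) * ((Wᴴ * o 0 * W) j j).re = 0 := by linarith
    exact (mul_eq_zero.1 this).resolve_left (by linarith)
  · have : b * ((Wᴴ * o 1 * W) j j).re = 0 := by linarith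
    exact (mul_eq_zero.1 this).resolve_left h0.ne'

/-- Lower bound, linear in the average weight, for the divergence of a mixture of codewords. -/
lemma relEnt_mixture_ge {K : Type*} [Fintype K] (ho : ∀ a, IsDensity (o a))
    (hs : supp (o 1) ≤ supp (o 0)) {w : K → ℝ} (hw : ∀ k, 0 ≤ w k) (hw1 : ∑ k, w k = 1)
    (c : K → Fin n → Fin 2) {b : ℝ} (h0 : 0 < b) (h1 : b < 1) :
    n * (crossLog (o 0) (mix o b) - crossLog (o 0) (o 0))
      + (∑ k, w k * wt (c k)) * ((crossLog (o 1) (mix o b) - crossLog (o 1) (o 0))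
          - (crossLog (o 0) (mix o b) - crossLog (o 0) (o 0)))
      ≤ relEnt (∑ k, (w k : ℂ) • wordState o (c k)) (tensorPow (o 0) n) := by
  obtain ⟨W, s, hW⟩ := exists_isDiag (mix_isDensity ho h0.le h1.le).1.1
  obtain ⟨W', s', hW'⟩ := exists_isDiag (ho 0).1.1
  have hac := absCont_mix ho h0 h1 hW
  set ρ := ∑ k, (w k : ℂ) • wordState o (c k) with hρ
  have hρP : ρ.PosSemidef := sum_smul_posSemidef _ (fun k _ => hw k)
    fun k _ => (wordState_isDensity ho (c k)).1
  have hρ1 : ρ.trace.re = 1 := by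
    rw [hρ, trace_sum, Complex.re_sum]
    simp_rw [trace_smul, smul_eq_mul, Complex.re_ofReal_mul,
      (wordState_isDensity ho _).re_trace, mul_one, hw1]
  -- Comparing with the product mixture bounds the divergence by an expression linear in the code
  -- state, which depends on the code only through its average weight. The parameter `b` stays free.
  have hk := klein hρP (tensorPow_isDensity (mix_isDensity ho h0.le h1.le) n).1
    (IsDiag.tensorFam fun _ : Fin n => hW)
    (AbsCont.sum_smul _ w fun k _ => AbsCont.tensorFam (fun i => (ho _).1.1) fun i => hac _)
  rw [hρ1, (tensorPow_isDensity (mix_isDensity ho h0.le h1.le) n).re_trace, sub_self, relEnt] at hk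
  have e : ∀ {σ V : Matrix A A ℂ} {t : A → ℝ}, IsDiag σ V t → (∀ a, AbsCont (o a) V t) →
      crossLog ρ (tensorPow σ n) = n * crossLog (o 0) σ
        + (∑ k, w k * wt (c k)) * (crossLog (o 1) σ - crossLog (o 0) σ) := by
    intro σ V t hV hacV
    rw [hρ, crossLog_sum]
    simp_rw [crossLog_smul, crossLog_wordState_pow ho hV hacV, mul_add, Finset.sum_add_distrib]
    rw [← Finset.sum_mul, hw1, one_mul, Finset.sum_mul]
    congr 1
    exact Finset.sum_congr rfl fun k _ => by ring
  rw [relEnt, e hW' (absCont_zero_one hs hW')]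
  rw [e hW hac] at hk
  linarith

end Codewords

lemma vonNeumannEntropy_eq {A : Type*} [Fintype A] [DecidableEq A] (ρ : Matrix A A ℂ) :
    vonNeumannEntropy ρ = - crossLog ρ ρ := rfl

/-! ### Converse inequalities for a single code -/

section CodeConverse

variable {B W : Type*} [Fintype B] [DecidableEq B] [Fintype W] [DecidableEq W]
  {M L n : ℕ} (C : SecrecyCode (Fin 2) B M L 1 n) (P : CQChannel (Fin 2) B W)

/-- The codeword of the message pair `(m, l)`. -/
def SecrecyCode.word (m : Fin M) (l : Fin L) : Fin n → Fin 2 := C.enc m l 0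

lemma SecrecyCode.bobState_eq (m : Fin M) (l : Fin L) (k : Fin 1) :
    C.bobState P m l k = wordState P.bob (C.word m l) := by
  rw [Subsingleton.elim k 0]
  exact partialTraceRight_output P _

lemma SecrecyCode.willieGiven_eq (m : Fin M) :
    C.willieGiven P m = ∑ l, (((L : ℝ)⁻¹ : ℝ) : ℂ) • wordState P.willie (C.word m l) := by
  rw [SecrecyCode.willieGiven, Finset.smul_sum]
  refine Finset.sum_congr rfl fun l _ => ?_
  simp only [Finset.univ_unique, Finset.sum_singleton, SecrecyCode.willieState,
    partialTraceLeft_output]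
  simp [wordState, SecrecyCode.word]

lemma SecrecyCode.willieAvg_eq :
    C.willieAvg P = ∑ m, (((M : ℝ)⁻¹ : ℝ) : ℂ) • C.willieGiven P m := by
  rw [SecrecyCode.willieAvg, Finset.smul_sum]
  simp

lemma SecrecyCode.avgError_eq : C.avgError P = ∑ ml : Fin M × Fin L, ((M : ℝ) * L)⁻¹ *
    (1 - (C.dec 0 ml * wordState P.bob (C.word ml.1 ml.2)).trace.re) := by
  rw [SecrecyCode.avgError, Fintype.sum_prod_type, Finset.mul_sum]
  refine Finset.sum_congr rfl fun m _ => ?_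
  rw [Finset.mul_sum]
  refine Finset.sum_congr rfl fun l _ => ?_
  simp only [Finset.univ_unique, Finset.sum_singleton, bobState_eq]
  simp

/-- Average weight of the codewords. -/
def SecrecyCode.avgWeight : ℝ := ∑ ml : Fin M × Fin L, ((M : ℝ) * L)⁻¹ * wt (C.word ml.1 ml.2)

lemma SecrecyCode.avgWeight_nonneg : 0 ≤ C.avgWeight :=
  Finset.sum_nonneg fun _ _ => mul_nonneg (by positivity) (wt_nonneg _)

lemma sum_inv_prod (hM : 0 < M) (hL : 0 < L) :
    ∑ _ml : Fin M × Fin L, ((M : ℝ) * L)⁻¹ = 1 := by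
  have hM' : (0 : ℝ) < M := by exact_mod_cast hM
  have hL' : (0 : ℝ) < L := by exact_mod_cast hL
  simp; field_simp

lemma SecrecyCode.willieAvg_eq_sum :
    C.willieAvg P = ∑ ml : Fin M × Fin L, ((((M : ℝ) * L)⁻¹ : ℝ) : ℂ) •
      wordState P.willie (C.word ml.1 ml.2) := by
  rw [willieAvg_eq, Fintype.sum_prod_type]
  refine Finset.sum_congr rfl fun m _ => ?_
  rw [willieGiven_eq, Finset.smul_sum]
  refine Finset.sum_congr rfl fun l _ => ?_
  rw [smul_smul, ← Complex.ofReal_mul, mul_inv]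

lemma SecrecyCode.willieGiven_isDensity (hL : 0 < L) (m : Fin M) :
    IsDensity (C.willieGiven P m) := by
  rw [willieGiven_eq]
  refine ⟨sum_smul_posSemidef _ (fun _ _ => by positivity)
    fun l _ => (wordState_isDensity P.willie_isDensity _).1, ?_⟩
  have hL' : (L : ℂ) ≠ 0 := by exact_mod_cast hL.ne'
  simp_rw [trace_sum, trace_smul, (wordState_isDensity P.willie_isDensity _).2]
  simp [hL']

/-- Converse for the legitimate receiver. -/
lemma SecrecyCode.log_card_le (hM : 0 < M) (hL : 0 < L) (hs : supp (P.bob 1) ≤ supp (P.bob 0))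
    {ε : ℝ} (hε : 0 < ε) (hε4 : 4 * ε ≤ 1) (hC : C.Reliable P ε) :
    (1 - 4 * ε) * Real.log (ε * (M * L)) - 1 ≤ C.avgWeight * relEnt (P.bob 1) (P.bob 0) := by
  have hM' : (0 : ℝ) < M := by exact_mod_cast hM
  have hL' : (0 : ℝ) < L := by exact_mod_cast hL
  have hD := relEnt_nonneg_of_supp (P.bob_isDensity 1) (P.bob_isDensity 0) hs
  -- Below `1` the logarithm is non-positive and the claim is trivial; otherwise this number is an
  -- admissible threshold `K ≥ 1`.
  rcases lt_or_ge (ε * (M * L)) 1 with hK | hK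
  · have h1 : Real.log (ε * (M * L)) ≤ 0 := Real.log_nonpos (by positivity) hK.le
    have h2 := mul_nonneg C.avgWeight_nonneg hD
    nlinarith
  set K := ε * (M * L) with hKdef
  set N : ℝ := ((M : ℝ) * L)⁻¹ with hN
  have hN0 : 0 < N := by positivity
  have hsum1 := sum_inv_prod hM hL
  rw [← hN] at hsum1
  obtain ⟨V, s, hV⟩ := exists_isDiag (P.bob_isDensity 0).1.1
  have hpow := tensorPow_isDensity (P.bob_isDensity 0) n
  set ξ := tensorPow (P.bob 0) n with hξ
  have hle : ∀ ml, C.dec 0 ml ≤ 1 := by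
    intro ml
    rw [← C.dec_sum 0]
    exact Finset.single_le_sum (f := C.dec 0)
      (fun ml _ => nonneg_iff_posSemidef.2 (C.dec_posSemidef 0 ml)) (Finset.mem_univ ml)
  have h1 : ∀ ml : Fin M × Fin L,
      Real.log K * (1 - 2 * (((1 - C.dec 0 ml) * wordState P.bob (C.word ml.1 ml.2)).trace.re
        + K * (C.dec 0 ml * ξ).trace.re)) - 1
        ≤ wt (C.word ml.1 ml.2) * relEnt (P.bob 1) (P.bob 0) := by
    intro ml
    rw [← relEnt_wordState P.bob_isDensity hs]
    have hd := wordState_isDensity P.bob_isDensity (C.word ml.1 ml.2)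
    exact log_mul_le_relEnt hd.1 hpow.1 hd.re_trace hpow.re_trace
      (IsDiag.tensorFam fun _ : Fin n => hV)
      (AbsCont.tensorFam (fun i => (P.bob_isDensity _).1.1) fun i => absCont_zero_one hs hV _)
      (C.dec_posSemidef 0 ml) (hle ml) hK
  have h2 := Finset.sum_le_sum fun ml (_ : ml ∈ Finset.univ) =>
    mul_le_mul_of_nonneg_left (h1 ml) hN0.le
  have e1 : ∑ ml : Fin M × Fin L, N * (wt (C.word ml.1 ml.2) * relEnt (P.bob 1) (P.bob 0))
      = C.avgWeight * relEnt (P.bob 1) (P.bob 0) := by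
    rw [avgWeight, Finset.sum_mul]
    exact Finset.sum_congr rfl fun _ _ => by rw [hN]; ring
  -- The POVM elements sum to `1`, so the average acceptance of the innocent state is `1 / (M L)`;
  -- multiplied by `K` it is exactly `ε`.
  have e2 : ∑ ml : Fin M × Fin L, N * ((C.dec 0 ml) * ξ).trace.re = N := by
    rw [← Finset.mul_sum, ← Complex.re_sum, ← trace_sum, ← Matrix.sum_mul, C.dec_sum,
      Matrix.one_mul, hpow.re_trace, mul_one]
  have e3 : ∑ ml : Fin M × Fin L,
      N * ((1 - C.dec 0 ml) * wordState P.bob (C.word ml.1 ml.2)).trace.re = C.avgError P := by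
    rw [avgError_eq]
    refine Finset.sum_congr rfl fun ml _ => ?_
    rw [Matrix.sub_mul, Matrix.one_mul, trace_sub, Complex.sub_re,
      (wordState_isDensity P.bob_isDensity _).re_trace]
  have e4 : ∑ ml : Fin M × Fin L, N * (Real.log K * (1 - 2 *
      (((1 - C.dec 0 ml) * wordState P.bob (C.word ml.1 ml.2)).trace.re
        + K * (C.dec 0 ml * ξ).trace.re)) - 1)
      = Real.log K * (1 - 2 * (C.avgError P + K * N)) - 1 := by
    have hgen : ∀ x y : Fin M × Fin L → ℝ,
        ∑ ml, N * (Real.log K * (1 - 2 * (x ml + K * y ml)) - 1)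
          = Real.log K * (∑ _ml : Fin M × Fin L, N - 2 * (∑ ml, N * x ml + K * ∑ ml, N * y ml))
            - ∑ _ml : Fin M × Fin L, N := by
      intro x y
      simp only [Finset.mul_sum, ← Finset.sum_add_distrib, ← Finset.sum_sub_distrib]
      exact Finset.sum_congr rfl fun _ _ => by ring
    rw [hgen, e2, e3, hsum1]
  rw [e1, e4] at h2
  have hKN : K * N = ε := by rw [hKdef, hN]; field_simp
  have hlog : 0 ≤ Real.log K := Real.log_nonneg hK
  have hC' : C.avgError P ≤ ε := hC
  rw [hKN] at h2
  nlinarith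

/-- Holevo quantity between the secret message and Willie's output. -/
def SecrecyCode.leakage : ℝ := ∑ m, (M : ℝ)⁻¹ * crossLog (C.willieGiven P m) (C.willieGiven P m)
  - crossLog (C.willieAvg P) (C.willieAvg P)

/-- The weight term is the average divergence of the codeword states from the innocent state. It
decomposes into the covertness divergence of the mean state, the leakage of the secret message, and
the average Holevo quantity of the public message given the secret one, at most `log L`. -/
lemma SecrecyCode.covert_bounds (hM : 0 < M) (hL : 0 < L)
    (hs : supp (P.willie 1) ≤ supp (P.willie 0)) {δ : ℝ} (hC : C.Covert P δ) :
    C.avgWeight * relEnt (P.willie 1) (P.willie 0) - δ ≤ Real.log L + C.leakage P := by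
  have ho := P.willie_isDensity
  obtain ⟨V, s, hV⟩ := exists_isDiag (ho 0).1.1
  have hcov := relEnt_le_of_relEntropy_le hC
  have h1 : ∀ m, ∑ l, (L : ℝ)⁻¹ * crossLog (wordState P.willie (C.word m l))
      (wordState P.willie (C.word m l)) - crossLog (C.willieGiven P m) (C.willieGiven P m)
      ≤ Real.log L := by
    intro m
    have := holevo_le_log hL (fun l => (wordState_isDensity ho (C.word m l)).1)
      (fun l => (wordState_isDensity ho (C.word m l)).re_trace)
    rwa [← willieGiven_eq] at this
  have hM' : (0 : ℝ) < M := by exact_mod_cast hM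
  have h2 := Finset.sum_le_sum fun m (_ : m ∈ Finset.univ) =>
    mul_le_mul_of_nonneg_left (h1 m) (inv_nonneg.2 hM'.le)
  have e0 : ∑ _m : Fin M, (M : ℝ)⁻¹ * Real.log L = Real.log L := by
    rw [Finset.sum_const]; simp [hM'.ne']
  simp only [mul_sub, Finset.sum_sub_distrib, e0] at h2
  have e1 : ∑ m, (M : ℝ)⁻¹ * ∑ l, (L : ℝ)⁻¹ * crossLog (wordState P.willie (C.word m l))
      (wordState P.willie (C.word m l))
      = ∑ ml : Fin M × Fin L, ((M : ℝ) * L)⁻¹ * crossLog (wordState P.willie (C.word ml.1 ml.2))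
        (wordState P.willie (C.word ml.1 ml.2)) := by
    rw [Fintype.sum_prod_type]
    refine Finset.sum_congr rfl fun m _ => ?_
    rw [Finset.mul_sum]
    exact Finset.sum_congr rfl fun l _ => by rw [mul_inv]; ring
  have e2 : crossLog (C.willieAvg P) (tensorPow (P.willie 0) n)
      = ∑ ml : Fin M × Fin L, ((M : ℝ) * L)⁻¹ * crossLog (wordState P.willie (C.word ml.1 ml.2))
        (tensorPow (P.willie 0) n) := by
    rw [willieAvg_eq_sum, crossLog_sum]
    exact Finset.sum_congr rfl fun ml _ => by rw [crossLog_smul]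
  have e3 : C.avgWeight * relEnt (P.willie 1) (P.willie 0)
      = ∑ ml : Fin M × Fin L, ((M : ℝ) * L)⁻¹ * crossLog (wordState P.willie (C.word ml.1 ml.2))
        (wordState P.willie (C.word ml.1 ml.2))
        - ∑ ml : Fin M × Fin L, ((M : ℝ) * L)⁻¹ * crossLog (wordState P.willie (C.word ml.1 ml.2))
        (tensorPow (P.willie 0) n) := by
    rw [avgWeight, Finset.sum_mul, ← Finset.sum_sub_distrib]
    refine Finset.sum_congr rfl fun ml _ => ?_
    rw [mul_assoc, ← relEnt_wordState ho hs, relEnt, mul_sub]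
  rw [relEnt, e2] at hcov
  rw [e1] at h2
  rw [e3, leakage]
  linarith

/-- Covertness constrains the average weight through every tangent parameter `b`; the right choice
depends on `n` and is made later. -/
lemma SecrecyCode.weight_bound (hM : 0 < M) (hL : 0 < L)
    (hs : supp (P.willie 1) ≤ supp (P.willie 0)) {δ : ℝ} (hC : C.Covert P δ) {b : ℝ}
    (h0 : 0 < b) (h1 : b < 1) :
    n * (crossLog (P.willie 0) (mix P.willie b) - crossLog (P.willie 0) (P.willie 0))
      + C.avgWeight * ((crossLog (P.willie 1) (mix P.willie b)
            - crossLog (P.willie 1) (P.willie 0))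
          - (crossLog (P.willie 0) (mix P.willie b) - crossLog (P.willie 0) (P.willie 0))) ≤ δ := by
  have hcov := relEnt_le_of_relEntropy_le hC
  rw [willieAvg_eq_sum] at hcov
  refine le_trans ?_ hcov
  exact relEnt_mixture_ge P.willie_isDensity hs (fun _ : Fin M × Fin L => by positivity)
    (sum_inv_prod hM hL) (fun ml => C.word ml.1 ml.2) h0 h1

lemma SecrecyCode.leakage_of_secret (hM : 0 < M) (hL : 0 < L) {δ : ℝ} (hδ : δ ≤ 1)
    (hC : C.Secret P δ) : C.leakage P ≤ δ * Real.log M + 3 := by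
  obtain ⟨τ, hτ, h⟩ := hC
  have := holevo_le_of_traceNorm hM (ρ := C.willieGiven P) (τ := τ)
    (fun m => (C.willieGiven_isDensity P hL m).1)
    (fun m => (C.willieGiven_isDensity P hL m).re_trace) hτ.1 hτ.re_trace hδ
    (by rw [← Finset.mul_sum]; simpa using h)
  rwa [← willieAvg_eq] at this

/-- The joint state is block diagonal with blocks scaled by `1 / M`, so its entropy contains an
extra `log M` that cancels the entropy of the message. -/
lemma SecrecyCode.mutualInfo_eq (hM : 0 < M) (hL : 0 < L) :
    mutualInfo (C.messageWillie P) = C.leakage P := by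
  have hM' : (0 : ℝ) < M := by exact_mod_cast hM
  have hden := C.willieGiven_isDensity P hL
  choose U a hU using fun m => exists_isDiag (hden m).1.1
  have hl : partialTraceLeft (C.messageWillie P) = C.willieAvg P := by
    ext w w'
    rw [willieAvg_eq, Matrix.sum_apply]
    simp [partialTraceLeft, messageWillie]
  have hr : partialTraceRight (C.messageWillie P) = dg fun _ => (M : ℝ)⁻¹ := by
    ext m m'
    by_cases h : m = m'
    · subst h
      have : ∑ w, C.willieGiven P m w w = 1 := (hden m).2
      simp [partialTraceRight, messageWillie, dg, ← Finset.mul_sum, this]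
    · simp [partialTraceRight, messageWillie, dg, h]
  have hrd : IsDiag (partialTraceRight (C.messageWillie P)) (1 : Matrix (Fin M) (Fin M) ℂ)
      fun _ => (M : ℝ)⁻¹ := ⟨by simp, by simp [hr]⟩
  -- The block diagonal matrix of the eigenbases `U m` diagonalizes the joint state.
  have hmd : IsDiag (C.messageWillie P)
      (Matrix.of fun p q : Fin M × (Fin n → W) => if p.1 = q.1 then U p.1 p.2 q.2 else 0)
      fun p => (M : ℝ)⁻¹ * a p.1 p.2 := by
    constructor
    · ext p q
      rw [mul_apply, Fintype.sum_prod_type]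
      simp only [conjTranspose_apply, of_apply]
      rcases p with ⟨m, w⟩
      rcases q with ⟨m', w'⟩
      rw [Finset.sum_eq_single m]
      · by_cases h : m = m'
        · subst h
          have := congrFun (congrFun (hU m).iso w) w'
          rw [mul_apply] at this
          simp only [conjTranspose_apply] at this
          simp only [if_true, this, one_apply, Prod.mk.injEq, true_and]
        · simp [h, one_apply]
      · intro b _ hb; simp [hb]
      · simp
    · ext p q
      rcases p with ⟨m, w⟩
      rcases q with ⟨m', w'⟩
      have key : ∀ m, C.willieGiven P m w w' = ∑ j, U m w j * (a m j : ℂ) * star (U m w' j) := by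
        intro m
        conv_lhs => rw [(hU m).eq]
        rw [mul_apply]
        simp [dg, mul_diagonal]
      rw [mul_apply, Fintype.sum_prod_type]
      simp only [dg, mul_diagonal, conjTranspose_apply, of_apply, messageWillie]
      rw [Finset.sum_eq_single m]
      · by_cases h : m = m'
        · subst h
          simp only [if_true, key, Finset.mul_sum]
          refine Finset.sum_congr rfl fun j _ => ?_
          push_cast; ring
        · simp [h, Ne.symm h]
      · intro b _ hb; simp [Ne.symm hb]
      · simp
  have e1 : crossLog (C.messageWillie P) (C.messageWillie P)
      = ∑ m, (M : ℝ)⁻¹ * crossLog (C.willieGiven P m) (C.willieGiven P m) - Real.log M := by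
    rw [hmd.crossLog_self, Fintype.sum_prod_type]
    have : ∀ m, ∑ j, (M : ℝ)⁻¹ * a m j * Real.log ((M : ℝ)⁻¹ * a m j)
        = (M : ℝ)⁻¹ * crossLog (C.willieGiven P m) (C.willieGiven P m)
          - (M : ℝ)⁻¹ * Real.log M := by
      intro m
      have ht := (hU m).trace_re
      rw [(hden m).re_trace] at ht
      rw [(hU m).crossLog_self]
      conv_rhs => rw [← mul_one (Real.log (M : ℝ)), ht, Finset.mul_sum, Finset.mul_sum,
        Finset.mul_sum, ← Finset.sum_sub_distrib]
      refine Finset.sum_congr rfl fun j _ => ?_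
      rcases eq_or_ne (a m j) 0 with h | h
      · simp [h]
      · rw [Real.log_mul (inv_ne_zero hM'.ne') h, Real.log_inv]; ring
    simp only [this, Finset.sum_sub_distrib]
    congr 1
    rw [Finset.sum_const]; simp [hM'.ne']
  have e2 : crossLog (partialTraceRight (C.messageWillie P))
      (partialTraceRight (C.messageWillie P)) = - Real.log M := by
    rw [hrd.crossLog_self, Finset.sum_const]; simp [hM'.ne']
  rw [mutualInfo, vonNeumannEntropy_eq, vonNeumannEntropy_eq, vonNeumannEntropy_eq, e2, hl, e1,
    leakage]
  ring

end CodeConverse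

/-! ### The chi-square divergence and divided differences of the logarithm -/

section Spectrum

variable {A I J : Type*} [Fintype A] [DecidableEq A] [Fintype I] [DecidableEq I]
  [Fintype J] [DecidableEq J]

lemma exists_smul_one_le {σ : Matrix A A ℂ} (hσ : σ.PosDef) :
    ∃ m : ℝ, 0 < m ∧ (m : ℂ) • (1 : Matrix A A ℂ) ≤ σ := by
  obtain ⟨U, a, h⟩ := exists_isDiag hσ.1
  obtain ⟨m, hm, hma⟩ : ∃ m : ℝ, 0 < m ∧ ∀ i, m ≤ a i := by
    rcases isEmpty_or_nonempty A with hA | hA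
    · exact ⟨1, one_pos, fun i => hA.elim i⟩
    · obtain ⟨i, hi⟩ := Finite.exists_min a
      exact ⟨a i, h.pos hσ i, hi⟩
  refine ⟨m, hm, ?_⟩
  rw [le_iff]
  have := (h.add_one (-m)).posSemidef fun i => by linarith [hma i]
  have e : σ - (m : ℂ) • (1 : Matrix A A ℂ) = σ + ((-m : ℝ) : ℂ) • 1 := by
    push_cast; module
  rwa [e]

lemma le_one_of_isDensity {ρ : Matrix A A ℂ} (h : IsDensity ρ) : ρ ≤ 1 := by
  obtain ⟨U, a, hU⟩ := exists_isDiag h.1.1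
  have ht := hU.trace_re
  rw [h.re_trace] at ht
  have h1 : ∀ i, a i ≤ 1 := fun i => by
    rw [ht]; exact Finset.single_le_sum (f := a) (fun i _ => hU.nonneg h.1 i) (Finset.mem_univ i)
  have e : (1 : Matrix A A ℂ) - ρ = U * dg (fun i => 1 - a i) * Uᴴ := by
    have : (1 : Matrix A A ℂ) = U * dg (fun _ => 1) * Uᴴ := by simp [dg, hU.unitary]
    conv_lhs => rw [this, hU.eq]
    rw [← Matrix.sub_mul, ← Matrix.mul_sub]
    congr 2
    ext i j; by_cases hij : i = j <;> simp [dg, hij]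
  rw [le_iff, e]
  exact conj_dg_posSemidef (fun i => by linarith [h1 i]) U

variable {o : Fin 2 → Matrix A A ℂ}

lemma one_sub_smul_le_mix (ho : ∀ a, IsDensity (o a)) {b : ℝ} (h0 : 0 ≤ b) :
    ((1 - b : ℝ) : ℂ) • o 0 ≤ mix o b :=
  le_add_posSemidef _ (smul_posSemidef (ho 1).1 h0)

lemma mix_zero (o : Fin 2 → Matrix A A ℂ) : mix o 0 = o 0 := by simp [mix]

lemma mix_posDef (ho : ∀ a, IsDensity (o a)) (hpd : (o 0).PosDef) {b : ℝ} (h0 : 0 ≤ b)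
    (h1 : b < 1) : (mix o b).PosDef :=
  posDef_add (hpd.smul (a := ((1 - b : ℝ) : ℂ)) (by exact_mod_cast sub_pos.2 h1))
    (smul_posSemidef (ho 1).1 h0)

/-- For `b ≤ 1 / 2` the mixture dominates half of `o 0`. A common compact interval away from `0` is
what continuity of the functional calculus needs. -/
lemma exists_spectrum_mix_subset (ho : ∀ a, IsDensity (o a)) (hpd : (o 0).PosDef) :
    ∃ m : ℝ, 0 < m ∧ ∀ b : ℝ, 0 ≤ b → b ≤ 1 / 2 → spectrum ℝ (mix o b) ⊆ Set.Icc m 1 := by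
  obtain ⟨m, hm, hle⟩ := exists_smul_one_le hpd
  refine ⟨m / 2, by positivity, fun b h0 h1 x hx => ?_⟩
  have hden := mix_isDensity ho h0 (by linarith)
  have hsa : IsSelfAdjoint (mix o b) := hden.1.1
  constructor
  · refine (algebraMap_le_iff_le_spectrum (a := mix o b) hsa).1 ?_ x hx
    refine le_trans ?_ (one_sub_smul_le_mix ho h0)
    have h2 := smul_posSemidef (le_iff.1 hle) (c := 1 / 2) (by norm_num)
    have h3 := smul_posSemidef (ho 0).1 (c := 1 - b - 1 / 2) (by linarith)
    have e : ((1 - b : ℝ) : ℂ) • o 0 - algebraMap ℝ (Matrix A A ℂ) (m / 2)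
        = ((1 / 2 : ℝ) : ℂ) • (o 0 - (m : ℂ) • (1 : Matrix A A ℂ))
          + ((1 - b - 1 / 2 : ℝ) : ℂ) • o 0 := by
      rw [Algebra.algebraMap_eq_smul_one]
      have : (m / 2 : ℝ) • (1 : Matrix A A ℂ) = ((m / 2 : ℝ) : ℂ) • 1 := by ext i j; simp
      rw [this]
      push_cast
      module
    rw [le_iff, e]
    exact h2.add h3
  · refine (le_algebraMap_iff_spectrum_le (a := mix o b) hsa).1 ?_ x hx
    rw [map_one]
    exact le_one_of_isDensity hden

-- Needed for functions that are continuous only on the positive half-line: divided differences of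
-- `log`, and negative powers.
open Filter Topology in
lemma tendsto_cfc_mix (ho : ∀ a, IsDensity (o a)) (hpd : (o 0).PosDef) {f : ℝ → ℝ}
    (hf : ContinuousOn f (Set.Ioi 0)) :
    Tendsto (fun b => cfc f (mix o b)) (𝓝[>] 0) (𝓝 (cfc f (o 0))) := by
  obtain ⟨m, hm, hs⟩ := exists_spectrum_mix_subset ho hpd
  have hcont : Continuous fun b : ℝ => mix o b := by unfold mix; fun_prop
  have ht : Tendsto (fun b : ℝ => mix o b) (𝓝[>] 0) (𝓝 (o 0)) := by
    have := hcont.tendsto 0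
    rw [mix_zero] at this
    exact this.mono_left nhdsWithin_le_nhds
  have hev : ∀ᶠ b : ℝ in 𝓝[>] 0, 0 ≤ b ∧ b ≤ 1 / 2 := by
    filter_upwards [Ioc_mem_nhdsGT (show (0 : ℝ) < 1 / 2 by norm_num)] with b hb
    exact ⟨hb.1.le, hb.2⟩
  refine Filter.Tendsto.cfc (isCompact_Icc (a := m) (b := 1)) f ht ?_ ?_ ?_ ?_ ?_
  · filter_upwards [hev] with b hb using hs b hb.1 hb.2
  · filter_upwards [hev] with b hb using (mix_isDensity ho hb.1 (by linarith)).1.1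
  · rw [← mix_zero o]; exact hs 0 le_rfl (by norm_num)
  · exact (ho 0).1.1
  · exact hf.mono fun x hx => lt_of_lt_of_le hm hx.1

lemma dslope_log_pos {a b : ℝ} (ha : 0 < a) (hb : 0 < b) : 0 < dslope Real.log a b := by
  rcases eq_or_ne b a with rfl | h
  · rw [dslope_same, Real.deriv_log]; positivity
  · rw [dslope_of_ne _ h, slope_def_field]
    rcases lt_or_gt_of_ne h with h | h
    · exact div_pos_of_neg_of_neg (sub_neg.2 (Real.log_lt_log hb h)) (sub_neg.2 h)
    · exact div_pos (sub_pos.2 (Real.log_lt_log ha h)) (sub_pos.2 h)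

lemma continuousOn_dslope_log {a : ℝ} (ha : 0 < a) :
    ContinuousOn (dslope Real.log a) (Set.Ioi 0) := by
  rw [continuousOn_dslope (Ioi_mem_nhds ha)]
  exact ⟨Real.continuousOn_log.mono fun x hx => ne_of_gt hx, Real.differentiableAt_log ha.ne'⟩

/-- `tr ((B - A) (log B - log A))` as a sum of logarithmic divided differences. -/
lemma trace_sub_mul_log_sub {P Q U V : Matrix A A ℂ} {p q : A → ℝ}
    (hP : IsDiag P U p) (hQ : IsDiag Q V q) :
    ((Q - P) * (matLog Q - matLog P)).trace.re
      = ∑ i, ∑ j, dslope Real.log (p i) (q j) * Complex.normSq ((Uᴴ * (Q - P) * V) i j) := by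
  have e0 : ∀ i j, Complex.normSq ((Uᴴ * (Q - P) * V) i j) = (q j - p i) ^ 2 * ov U V i j := by
    intro i j
    have h1 : Q * V = V * dg q := by rw [hQ.eq, Matrix.mul_assoc, hQ.iso, Matrix.mul_one]
    have h2 : Uᴴ * P = dg p * Uᴴ := by
      rw [hP.eq, ← Matrix.mul_assoc, ← Matrix.mul_assoc, hP.iso, Matrix.one_mul]
    have : Uᴴ * (Q - P) * V = Uᴴ * V * dg q - dg p * (Uᴴ * V) := by
      rw [Matrix.mul_sub, Matrix.sub_mul, Matrix.mul_assoc, h1, h2]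
      simp only [Matrix.mul_assoc]
    rw [this, Matrix.sub_apply, dg, dg, mul_diagonal, diagonal_mul, mul_comm, ← sub_mul,
      Complex.normSq_mul, ← Complex.ofReal_sub, Complex.normSq_ofReal, ov]
    ring
  have e1 : ∀ i j, dslope Real.log (p i) (q j) * Complex.normSq ((Uᴴ * (Q - P) * V) i j)
      = (q j - p i) * (Real.log (q j) - Real.log (p i)) * ov U V i j := by
    intro i j
    have := sub_smul_dslope Real.log (p i) (q j)
    rw [smul_eq_mul] at this
    rw [e0, ← this]; ring
  simp only [e1]
  have hU : ∀ i, ∑ j, ov U V i j = 1 := sum_ov_right hP.iso hQ.unitary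
  have hV : ∀ j, ∑ i, ov U V i j = 1 := sum_ov_left hP.unitary hQ.iso
  have t1 : (Q * matLog Q).trace.re = ∑ i, ∑ j, q j * Real.log (q j) * ov U V i j := by
    rw [Finset.sum_comm]; simp_rw [← Finset.mul_sum, hV, mul_one]
    exact hQ.crossLog_self
  have t2 : (P * matLog P).trace.re = ∑ i, ∑ j, p i * Real.log (p i) * ov U V i j := by
    simp_rw [← Finset.mul_sum, hU, mul_one]
    exact hP.crossLog_self
  have t3 : (P * matLog Q).trace.re = ∑ i, ∑ j, p i * Real.log (q j) * ov U V i j :=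
    hP.trace_mul hQ.log
  have t4 : (Q * matLog P).trace.re = ∑ i, ∑ j, Real.log (p i) * q j * ov U V i j := by
    rw [trace_mul_comm]; exact hP.log.trace_mul hQ
  rw [Matrix.sub_mul, Matrix.mul_sub, Matrix.mul_sub]
  simp only [trace_sub, Complex.sub_re]
  rw [t1, t2, t3, t4]
  simp only [← Finset.sum_sub_distrib]
  exact Finset.sum_congr rfl fun i _ => Finset.sum_congr rfl fun j _ => by ring

/-- The quadratic form behind the chi-square divergence, in an eigenbasis. -/
def bkm (H : Matrix A A ℂ) (V : Matrix A I ℂ) (a : I → ℝ) : ℝ :=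
  ∑ i, ∑ j, dslope Real.log (a i) (a j) * Complex.normSq ((Vᴴ * H * V) i j)

lemma trace_mul_mul_mul_rect {P Q : Matrix A A ℂ} {V : Matrix A I ℂ} {W : Matrix A J ℂ}
    {a : I → ℝ} {b : J → ℝ}
    (hP : IsDiag P V a) (hQ : IsDiag Q W b) {X : Matrix A A ℂ} (hX : X.IsHermitian) :
    (X * P * X * Q).trace.re = ∑ i, ∑ j, a i * b j * Complex.normSq ((Vᴴ * X * W) i j) := by
  have h1 : (X * P * X * Q).trace = (V * dg a * Vᴴ * (X * W * dg b * (X * W)ᴴ)).trace := by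
    rw [conjTranspose_mul, hX, ← hP.eq, Matrix.mul_assoc, Matrix.mul_assoc, trace_mul_comm]
    conv_lhs => rw [hQ.eq]
    simp only [Matrix.mul_assoc]
  rw [h1, trace_conj_dg_mul_conj_dg, Complex.ofReal_re]
  simp only [ov, Matrix.mul_assoc]

lemma IsDiag.mem_spectrum {σ : Matrix A A ℂ} {V : Matrix A I ℂ} {a : I → ℝ} (h : IsDiag σ V a)
    (i : I) : a i ∈ spectrum ℝ σ := by
  rw [spectrum.mem_iff]
  intro hu
  have e1 : σ * V = V * dg a := by rw [h.eq, Matrix.mul_assoc, h.iso, Matrix.mul_one]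
  -- `V * E` retains only the `i`-th column of `V`, an eigenvector, and is annihilated by `a i - σ`.
  obtain ⟨E, hE⟩ : ∃ E : Matrix I I ℂ, E = Matrix.single i i 1 := ⟨_, rfl⟩
  have hdE : dg a * E = (a i : ℂ) • E := by
    ext j k
    rw [hE, dg, Matrix.smul_apply, diagonal_mul, Matrix.single_apply]
    by_cases hjk : i = j ∧ i = k
    · rw [hjk.1]; simp
    · simp [hjk]
  have h1 : (algebraMap ℝ (Matrix A A ℂ) (a i) - σ) * (V * E) = 0 := by
    have e2 : (a i : ℝ) • (V * E) = (a i : ℂ) • (V * E) := by ext j k; simp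
    rw [Matrix.sub_mul, ← Matrix.mul_assoc σ, e1, Algebra.algebraMap_eq_smul_one,
      Matrix.smul_mul, Matrix.one_mul, Matrix.mul_assoc, hdE, e2, Matrix.mul_smul, sub_self]
  obtain ⟨u, hu⟩ := hu
  have h2 : V * E = 0 := by
    rw [← hu] at h1
    have h4 : (((u⁻¹ : (Matrix A A ℂ)ˣ) : Matrix A A ℂ) * (u : Matrix A A ℂ)) * (V * E) = 0 := by
      rw [Matrix.mul_assoc, h1, Matrix.mul_zero]
    rwa [Units.inv_mul, Matrix.one_mul] at h4
  have h3 : Vᴴ * (V * E) = 0 := by rw [h2, Matrix.mul_zero]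
  rw [← Matrix.mul_assoc, h.iso, Matrix.one_mul, hE] at h3
  have := congrFun (congrFun h3 i) i
  simp at this

/-- The terms `1 / λ` are the divided differences at coinciding arguments, so both sums of `chiSq`
merge into one; eigenvectors are then grouped by eigenvalue. -/
lemma chiSq_eq_bkm {ρ σ : Matrix A A ℂ} {V : Matrix A I ℂ} {a : I → ℝ} (hρ : ρ.IsHermitian)
    (h : IsDiag σ V a) (ha : ∀ i, 0 < a i) : chiSq ρ σ = bkm (ρ - σ) V a := by
  have hH : (ρ - σ).IsHermitian := hρ.sub h.isHermitian
  have hpos : ∀ x ∈ posSpectrum σ, 0 < x := fun x hx => (Finset.mem_filter.1 hx).2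
  have hmem : ∀ i, a i ∈ posSpectrum σ := fun i => by
    refine Finset.mem_filter.2 ⟨?_, ha i⟩
    simpa using h.mem_spectrum i
  have hproj : ∀ x ∈ posSpectrum σ,
      IsDiag (spectralProj σ x) V fun i => if a i = x then 1 else 0 := fun x hx =>
    h.cfc (f := fun y => if y = x then 1 else 0) (by simp [(hpos x hx).ne])
  have htr : ∀ x ∈ posSpectrum σ, ∀ y ∈ posSpectrum σ,
      ((ρ - σ) * spectralProj σ x * (ρ - σ) * spectralProj σ y).trace.re
        = ∑ i, ∑ j, (if a i = x then 1 else 0) * (if a j = y then 1 else 0)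
          * Complex.normSq ((Vᴴ * (ρ - σ) * V) i j) :=
    fun x hx y hy => trace_mul_mul_mul_rect (hproj x hx) (hproj y hy) hH
  have h1 : chiSq ρ σ = ∑ x ∈ posSpectrum σ, ∑ y ∈ posSpectrum σ, dslope Real.log x y
      * ∑ i, ∑ j, (if a i = x then 1 else 0) * (if a j = y then 1 else 0)
          * Complex.normSq ((Vᴴ * (ρ - σ) * V) i j) := by
    rw [chiSq, ← Finset.sum_add_distrib]
    refine Finset.sum_congr rfl fun x hx => ?_
    rw [← Finset.sum_erase_add _ _ hx]
    congr 1
    · refine Finset.sum_congr rfl fun y hy => ?_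
      obtain ⟨hyx, hy⟩ := Finset.mem_erase.1 hy
      rw [htr x hx y hy, dslope_of_ne _ hyx, slope_def_field, ← neg_sub, ← neg_sub y x, neg_div_neg_eq]
    · rw [htr x hx x hx, dslope_same, Real.deriv_log, one_div]
  rw [h1, bkm]
  simp_rw [Finset.mul_sum]
  have swap : ∀ F : ℝ → ℝ → I → I → ℝ, ∑ x ∈ posSpectrum σ, ∑ y ∈ posSpectrum σ, ∑ i, ∑ j, F x y i j
      = ∑ i, ∑ j, ∑ x ∈ posSpectrum σ, ∑ y ∈ posSpectrum σ, F x y i j := by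
    intro F
    calc _ = ∑ x ∈ posSpectrum σ, ∑ i, ∑ y ∈ posSpectrum σ, ∑ j, F x y i j :=
          Finset.sum_congr rfl fun x _ => Finset.sum_comm
      _ = ∑ i, ∑ x ∈ posSpectrum σ, ∑ y ∈ posSpectrum σ, ∑ j, F x y i j := Finset.sum_comm
      _ = ∑ i, ∑ x ∈ posSpectrum σ, ∑ j, ∑ y ∈ posSpectrum σ, F x y i j :=
          Finset.sum_congr rfl fun i _ => Finset.sum_congr rfl fun x _ => Finset.sum_comm
      _ = _ := Finset.sum_congr rfl fun i _ => Finset.sum_comm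
  rw [swap]
  refine Finset.sum_congr rfl fun i _ => Finset.sum_congr rfl fun j _ => ?_
  rw [Finset.sum_eq_single (a i), Finset.sum_eq_single (a j)]
  · simp
  · intro y _ hy; simp [Ne.symm hy]
  · intro h; exact absurd (hmem j) h
  · intro x _ hx; simp [Ne.symm hx]
  · intro h; exact absurd (hmem i) h

/-- The divided differences of `log` are strictly positive, so a vanishing form kills every entry of
`H`. This is where distinct outputs at Willie give a non-zero denominator. -/
lemma bkm_pos {H U : Matrix A A ℂ} {a : A → ℝ} (hU : Uᴴ * U = 1) (ha : ∀ i, 0 < a i)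
    (hH : H ≠ 0) : 0 < bkm H U a := by
  have hU' : U * Uᴴ = 1 := mul_eq_one_comm.1 hU
  have hnn : ∀ i j, 0 ≤ dslope Real.log (a i) (a j) * Complex.normSq ((Uᴴ * H * U) i j) :=
    fun i j => mul_nonneg (dslope_log_pos (ha i) (ha j)).le (Complex.normSq_nonneg _)
  refine lt_of_le_of_ne (Finset.sum_nonneg fun i _ => Finset.sum_nonneg fun j _ => hnn i j) ?_
  intro h0
  refine hH ?_
  have hz : Uᴴ * H * U = 0 := by
    ext i j
    have h1 := (Finset.sum_eq_zero_iff_of_nonneg fun i _ => Finset.sum_nonneg fun j _ =>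
      hnn i j).1 h0.symm i (Finset.mem_univ _)
    have h2 := (Finset.sum_eq_zero_iff_of_nonneg fun j _ => hnn i j).1 h1 j (Finset.mem_univ _)
    exact Complex.normSq_eq_zero.1
      ((mul_eq_zero.1 h2).resolve_left (dslope_log_pos (ha i) (ha j)).ne')
  calc H = (U * Uᴴ) * H * (U * Uᴴ) := by rw [hU', Matrix.one_mul, Matrix.mul_one]
    _ = U * (Uᴴ * H * U) * Uᴴ := by simp only [Matrix.mul_assoc]
    _ = 0 := by rw [hz, Matrix.mul_zero, Matrix.zero_mul]

/-- Derivative of the divergence along the mixture. -/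
def slopeLog (o : Fin 2 → Matrix A A ℂ) (b : ℝ) : ℝ :=
  (crossLog (o 1) (mix o b) - crossLog (o 1) (o 0))
    - (crossLog (o 0) (mix o b) - crossLog (o 0) (o 0))

lemma mix_sub (o : Fin 2 → Matrix A A ℂ) (b : ℝ) : mix o b - o 0 = (b : ℂ) • (o 1 - o 0) := by
  rw [mix]; push_cast; module

-- For each eigenvalue `a i` of `o 0`, the sum over the eigenbasis of the mixture is a diagonal
-- entry of a conjugate of `cfc (dslope Real.log (a i)) (mix o b)`. Continuity of the functional
-- calculus then gives the limit, and moving eigenvectors need not be followed.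
open Filter Topology in
lemma tendsto_slopeLog (ho : ∀ a, IsDensity (o a)) (hpd : (o 0).PosDef) {U : Matrix A A ℂ}
    {a : A → ℝ} (hU : IsDiag (o 0) U a) :
    Tendsto (fun b => slopeLog o b / b) (𝓝[>] 0) (𝓝 (bkm (o 1 - o 0) U a)) := by
  set H := o 1 - o 0 with hH
  have hHh : H.IsHermitian := (ho 1).1.1.sub (ho 0).1.1
  have hmain : ∀ᶠ b : ℝ in 𝓝[>] 0, ∑ i, ((H * U)ᴴ * cfc (dslope Real.log (a i)) (mix o b) *
      (H * U)) i i = ((slopeLog o b / b : ℝ) : ℂ) := by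
    filter_upwards [Ioo_mem_nhdsGT (show (0 : ℝ) < 1 by norm_num)] with b hb
    obtain ⟨V, q, hV⟩ := exists_isDiag (mix_isDensity ho hb.1.le hb.2.le).1.1
    have e1 : ((mix o b - o 0) * (matLog (mix o b) - matLog (o 0))).trace.re
        = b * slopeLog o b := by
      rw [mix_sub, Matrix.smul_mul, trace_smul, smul_eq_mul, Complex.re_ofReal_mul, slopeLog,
        Matrix.sub_mul, Matrix.mul_sub, Matrix.mul_sub]
      simp only [trace_sub, Complex.sub_re]
      rfl
    rw [trace_sub_mul_log_sub hU hV, mix_sub, ← hH] at e1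
    have e2 : slopeLog o b / b = ∑ i, ∑ j, dslope Real.log (a i) (q j) *
        Complex.normSq ((Uᴴ * H * V) i j) := by
      have hb0 : b ≠ 0 := hb.1.ne'
      have : ∀ i j, Complex.normSq ((Uᴴ * ((b : ℂ) • H) * V) i j)
          = b * b * Complex.normSq ((Uᴴ * H * V) i j) := by
        intro i j
        rw [Matrix.mul_smul, Matrix.smul_mul, Matrix.smul_apply, smul_eq_mul, Complex.normSq_mul,
          Complex.normSq_ofReal]
      simp only [this] at e1
      rw [div_eq_iff hb0]
      refine mul_left_cancel₀ hb0 ?_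
      rw [← e1]
      simp only [Finset.mul_sum, Finset.sum_mul]
      exact Finset.sum_congr rfl fun i _ => Finset.sum_congr rfl fun j _ => by ring
    rw [e2]
    push_cast
    refine Finset.sum_congr rfl fun i _ => ?_
    have h3 := sum_mul_ov V (H * U) (fun j => dslope Real.log (a i) (q j)) i
    rw [← (hV.cfc_sq (dslope Real.log (a i))).eq] at h3
    rw [← h3]
    push_cast
    refine Finset.sum_congr rfl fun j _ => ?_
    rw [ov_comm, ov, conjTranspose_mul, hHh]
  have hlim : Tendsto (fun b => ∑ i, ((H * U)ᴴ * cfc (dslope Real.log (a i)) (mix o b) *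
      (H * U)) i i) (𝓝[>] 0) (𝓝 (∑ i, ((H * U)ᴴ * cfc (dslope Real.log (a i)) (o 0) *
      (H * U)) i i)) := by
    refine tendsto_finsetSum _ fun i _ => ?_
    have hc : Continuous fun X : Matrix A A ℂ => ((H * U)ᴴ * X * (H * U)) i i := by fun_prop
    exact (hc.tendsto _).comp
      (tendsto_cfc_mix ho hpd (continuousOn_dslope_log (hU.pos hpd i)))
  have hval : ∑ i, ((H * U)ᴴ * cfc (dslope Real.log (a i)) (o 0) * (H * U)) i i
      = ((bkm H U a : ℝ) : ℂ) := by
    rw [bkm]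
    push_cast
    refine Finset.sum_congr rfl fun i _ => ?_
    have h3 := sum_mul_ov U (H * U) (fun j => dslope Real.log (a i) (a j)) i
    rw [← (hU.cfc_sq (dslope Real.log (a i))).eq] at h3
    rw [← h3]
    push_cast
    refine Finset.sum_congr rfl fun j _ => ?_
    rw [ov_comm, ov, conjTranspose_mul, hHh]
  rw [hval] at hlim
  have h4 := (hlim.congr' hmain)
  have h5 := (Complex.continuous_re.tendsto _).comp h4
  simpa [Function.comp_def] using h5

end Spectrum

/-! ### Compression to the support of the innocent state -/

section Compression

variable {A I : Type*} [Fintype A] [DecidableEq A] [Fintype I] [DecidableEq I]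

lemma mul_eq_self_of_supp_le {P ρ σ : Matrix A A ℂ} (h : supp ρ ≤ supp σ) (hP : P * σ = σ) :
    P * ρ = ρ := by
  refine Matrix.toLin'.injective (LinearMap.ext fun v => ?_)
  rw [Matrix.toLin'_apply, Matrix.toLin'_apply, ← mulVec_mulVec]
  obtain ⟨u, hu⟩ : ρ *ᵥ v ∈ supp σ := h ⟨v, rfl⟩
  have hu' : σ *ᵥ u = ρ *ᵥ v := hu
  rw [← hu', mulVec_mulVec, hP]

/-- A pair of states with nested supports lives on the support of the larger one. -/
lemma exists_compression {A : Type*} [Fintype A] [DecidableEq A] {o : Fin 2 → Matrix A A ℂ}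
    (ho : ∀ a, IsDensity (o a)) (hs : supp (o 1) ≤ supp (o 0)) :
    ∃ (s : A → ℝ) (V : Matrix A {i // s i ≠ 0} ℂ)
      (o' : Fin 2 → Matrix {i // s i ≠ 0} {i // s i ≠ 0} ℂ), Vᴴ * V = 1 ∧
      (∀ a, o a = V * o' a * Vᴴ) ∧ (∀ a, IsDensity (o' a)) ∧ (o' 0).PosDef := by
  obtain ⟨W, s, hW⟩ := exists_isDiag (ho 0).1.1
  set V : Matrix A {i // s i ≠ 0} ℂ := W.submatrix id Subtype.val with hV
  have hVV : Vᴴ * V = 1 := by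
    ext i j
    have h1 := congrFun (congrFun hW.iso i.1) j.1
    rw [hV]
    simp only [Matrix.mul_apply, conjTranspose_apply, submatrix_apply, id] at h1 ⊢
    rw [h1]
    simp [Matrix.one_apply, Subtype.ext_iff]
  have hd : o 0 = V * dg (fun i : {i // s i ≠ 0} => s i.1) * Vᴴ := by
    rw [hW.eq]
    ext x y
    rw [dg, dg, Matrix.mul_apply, Matrix.mul_apply]
    simp only [Matrix.mul_diagonal, conjTranspose_apply, hV, submatrix_apply, id]
    rw [← Finset.sum_subtype (Finset.univ.filter fun i => s i ≠ 0) (by simp)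
      (fun i => W x i * (s i : ℂ) * star (W y i)), Finset.sum_filter]
    refine Finset.sum_congr rfl fun i _ => ?_
    by_cases hi : s i = 0 <;> simp [hi]
  have hP : V * Vᴴ * o 0 = o 0 := by
    rw [hd]
    calc _ = V * (Vᴴ * V) * dg (fun i : {i // s i ≠ 0} => s i.1) * Vᴴ := by simp only [Matrix.mul_assoc]
      _ = _ := by rw [hVV, Matrix.mul_one]
  have hPa : ∀ a, V * Vᴴ * o a = o a := by
    intro a
    fin_cases a
    · exact hP
    · exact mul_eq_self_of_supp_le hs hP
  have hPa' : ∀ a, o a * (V * Vᴴ) = o a := by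
    intro a
    have := congrArg conjTranspose (hPa a)
    rwa [conjTranspose_mul, conjTranspose_mul, conjTranspose_conjTranspose, (ho a).1.1] at this
  have he : ∀ a, o a = V * (Vᴴ * o a * V) * Vᴴ := by
    intro a
    calc o a = V * Vᴴ * o a * (V * Vᴴ) := by rw [hPa, hPa']
      _ = _ := by simp only [Matrix.mul_assoc]
  have hdo : ∀ a, IsDensity (Vᴴ * o a * V) := by
    intro a
    refine ⟨(ho a).1.conjTranspose_mul_mul_same V, ?_⟩
    rw [← trace_conj hVV, ← he, (ho a).2]
  refine ⟨s, V, fun a => Vᴴ * o a * V, hVV, he, hdo, ?_⟩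
  have hdiag : IsDiag (Vᴴ * o 0 * V) (1 : Matrix {i // s i ≠ 0} {i // s i ≠ 0} ℂ)
      fun i => s i.1 := by
    refine ⟨by simp, ?_⟩
    rw [hd]
    calc _ = (Vᴴ * V) * dg (fun i : {i // s i ≠ 0} => s i.1) * (Vᴴ * V) := by simp only [Matrix.mul_assoc]
      _ = _ := by rw [hVV]; simp
  exact hdiag.posDef fun i => lt_of_le_of_ne (hW.nonneg (ho 0).1 i.1) i.2.symm

lemma mix_conj (V : Matrix A I ℂ) (o : Fin 2 → Matrix A A ℂ) (o' : Fin 2 → Matrix I I ℂ)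
    (h : ∀ a, o a = V * o' a * Vᴴ) (b : ℝ) : mix o b = V * mix o' b * Vᴴ := by
  rw [mix, mix, h 0, h 1]
  simp only [Matrix.mul_add, Matrix.add_mul, Matrix.mul_smul, Matrix.smul_mul]

lemma slopeLog_conj {V : Matrix A I ℂ} (hV : Vᴴ * V = 1) {o : Fin 2 → Matrix A A ℂ}
    {o' : Fin 2 → Matrix I I ℂ} (h : ∀ a, o a = V * o' a * Vᴴ) (ho' : ∀ a, IsDensity (o' a)) {b : ℝ}
    (h0 : 0 ≤ b) (h1 : b ≤ 1) : slopeLog o b = slopeLog o' b := by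
  have hm := (mix_isDensity ho' h0 h1).1.1
  rw [slopeLog, slopeLog, mix_conj V o o' h, h 0, h 1]
  simp only [crossLog_conj hV _ hm, crossLog_conj hV _ (ho' 0).1.1]

end Compression

/-! ### Second-order expansion along the mixture -/

section SecondOrder

variable {A : Type*} [Fintype A] [DecidableEq A] {o : Fin 2 → Matrix A A ℂ}

/-- Cutting `[0, b]` into `N + 1` equal pieces makes the total error `K * b ^ 2 / (N + 1)`. This
replaces an argument by derivatives. -/
lemma le_of_sub_le_mul_sq {F : ℝ → ℝ} {K b : ℝ} (hb : 0 ≤ b)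
    (hF : ∀ x y, 0 ≤ x → x ≤ y → y ≤ b → F y - F x ≤ K * (y - x) ^ 2) : F b ≤ F 0 := by
  have step : ∀ N : ℕ, F b ≤ F 0 + K * b ^ 2 / ((N : ℝ) + 1) := by
    intro N
    have hN : (0 : ℝ) < (N : ℝ) + 1 := by positivity
    have ind : ∀ k : ℕ, k ≤ N + 1 → F (k * (b / (N + 1))) ≤ F 0 + k * (K * (b / (N + 1)) ^ 2) := by
      intro k
      induction k with
      | zero => intro _; simp
      | succ k ih =>
        intro hk
        have hk' : ((k : ℝ) + 1) ≤ N + 1 := by exact_mod_cast hk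
        have h2 := hF (k * (b / (N + 1))) ((k + 1 : ℕ) * (b / (N + 1))) (by positivity)
          (by push_cast; nlinarith [show 0 ≤ b / ((N : ℝ) + 1) by positivity])
          (by
            push_cast
            calc ((k : ℝ) + 1) * (b / (N + 1)) ≤ (N + 1) * (b / (N + 1)) := by gcongr
              _ = b := by field_simp)
        have h3 := ih (by omega)
        push_cast at h2 ⊢
        have e : ((k : ℝ) + 1) * (b / (N + 1)) - k * (b / (N + 1)) = b / (N + 1) := by ring
        rw [e] at h2
        linarith
    have h := ind (N + 1) le_rfl
    push_cast at h
    have e1 : ((N : ℝ) + 1) * (b / (N + 1)) = b := by field_simp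
    have e2 : ((N : ℝ) + 1) * (K * (b / (N + 1)) ^ 2) = K * b ^ 2 / (N + 1) := by field_simp
    rwa [e1, e2] at h
  have hlim : Filter.Tendsto (fun N : ℕ => F 0 + K * b ^ 2 / ((N : ℝ) + 1)) Filter.atTop
      (nhds (F 0 + 0)) :=
    tendsto_const_nhds.add ((tendsto_const_div_atTop_nhds_zero_nat (K * b ^ 2) |>.comp
      (Filter.tendsto_add_atTop_nat 1)).congr fun N => by simp)
  simpa using ge_of_tendsto' hlim step

lemma crossLog_mix_left (X : Matrix A A ℂ) (b : ℝ) :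
    crossLog (mix o b) X = (1 - b) * crossLog (o 0) X + b * crossLog (o 1) X := by
  rw [mix, crossLog_add, crossLog_smul, crossLog_smul]

lemma relEnt_mix_eq (b : ℝ) : relEnt (mix o b) (o 0)
    = (crossLog (o 0) (mix o b) - crossLog (o 0) (o 0)) + b * slopeLog o b := by
  rw [relEnt, crossLog_mix_left, crossLog_mix_left, slopeLog]; ring

lemma slopeLog_zero : slopeLog o 0 = 0 := by
  rw [slopeLog, mix_zero]; ring

/-- Convexity of the divergence along the mixture. -/
lemma slopeLog_mul_le (ho : ∀ a, IsDensity (o a)) (hpd : (o 0).PosDef) {x y : ℝ} (hx0 : 0 ≤ x)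
    (hx1 : x < 1) (hy0 : 0 ≤ y) (hy1 : y ≤ 1) :
    (y - x) * slopeLog o x ≤ relEnt (mix o y) (o 0) - relEnt (mix o x) (o 0) := by
  have h := klein_posDef (mix_isDensity ho hy0 hy1).1 (mix_posDef ho hpd hx0 hx1)
  rw [(mix_isDensity ho hy0 hy1).re_trace, (mix_isDensity ho hx0 hx1.le).re_trace, sub_self] at h
  have e : relEnt (mix o y) (mix o x) = relEnt (mix o y) (o 0) - relEnt (mix o x) (o 0)
      - (y - x) * slopeLog o x := by
    rw [relEnt, relEnt, relEnt, crossLog_mix_left, crossLog_mix_left, crossLog_mix_left,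
      crossLog_mix_left, crossLog_mix_left, slopeLog]
    ring
  linarith

-- Integrates the slope asymptotics without differentiating the divergence: convexity bounds chords
-- by end-point slopes, so the difference from `(c ± ε) * x ^ 2 / 2` has increments of quadratic
-- order on one side.
open Filter Topology in
lemma tendsto_relEnt_mix_of_posDef (ho : ∀ a, IsDensity (o a)) (hpd : (o 0).PosDef) {c : ℝ}
    (hc : Tendsto (fun b => slopeLog o b / b) (𝓝[>] 0) (𝓝 c)) :
    Tendsto (fun b => relEnt (mix o b) (o 0) / b ^ 2) (𝓝[>] 0) (𝓝 (c / 2)) := by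
  rw [Metric.tendsto_nhds]
  intro ε hε
  have h1 : ∀ᶠ b in 𝓝[>] (0 : ℝ), dist (slopeLog o b / b) c < ε := Metric.tendsto_nhds.1 hc ε hε
  obtain ⟨u, hu0, hu⟩ := (mem_nhdsGT_iff_exists_Ioo_subset).1 h1
  have hu0' : (0 : ℝ) < u := hu0
  filter_upwards [Ioo_mem_nhdsGT (show (0 : ℝ) < min u 1 from lt_min hu0' one_pos)] with b hb
  have hb0 : 0 < b := hb.1
  have hbu : b < u := hb.2.trans_le (min_le_left _ _)
  have hb1 : b < 1 := hb.2.trans_le (min_le_right _ _)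
  have hψ : ∀ x, 0 ≤ x → x ≤ b → (c - ε) * x ≤ slopeLog o x ∧ slopeLog o x ≤ (c + ε) * x := by
    intro x hx hxb
    rcases hx.eq_or_lt with rfl | hx
    · simp [slopeLog_zero]
    have h2 : dist (slopeLog o x / x) c < ε := hu ⟨hx, hxb.trans_lt hbu⟩
    rw [Real.dist_eq, abs_lt] at h2
    constructor
    · have : c - ε ≤ slopeLog o x / x := by linarith
      rwa [le_div_iff₀ hx] at this
    · have : slopeLog o x / x ≤ c + ε := by linarith
      rwa [div_le_iff₀ hx] at this
  have hz : relEnt (mix o 0) (o 0) = 0 := by rw [mix_zero, relEnt_self]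
  have up : relEnt (mix o b) (o 0) ≤ (c + ε) * b ^ 2 / 2 := by
    have := le_of_sub_le_mul_sq (F := fun x => relEnt (mix o x) (o 0) - (c + ε) * x ^ 2 / 2)
      (K := (c + ε) / 2) hb0.le (fun x y hx hxy hyb => by
        have h3 := slopeLog_mul_le ho hpd (x := y) (y := x) (hx.trans hxy) (hyb.trans_lt hb1) hx
          ((hxy.trans hyb).trans hb1.le)
        have h4 := mul_le_mul_of_nonneg_left (hψ y (hx.trans hxy) hyb).2 (sub_nonneg.2 hxy)
        show relEnt (mix o y) (o 0) - (c + ε) * y ^ 2 / 2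
          - (relEnt (mix o x) (o 0) - (c + ε) * x ^ 2 / 2) ≤ _
        nlinarith)
    simp only [hz] at this
    linarith
  have low : (c - ε) * b ^ 2 / 2 ≤ relEnt (mix o b) (o 0) := by
    have := le_of_sub_le_mul_sq (F := fun x => (c - ε) * x ^ 2 / 2 - relEnt (mix o x) (o 0))
      (K := (c - ε) / 2) hb0.le (fun x y hx hxy hyb => by
        have h3 := slopeLog_mul_le ho hpd (x := x) (y := y) hx ((hxy.trans hyb).trans_lt hb1)
          (hx.trans hxy) (hyb.trans hb1.le)
        have h4 := mul_le_mul_of_nonneg_left (hψ x hx (hxy.trans hyb)).1 (sub_nonneg.2 hxy)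
        show (c - ε) * y ^ 2 / 2 - relEnt (mix o y) (o 0)
          - ((c - ε) * x ^ 2 / 2 - relEnt (mix o x) (o 0)) ≤ _
        nlinarith)
    simp only [hz] at this
    linarith
  have hb2 : 0 < b ^ 2 := by positivity
  rw [Real.dist_eq, abs_lt]
  constructor
  · have : (c - ε) / 2 ≤ relEnt (mix o b) (o 0) / b ^ 2 := by
      rw [le_div_iff₀ hb2]; linarith
    linarith
  · have : relEnt (mix o b) (o 0) / b ^ 2 ≤ (c + ε) / 2 := by
      rw [div_le_iff₀ hb2]; linarith
    linarith

open Filter Topology in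
/-- Second-order expansion of the divergence of a small perturbation of the innocent state. -/
lemma second_order (ho : ∀ a, IsDensity (o a)) (hs : supp (o 1) ≤ supp (o 0)) (hne : o 1 ≠ o 0) :
    0 < chiSq (o 1) (o 0) ∧
    Tendsto (fun b => slopeLog o b / b) (𝓝[>] 0) (𝓝 (chiSq (o 1) (o 0))) ∧
    Tendsto (fun b => relEnt (mix o b) (o 0) / b ^ 2) (𝓝[>] 0) (𝓝 (chiSq (o 1) (o 0) / 2)) := by
  -- On the support of `o 0` the innocent state is positive definite; all three quantities are
  -- unchanged by the isometry.
  obtain ⟨s, V, o', hV, he, ho', hpd⟩ := exists_compression ho hs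
  obtain ⟨U, a, hU⟩ := exists_isDiag (ho' 0).1.1
  have ha := hU.pos hpd
  have hVU : IsDiag (o 0) (V * U) a := by rw [he 0]; exact hU.conj hV
  have hchi : chiSq (o 1) (o 0) = bkm (o' 1 - o' 0) U a := by
    rw [chiSq_eq_bkm (ho 1).1.1 hVU ha, bkm, bkm]
    have : (V * U)ᴴ * (o 1 - o 0) * (V * U) = Uᴴ * (o' 1 - o' 0) * U := by
      rw [he 0, he 1, ← Matrix.sub_mul, ← Matrix.mul_sub, conjTranspose_mul]
      calc _ = Uᴴ * (Vᴴ * V) * (o' 1 - o' 0) * (Vᴴ * V) * U := by simp only [Matrix.mul_assoc]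
        _ = _ := by rw [hV, Matrix.mul_one, Matrix.mul_one]
    rw [this]
  have h1 := tendsto_slopeLog ho' hpd hU
  have h2 := tendsto_relEnt_mix_of_posDef ho' hpd h1
  rw [hchi]
  refine ⟨bkm_pos hU.iso ha fun h => hne ?_, ?_, ?_⟩
  · rw [he 0, he 1, sub_eq_zero.1 h]
  · refine h1.congr' ?_
    filter_upwards [Ioo_mem_nhdsGT (show (0 : ℝ) < 1 by norm_num)] with b hb
    rw [slopeLog_conj hV he ho' hb.1.le hb.2.le]
  · refine h2.congr' ?_
    filter_upwards [Ioo_mem_nhdsGT (show (0 : ℝ) < 1 by norm_num)] with b hb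
    rw [mix_conj V o o' he, he 0, relEnt_conj hV (mix_isDensity ho' hb.1.le hb.2.le).1.1 (ho' 0).1.1]

end SecondOrder

/-! ### The asymptotic converse -/

section Converse

variable {B W : Type*} [Fintype B] [DecidableEq B] [Fintype W] [DecidableEq W]
  {P : CQChannel (Fin 2) B W}

open Filter Topology in
/-- Limit of the normalized weight allowed by covertness. -/
lemma tendsto_weight_bound {c : ℝ} (hc : 0 < c) {φ ψ : ℝ → ℝ}
    (hψ : Tendsto (fun b => ψ b / b) (𝓝[>] 0) (𝓝 c))
    (hφ : Tendsto (fun b => φ b / b ^ 2) (𝓝[>] 0) (𝓝 (c / 2))) :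
    Tendsto (fun n : ℕ => Real.sqrt (2 / (n * c))) atTop (𝓝[>] 0) ∧
    Tendsto (fun n : ℕ => (1 - n * φ (Real.sqrt (2 / (n * c)))
      + n * Real.sqrt (2 / (n * c)) * ψ (Real.sqrt (2 / (n * c))))
      / (Real.sqrt n * ψ (Real.sqrt (2 / (n * c))))) atTop (𝓝 (1 / Real.sqrt (1 / 2 * c))) := by
  have hb : Tendsto (fun n : ℕ => Real.sqrt (2 / (n * c))) atTop (𝓝[>] 0) := by
    refine tendsto_nhdsWithin_iff.2 ⟨?_, ?_⟩
    · have h1 : Tendsto (fun n : ℕ => 2 / c / (n : ℝ)) atTop (𝓝 0) :=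
        tendsto_const_div_atTop_nhds_zero_nat _
      have h2 := (Real.continuous_sqrt.tendsto 0).comp h1
      rw [Real.sqrt_zero] at h2
      refine h2.congr fun n => ?_
      simp only [Function.comp]
      rw [div_div, mul_comm c]
    · filter_upwards [eventually_gt_atTop 0] with n hn
      have : (0 : ℝ) < n := by exact_mod_cast hn
      exact Real.sqrt_pos.2 (by positivity)
  refine ⟨hb, ?_⟩
  have h1 := hψ.comp hb
  have h2 := hφ.comp hb
  -- The choice of `b` makes `n * b ^ 2 = 2 / c`, so that `n * c * b ^ 2 / 2` equals the covertness
  -- level `1`. The quotient is then a function of `ψ b / b` and `φ b / b ^ 2` alone.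
  have h3 : Tendsto (fun n : ℕ => (1 + 2 / c * (ψ (Real.sqrt (2 / (n * c))) / Real.sqrt (2 / (n * c))
      - φ (Real.sqrt (2 / (n * c))) / Real.sqrt (2 / (n * c)) ^ 2))
      / (Real.sqrt (2 / c) * (ψ (Real.sqrt (2 / (n * c))) / Real.sqrt (2 / (n * c))))) atTop
      (𝓝 ((1 + 2 / c * (c - c / 2)) / (Real.sqrt (2 / c) * c))) := by
    refine Tendsto.div (tendsto_const_nhds.add ((h1.sub h2).const_mul _)) (h1.const_mul _) ?_
    have : 0 < Real.sqrt (2 / c) := Real.sqrt_pos.2 (by positivity)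
    positivity
  have e : (1 + 2 / c * (c - c / 2)) / (Real.sqrt (2 / c) * c) = 1 / Real.sqrt (1 / 2 * c) := by
    have e1 : 1 + 2 / c * (c - c / 2) = 2 := by field_simp; ring
    have e2 : Real.sqrt (2 / c) * c = 2 * Real.sqrt (1 / 2 * c) := by
      have h4 : (2 / c) = (1 / 2 * c) * (2 / c) ^ 2 := by field_simp
      rw [h4, Real.sqrt_mul (by positivity), Real.sqrt_sq (by positivity)]
      field_simp
    have : 0 < Real.sqrt (1 / 2 * c) := Real.sqrt_pos.2 (by positivity)
    rw [e1, e2]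
    field_simp
  rw [← e]
  refine h3.congr' ?_
  filter_upwards [eventually_gt_atTop 0] with n hn
  have hn' : (0 : ℝ) < n := by exact_mod_cast hn
  set b := Real.sqrt (2 / (n * c)) with hbd
  have hb0 : 0 < b := Real.sqrt_pos.2 (by positivity)
  have hb2 : 2 / c = n * b ^ 2 := by
    rw [hbd, Real.sq_sqrt (by positivity)]; field_simp
  have hs : Real.sqrt (2 / c) = Real.sqrt n * b := by
    rw [hb2, Real.sqrt_mul hn'.le, Real.sqrt_sq hb0.le]
  rw [hs, hb2]
  congr 1 <;> field_simp
  ring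

-- Shared by both secrecy notions, which enter only through the leakage bound. First `n → ∞` at
-- fixed `ε`, then `ε → 0`.
open Filter Topology in
lemma rate_le_of_codes (hB : supp (P.bob 1) ≤ supp (P.bob 0))
    (hW : supp (P.willie 1) ≤ supp (P.willie 0)) (hne : P.willie 1 ≠ P.willie 0) {r : ℝ}
    (H : ∀ ε : ℝ, 0 < ε → ε < 1 → ∀ᶠ n : ℕ in atTop, ∃ M L : ℕ, 0 < M ∧ 0 < L ∧
      Real.sqrt n * r ≤ Real.log M ∧ ∃ C : SecrecyCode (Fin 2) B M L 1 n,
        C.Reliable P ε ∧ C.Covert P 1 ∧ C.leakage P ≤ ε * Real.log M + 3) :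
    r ≤ max 0 (relEnt (P.bob 1) (P.bob 0) - relEnt (P.willie 1) (P.willie 0))
      / Real.sqrt (1 / 2 * chiSq (P.willie 1) (P.willie 0)) := by
  obtain ⟨hc, hψ, hφ⟩ := second_order P.willie_isDensity hW hne
  set c := chiSq (P.willie 1) (P.willie 0)
  set DB := relEnt (P.bob 1) (P.bob 0)
  set DW := relEnt (P.willie 1) (P.willie 0)
  obtain ⟨hb, hu⟩ := tendsto_weight_bound hc hψ hφ
  have hDW : 0 ≤ DW := relEnt_nonneg_of_supp (P.willie_isDensity 1) (P.willie_isDensity 0) hW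
  have key : ∀ ε : ℝ, 0 < ε → ε < 1 / 4 →
      (1 - 4 * ε) * (1 - ε) * r ≤ max 0 (DB - DW + 4 * ε * DW) * (1 / Real.sqrt (1 / 2 * c)) := by
    intro ε hε hε4
    have hlim := (hu.const_mul (max 0 (DB - DW + 4 * ε * DW))).add
      ((tendsto_const_nhds (x := 1 + (1 - 4 * ε) * (4 - Real.log ε))).div_atTop
        (Real.tendsto_sqrt_atTop.comp tendsto_natCast_atTop_atTop))
    rw [add_zero] at hlim
    refine ge_of_tendsto hlim ?_
    have hψpos : ∀ᶠ b in 𝓝[>] (0 : ℝ), 0 < slopeLog P.willie b / b :=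
      hψ.eventually (lt_mem_nhds hc)
    filter_upwards [H ε hε (by linarith), hb.eventually hψpos,
      hb.eventually (Ioo_mem_nhdsGT (show (0 : ℝ) < 1 by norm_num)), eventually_gt_atTop 0]
      with n ⟨M, L, hM, hL, hr, C, hrel, hcov, hleak⟩ hp hb1 hn
    have hn' : (0 : ℝ) < n := by exact_mod_cast hn
    set b := Real.sqrt (2 / (n * c))
    have hM' : (0 : ℝ) < M := by exact_mod_cast hM
    have hL' : (0 : ℝ) < L := by exact_mod_cast hL
    have hψb : 0 < slopeLog P.willie b := by
      have := mul_pos hp hb1.1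
      rwa [div_mul_cancel₀ _ hb1.1.ne'] at this
    have i1 := C.log_card_le P hM hL hB hε (by linarith) hrel
    have i2 := C.covert_bounds P hM hL hW hcov
    have i3 := C.weight_bound P hM hL hW hcov hb1.1 hb1.2
    have hA := C.avgWeight_nonneg
    set a := C.avgWeight
    rw [Real.log_mul hε.ne' (by positivity), Real.log_mul hM'.ne' hL'.ne'] at i1
    change n * _ + a * slopeLog P.willie b ≤ 1 at i3
    have hφe := relEnt_mix_eq (o := P.willie) b
    have hsn : 0 < Real.sqrt n := Real.sqrt_pos.2 hn'
    have i4 : a / Real.sqrt n ≤ (1 - n * relEnt (mix P.willie b) (P.willie 0)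
        + n * b * slopeLog P.willie b) / (Real.sqrt n * slopeLog P.willie b) := by
      rw [div_le_div_iff₀ hsn (by positivity)]
      have : a * slopeLog P.willie b ≤ 1 - n * relEnt (mix P.willie b) (P.willie 0)
        + n * b * slopeLog P.willie b := by rw [hφe]; linarith
      nlinarith
    -- Bob's bound minus `1 - 4 * ε` times Willie's eliminates `log L`. The `4` is the covertness
    -- level `1` plus the constant `3` of the leakage.
    have i5 : (1 - 4 * ε) * (1 - ε) * (Real.sqrt n * r)
        ≤ a * (DB - DW + 4 * ε * DW) + (1 + (1 - 4 * ε) * (4 - Real.log ε)) := by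
      have h1 := mul_le_mul_of_nonneg_left hr
        (show 0 ≤ (1 - 4 * ε) * (1 - ε) from mul_nonneg (by linarith) (by linarith))
      have h2 := mul_le_mul_of_nonneg_left (i2.trans (add_le_add_right hleak _))
        (show 0 ≤ 1 - 4 * ε by linarith)
      nlinarith
    have i6 : a * (DB - DW + 4 * ε * DW) ≤ a * max 0 (DB - DW + 4 * ε * DW) :=
      mul_le_mul_of_nonneg_left (le_max_right _ _) hA
    have i7 := mul_le_mul_of_nonneg_left i4 (le_max_left 0 (DB - DW + 4 * ε * DW))
    calc (1 - 4 * ε) * (1 - ε) * r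
        = ((1 - 4 * ε) * (1 - ε) * (Real.sqrt n * r)) / Real.sqrt n := by field_simp
      _ ≤ (a * max 0 (DB - DW + 4 * ε * DW) + (1 + (1 - 4 * ε) * (4 - Real.log ε)))
          / Real.sqrt n := by gcongr; linarith
      _ = max 0 (DB - DW + 4 * ε * DW) * (a / Real.sqrt n)
          + (1 + (1 - 4 * ε) * (4 - Real.log ε)) / Real.sqrt n := by ring
      _ ≤ _ := add_le_add_left i7 _
  have hcl : Continuous fun ε : ℝ => (1 - 4 * ε) * (1 - ε) * r := by fun_prop
  have hcr : Continuous fun ε : ℝ =>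
      max 0 (DB - DW + 4 * ε * DW) * (1 / Real.sqrt (1 / 2 * c)) := by fun_prop
  have h := le_of_tendsto_of_tendsto ((hcl.tendsto 0).mono_left nhdsWithin_le_nhds)
    ((hcr.tendsto 0).mono_left nhdsWithin_le_nhds) (b := 𝓝[>] (0 : ℝ)) (by
      filter_upwards [Ioo_mem_nhdsGT (show (0 : ℝ) < 1 / 4 by norm_num)] with ε hε
      exact key ε hε.1 hε.2)
  simpa [div_eq_mul_inv] using h

lemma CQChannel.Achievable.rate_le (hB : supp (P.bob 1) ≤ supp (P.bob 0))
    (hW : supp (P.willie 1) ≤ supp (P.willie 0)) (hne : P.willie 1 ≠ P.willie 0) {r : ℝ}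
    (h : P.Achievable r) :
    r ≤ max 0 (relEnt (P.bob 1) (P.bob 0) - relEnt (P.willie 1) (P.willie 0))
      / Real.sqrt (1 / 2 * chiSq (P.willie 1) (P.willie 0)) := by
  refine rate_le_of_codes hB hW hne fun ε hε hε1 => ?_
  filter_upwards [h ε 1 ε hε one_pos hε] with n ⟨M, L, hM, hL, hr, C, hrel, hcov, hsec⟩
  rw [mul_one] at hr
  exact ⟨M, L, hM, hL, hr, C, hrel, hcov, C.leakage_of_secret P hM hL hε1.le hsec⟩

lemma CQChannel.WeaklyAchievable.rate_le (hB : supp (P.bob 1) ≤ supp (P.bob 0))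
    (hW : supp (P.willie 1) ≤ supp (P.willie 0)) (hne : P.willie 1 ≠ P.willie 0) {r : ℝ}
    (h : P.WeaklyAchievable r) :
    r ≤ max 0 (relEnt (P.bob 1) (P.bob 0) - relEnt (P.willie 1) (P.willie 0))
      / Real.sqrt (1 / 2 * chiSq (P.willie 1) (P.willie 0)) := by
  refine rate_le_of_codes hB hW hne fun ε hε _ => ?_
  filter_upwards [h ε 1 ε hε one_pos hε] with n ⟨M, L, hM, hL, hr, C, hrel, hcov, hsec⟩
  rw [mul_one] at hr
  refine ⟨M, L, hM, hL, hr, C, hrel, hcov, ?_⟩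
  rw [SecrecyCode.WeaklySecret, C.mutualInfo_eq P hM hL] at hsec
  linarith

end Converse

/-! ### Matrix powers, Petz quasi-entropies and Audenaert's test -/

section Powers

variable {A I : Type*} [Fintype A] [DecidableEq A] [Fintype I] [DecidableEq I] {n : ℕ}

/-- Real powers of positive semidefinite matrices. -/
def mpow (ρ : Matrix A A ℂ) (t : ℝ) : Matrix A A ℂ := cfc (fun x : ℝ => x ^ t) ρ

lemma IsDiag.mpow {ρ U : Matrix A A ℂ} {a : A → ℝ} (h : IsDiag ρ U a) (t : ℝ) :
    IsDiag (mpow ρ t) U fun i => a i ^ t := h.cfc_sq _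

lemma mpow_posSemidef {ρ : Matrix A A ℂ} (hρ : ρ.PosSemidef) (t : ℝ) : (mpow ρ t).PosSemidef := by
  obtain ⟨U, a, h⟩ := exists_isDiag hρ.1
  exact (h.mpow t).posSemidef fun i => Real.rpow_nonneg (h.nonneg hρ i) t

/-- The Löwner-Heinz inequality. -/
lemma mpow_mono {ρ σ : Matrix A A ℂ} (hρ : ρ.PosSemidef) (h : ρ ≤ σ) {t : ℝ} (h0 : 0 ≤ t)
    (h1 : t ≤ 1) : mpow ρ t ≤ mpow σ t := by
  have hρ' : 0 ≤ ρ := nonneg_iff_posSemidef.2 hρ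
  have := CFC.monotone_rpow (A := Matrix A A ℂ) (p := t) ⟨h0, h1⟩ h
  simp only at this
  rwa [CFC.rpow_eq_cfc_real hρ', CFC.rpow_eq_cfc_real (hρ'.trans h)] at this

lemma mpow_smul {ρ : Matrix A A ℂ} (hρ : ρ.PosSemidef) {c : ℝ} (hc : 0 ≤ c) (t : ℝ) :
    mpow ((c : ℂ) • ρ) t = ((c ^ t : ℝ) : ℂ) • mpow ρ t := by
  obtain ⟨U, a, h⟩ := exists_isDiag hρ.1
  rw [((h.smul c).mpow t).eq, (h.mpow t).eq, ← Matrix.smul_mul, ← Matrix.mul_smul]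
  congr 2
  ext i j
  by_cases hij : i = j
  · subst hij
    simp [dg, Real.mul_rpow hc (h.nonneg hρ i)]
  · simp [dg, hij]

lemma mpow_mul_mpow {ρ : Matrix A A ℂ} (hρ : ρ.PosSemidef) {s t : ℝ} (hst : s + t = 1) :
    mpow ρ s * mpow ρ t = ρ := by
  obtain ⟨U, a, h⟩ := exists_isDiag hρ.1
  rw [(h.mpow s).eq, (h.mpow t).eq, conj_dg_mul h.iso]
  conv_rhs => rw [h.eq]
  congr 3
  ext i
  rw [← Real.rpow_add' (h.nonneg hρ i) (by rw [hst]; exact one_ne_zero), hst, Real.rpow_one]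

lemma mpow_tensorFam {ρ : Fin n → Matrix A A ℂ} (hρ : ∀ i, (ρ i).PosSemidef) (t : ℝ) :
    mpow (tensorFam ρ) t = tensorFam fun i => mpow (ρ i) t := by
  choose U a h using fun i => exists_isDiag (hρ i).1
  rw [((IsDiag.tensorFam h).mpow t).eq, (IsDiag.tensorFam fun i => (h i).mpow t).eq]
  congr 3
  ext j
  exact (Real.finsetProd_rpow _ _ (fun i _ => (h i).nonneg (hρ i) _) t).symm

/-- The Petz quasi-entropy `tr ρ^(1-t) σ^t`. -/
def petz (t : ℝ) (ρ σ : Matrix A A ℂ) : ℝ := (mpow ρ (1 - t) * mpow σ t).trace.re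

lemma IsDiag.petz_eq {ρ σ V W : Matrix A A ℂ} {r s : A → ℝ} (hV : IsDiag ρ V r) (hW : IsDiag σ W s)
    (t : ℝ) : petz t ρ σ = ∑ i, ∑ j, r i ^ (1 - t) * s j ^ t * ov V W i j :=
  (hV.mpow _).trace_mul (hW.mpow _)

lemma petz_tensorFam {ρ σ : Fin n → Matrix A A ℂ} (hρ : ∀ i, (ρ i).PosSemidef)
    (hσ : ∀ i, (σ i).PosSemidef) (t : ℝ) :
    petz t (tensorFam ρ) (tensorFam σ) = ∏ i, petz t (ρ i) (σ i) := by
  have h : ∀ i, (mpow (ρ i) (1 - t) * mpow (σ i) t).trace = ((petz t (ρ i) (σ i) : ℝ) : ℂ) := by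
    intro i
    obtain ⟨V, r, hV⟩ := exists_isDiag (hρ i).1
    obtain ⟨W, s, hW⟩ := exists_isDiag (hσ i).1
    rw [hV.petz_eq hW, (hV.mpow _).eq, (hW.mpow _).eq, trace_conj_dg_mul_conj_dg]
  rw [petz, mpow_tensorFam hρ, mpow_tensorFam hσ, tensorFam_mul, trace_tensorFam,
    Finset.prod_congr rfl fun i _ => h i, ← Complex.ofReal_prod, Complex.ofReal_re]

lemma petz_nonneg {ρ σ : Matrix A A ℂ} (hρ : ρ.PosSemidef) (hσ : σ.PosSemidef) (t : ℝ) :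
    0 ≤ petz t ρ σ := trace_mul_nonneg (mpow_posSemidef hρ _) (mpow_posSemidef hσ _)

lemma petz_smul_right {ρ σ : Matrix A A ℂ} (hσ : σ.PosSemidef) {c : ℝ} (hc : 0 ≤ c) (t : ℝ) :
    petz t ρ ((c : ℂ) • σ) = c ^ t * petz t ρ σ := by
  rw [petz, mpow_smul hσ hc, Matrix.mul_smul, trace_smul, smul_eq_mul, Complex.re_ofReal_mul, petz]

lemma petz_mono_right {ρ σ τ : Matrix A A ℂ} (hρ : ρ.PosSemidef) (hσ : σ.PosSemidef) (h : σ ≤ τ)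
    {t : ℝ} (h0 : 0 ≤ t) (h1 : t ≤ 1) : petz t ρ σ ≤ petz t ρ τ :=
  trace_mul_le_of_le (mpow_posSemidef hρ _) (mpow_mono hσ h h0 h1)

/-- Weighted arithmetic-geometric mean on each pair of eigenvalues. -/
lemma petz_le_one {ρ σ : Matrix A A ℂ} (hρ : IsDensity ρ) (hσ : IsDensity σ) {t : ℝ} (h0 : 0 ≤ t)
    (h1 : t ≤ 1) : petz t ρ σ ≤ 1 := by
  obtain ⟨V, r, hV⟩ := exists_isDiag hρ.1.1
  obtain ⟨W, s, hW⟩ := exists_isDiag hσ.1.1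
  have e1 : ∑ i, r i = 1 := by rw [← hV.trace_re, hρ.re_trace]
  have e2 : ∑ j, s j = 1 := by rw [← hW.trace_re, hσ.re_trace]
  rw [hV.petz_eq hW]
  calc _ ≤ ∑ i, ∑ j, ((1 - t) * (r i * ov V W i j) + t * (s j * ov V W i j)) := by
        refine Finset.sum_le_sum fun i _ => Finset.sum_le_sum fun j _ => ?_
        have := Real.geom_mean_le_arith_mean2_weighted (sub_nonneg.2 h1) h0
          (hV.nonneg hρ.1 i) (hW.nonneg hσ.1 j) (by ring)
        have := mul_le_mul_of_nonneg_right this (ov_nonneg V W i j)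
        linarith
    _ = 1 := by
        simp_rw [Finset.sum_add_distrib, ← Finset.mul_sum]
        rw [Finset.sum_comm (f := fun i j => s j * ov V W i j)]
        simp_rw [← Finset.mul_sum, sum_ov_right hV.iso hW.unitary, sum_ov_left hV.unitary hW.iso,
          mul_one, e1, e2]
        ring

open Filter Topology in
/-- The derivative of the Petz quasi-entropy at `0` is minus the relative entropy. -/
lemma hasDerivAt_petz {ρ σ W : Matrix A A ℂ} {s : A → ℝ} (hρ : ρ.PosSemidef) (hσ : σ.PosSemidef)
    (hW : IsDiag σ W s) (hac : AbsCont ρ W s) :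
    HasDerivAt (fun t => petz t ρ σ) (-relEnt ρ σ) 0 := by
  obtain ⟨V, r, hV⟩ := exists_isDiag hρ.1
  have h1 : -relEnt ρ σ
      = ∑ i, ∑ j, (r i * Real.log (s j) - r i * Real.log (r i)) * ov V W i j := by
    rw [relEnt, hV.crossLog_self, hW.crossLog_eq]
    simp_rw [sub_mul, Finset.sum_sub_distrib]
    rw [neg_sub]
    congr 1
    · rw [Finset.sum_comm]
      refine Finset.sum_congr rfl fun j _ => ?_
      rw [← hV.sum_overlap, Finset.mul_sum]
      exact Finset.sum_congr rfl fun i _ => by ring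
    · refine Finset.sum_congr rfl fun i _ => ?_
      rw [← Finset.mul_sum, sum_ov_right hV.iso hW.unitary, mul_one]
  simp_rw [hV.petz_eq hW]
  rw [h1]
  refine HasDerivAt.fun_sum fun i _ => HasDerivAt.fun_sum fun j _ => ?_
  have hev : ∀ᶠ t : ℝ in 𝓝 0, 1 - t ≠ 0 := by
    filter_upwards [Iio_mem_nhds (show (0 : ℝ) < 1 by norm_num)] with t ht
    exact (sub_pos.2 ht).ne'
  have hov : s j = 0 → r i * ov V W i j = 0 := by
    intro h0
    have hz := hac j h0
    rw [← hV.sum_overlap] at hz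
    exact (Finset.sum_eq_zero_iff_of_nonneg fun i _ =>
      mul_nonneg (hV.nonneg hρ i) (ov_nonneg V W i j)).1 hz i (Finset.mem_univ _)
  -- Such terms vanish identically near `t = 0`, where the exponent `1 - t` is non-zero. For all
  -- others absolute continuity makes both eigenvalues positive.
  by_cases hz : r i * ov V W i j = 0
  · have e : (r i * Real.log (s j) - r i * Real.log (r i)) * ov V W i j = 0 := by
      rw [show (r i * Real.log (s j) - r i * Real.log (r i)) * ov V W i j
        = (Real.log (s j) - Real.log (r i)) * (r i * ov V W i j) by ring, hz, mul_zero]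
    rw [e]
    refine (hasDerivAt_const (0 : ℝ) (0 : ℝ)).congr_of_eventuallyEq ?_
    filter_upwards [hev] with t ht
    rcases mul_eq_zero.1 hz with h | h
    · rw [h, Real.zero_rpow ht]; simp
    · rw [h, mul_zero]
  · have hr : 0 < r i := lt_of_le_of_ne (hV.nonneg hρ i) fun h => hz (by rw [← h, zero_mul])
    have hs : 0 < s j := lt_of_le_of_ne (hW.nonneg hσ j) fun h => hz (hov h.symm)
    have d1 : HasDerivAt (fun t : ℝ => 1 - t) (-1) 0 := by
      simpa using (hasDerivAt_id (0 : ℝ)).const_sub 1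
    have d2 := (d1.const_rpow hr).mul ((hasDerivAt_id (0 : ℝ)).const_rpow hs)
    have d3 := d2.mul_const (ov V W i j)
    refine d3.congr_deriv ?_
    congr 1
    simp
    ring

lemma petz_zero {ρ : Matrix A A ℂ} (hρ : ρ.PosSemidef) {σ : Matrix A A ℂ} (hσ : σ.PosSemidef) :
    petz 0 ρ σ = ρ.trace.re := by
  obtain ⟨V, r, hV⟩ := exists_isDiag hρ.1
  obtain ⟨W, s, hW⟩ := exists_isDiag hσ.1
  rw [hV.petz_eq hW, hV.trace_re]
  simp only [sub_zero, Real.rpow_one, Real.rpow_zero, mul_one]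
  exact Finset.sum_congr rfl fun i _ => by
    rw [← Finset.mul_sum, sum_ov_right hV.iso hW.unitary, mul_one]

/-- Audenaert's inequality: a test between two positive operators. -/
lemma exists_test {ρ σ : Matrix A A ℂ} (hρ : ρ.PosSemidef) (hσ : σ.PosSemidef) {t : ℝ}
    (h0 : 0 ≤ t) (h1 : t ≤ 1) : ∃ T : Matrix A A ℂ, T.PosSemidef ∧ T ≤ 1 ∧
      ((1 - T) * ρ).trace.re + (T * σ).trace.re ≤ petz t ρ σ := by
  obtain ⟨U, a, h⟩ := exists_isDiag (hρ.1.sub hσ.1)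
  -- The test is the projection onto the positive part of `ρ - σ`, and its total error is `tr ρ - tr
  -- P`.
  have hT := h.cfc_sq (fun x => if 0 < x then 1 else 0)
  have hp := h.cfc_sq (fun x => max x 0)
  set T := cfc (fun x : ℝ => if 0 < x then (1 : ℝ) else 0) (ρ - σ)
  set P := cfc (fun x : ℝ => max x 0) (ρ - σ)
  have hPpos : P.PosSemidef := hp.posSemidef fun i => le_max_right _ _
  have hTP : T * (ρ - σ) = P := by
    rw [hT.eq, hp.eq]
    conv_lhs => rw [h.eq]
    rw [conj_dg_mul h.iso]
    congr 3
    ext i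
    rcases lt_or_ge 0 (a i) with hi | hi
    · simp [hi, hi.le]
    · simp [hi, hi.not_gt]
  have hone : (1 : Matrix A A ℂ) = U * dg (fun _ => 1) * Uᴴ := by simp [dg, h.unitary]
  refine ⟨T, hT.posSemidef fun i => by split_ifs <;> norm_num, ?_, ?_⟩
  · rw [le_iff]
    have : 1 - T = U * dg (fun i => 1 - if 0 < a i then (1 : ℝ) else 0) * Uᴴ := by
      rw [hT.eq]
      conv_lhs => rw [hone]
      rw [← Matrix.sub_mul, ← Matrix.mul_sub]
      congr 2
      ext i j; by_cases hij : i = j <;> simp [dg, hij]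
    rw [this]
    exact conj_dg_posSemidef (fun i => by split_ifs <;> norm_num) U
  · have hle : ρ ≤ σ + P := by
      have hn : (P - (ρ - σ)).PosSemidef := by
        have : P - (ρ - σ) = U * dg (fun i => max (a i) 0 - a i) * Uᴴ := by
          rw [hp.eq]
          conv_lhs => rw [h.eq]
          rw [← Matrix.sub_mul, ← Matrix.mul_sub]
          congr 2
          ext i j; by_cases hij : i = j <;> simp [dg, hij]
        rw [this]
        exact conj_dg_posSemidef (fun i => sub_nonneg.2 (le_max_left _ _)) U
      rw [le_iff]
      rwa [show σ + P - ρ = P - (ρ - σ) by abel]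
    have hle' : σ ≤ σ + P := le_add_posSemidef σ hPpos
    have hZ : (σ + P).PosSemidef := hσ.add hPpos
    have s0 : 0 ≤ 1 - t := sub_nonneg.2 h1
    have s1 : 1 - t ≤ 1 := by linarith
    -- With `Z = σ + P` above both operators, the chain is tr ρ - petz ≤ tr ρ^(1-t)(Z^t - σ^t) ≤ tr
    -- Z^(1-t)(Z^t - σ^t) ≤ tr P.
    have m1 := trace_mul_le_of_le (mpow_posSemidef hρ (1 - t)) (mpow_mono hρ hle h0 h1)
    have m2 := trace_mul_le_of_le (le_iff.1 (mpow_mono hσ hle' h0 h1)) (mpow_mono hρ hle s0 s1)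
    have m3 := trace_mul_le_of_le (mpow_posSemidef hσ t) (mpow_mono hσ hle' s0 s1)
    have e1 : (mpow ρ (1 - t) * mpow ρ t).trace.re = ρ.trace.re := by
      rw [mpow_mul_mpow hρ (by ring)]
    have e2 : (mpow (σ + P) t * mpow (σ + P) (1 - t)).trace.re = σ.trace.re + P.trace.re := by
      rw [mpow_mul_mpow hZ (by ring), trace_add, Complex.add_re]
    have e3 : (mpow σ t * mpow σ (1 - t)).trace.re = σ.trace.re := by
      rw [mpow_mul_mpow hσ (by ring)]
    rw [Matrix.sub_mul, Matrix.sub_mul, trace_sub, trace_sub, Complex.sub_re, Complex.sub_re, e2,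
      trace_mul_comm (mpow (σ + P) t), trace_mul_comm (mpow σ t)] at m2
    have e4 : ((1 - T) * ρ).trace.re + (T * σ).trace.re = ρ.trace.re - P.trace.re := by
      rw [← hTP, Matrix.mul_sub, Matrix.sub_mul, Matrix.one_mul]
      simp only [trace_sub, Complex.sub_re]
      ring
    rw [e4, petz]
    linarith

end Powers

/-! ### Square-root measurements -/

section Measurement

variable {A J : Type*} [Fintype A] [DecidableEq A] [Fintype J] [DecidableEq J]

/-- The Hayashi-Nagaoka inequality, with the square root measurement operator exposed. -/
lemma exists_inv_sqrt {G : Matrix A A ℂ} (hG : G.PosDef) :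
    ∃ X : Matrix A A ℂ, Xᴴ = X ∧ X * G * X = 1 ∧ ∀ S : Matrix A A ℂ, S.PosSemidef → S ≤ 1 →
      S ≤ G → 1 - X * S * X ≤ (2 : ℂ) • (1 - S) + (4 : ℂ) • (G - S) := by
  obtain ⟨U, g, h⟩ := exists_isDiag hG.1
  have hg := h.pos hG
  have hU := h.unitary
  set X := U * dg (fun i => (Real.sqrt (g i))⁻¹) * Uᴴ with hX
  have hXX : Xᴴ = X := by
    rw [hX, conjTranspose_mul, conjTranspose_mul, dg_conjTranspose, conjTranspose_conjTranspose,
      Matrix.mul_assoc]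
  have hR := h.cfc_sq Real.sqrt
  set R := cfc Real.sqrt G
  have hXG : X * G = R := by
    rw [hX, hR.eq]
    conv_lhs => rw [h.eq]
    rw [conj_dg_mul h.iso]
    congr 3
    ext i
    have := Real.sqrt_pos.2 (hg i)
    rw [inv_mul_eq_iff_eq_mul₀ this.ne', Real.mul_self_sqrt (hg i).le]
  have hGX : G * X = R := by
    have := congrArg conjTranspose hXG
    rwa [conjTranspose_mul, hXX, hG.1, hR.isHermitian] at this
  have hRX : R * X = 1 := by
    rw [hX, hR.eq, conj_dg_mul h.iso]
    have : (fun i => Real.sqrt (g i) * (Real.sqrt (g i))⁻¹) = fun _ => 1 := by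
      ext i
      exact mul_inv_cancel₀ (Real.sqrt_pos.2 (hg i)).ne'
    rw [this]; simp [dg, hU]
  have hXGX : X * G * X = 1 := by rw [hXG, hRX]
  refine ⟨X, hXX, hXGX, fun S hS hS1 hSG => ?_⟩
  -- The square root is operator monotone and `S * S ≤ S ≤ G`.
  have hSR : S ≤ R := by
    obtain ⟨W, s, hW⟩ := exists_isDiag hS.1
    have hSS : (S * S).PosSemidef := by
      have := posSemidef_conjTranspose_mul_self S
      rwa [hS.1] at this
    have hle : S * S ≤ G := (sq_le_self_of_le_one hS hS1).trans hSG
    have h2 := mpow_mono hSS hle (t := 1 / 2) (by norm_num) (by norm_num)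
    have hd : IsDiag (S * S) W fun i => s i * s i := by
      refine ⟨hW.iso, ?_⟩
      conv_lhs => rw [hW.eq]
      exact conj_dg_mul hW.iso _ _
    have e1 : mpow (S * S) (1 / 2) = S := by
      rw [(hd.mpow _).eq]
      conv_rhs => rw [hW.eq]
      congr 3
      ext i
      rw [← Real.sqrt_eq_rpow, Real.sqrt_mul_self (hW.nonneg hS i)]
    have e2 : mpow G (1 / 2) = R := by
      rw [(h.mpow _).eq, hR.eq]
      simp_rw [← Real.sqrt_eq_rpow]
    rwa [e1, e2] at h2
  have hT : (G - S).PosSemidef := le_iff.1 hSG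
  have q1 : ((X - 1 - 1)ᴴ * (G - S) * (X - 1 - 1)).PosSemidef := hT.conjTranspose_mul_mul_same _
  have q2 : ((X - 1)ᴴ * S * (X - 1)).PosSemidef := hS.conjTranspose_mul_mul_same _
  have q3 := le_iff.1 hSR
  -- An explicit certificate: the gap is a sum of three positive semidefinite terms.
  have e : (2 : ℂ) • (1 - S) + (4 : ℂ) • (G - S) - (1 - X * S * X)
      = (X - 1 - 1)ᴴ * (G - S) * (X - 1 - 1) + (2 : ℂ) • ((X - 1)ᴴ * S * (X - 1))
        + (4 : ℂ) • (R - S) := by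
    have hadj : (X - 1 - 1)ᴴ = X - 1 - 1 := by
      rw [conjTranspose_sub, conjTranspose_sub, hXX, conjTranspose_one]
    have hadj' : (X - 1)ᴴ = X - 1 := by rw [conjTranspose_sub, hXX, conjTranspose_one]
    have hSX : X * S * X = 1 - X * (G - S) * X := by
      rw [Matrix.mul_sub, Matrix.sub_mul, hXGX]; abel
    have hsplit : (X - 1 - 1) * (G - S) * (X - 1 - 1)
        = X * (G - S) * X - (2 : ℂ) • (X * (G - S)) - (2 : ℂ) • ((G - S) * X)
          + (4 : ℂ) • (G - S) := by
      simp only [two_smul, show (4 : ℂ) = 2 + 2 by norm_num, add_smul]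
      noncomm_ring
    have hsplit' : (X - 1) * S * (X - 1) = X * S * X - X * S - S * X + S := by noncomm_ring
    have f1 : X * (G - S) = R - X * S := by rw [Matrix.mul_sub, hXG]
    have f2 : (G - S) * X = R - S * X := by rw [Matrix.sub_mul, hGX]
    have f3 : X * (G - S) * X = 1 - X * S * X := by
      rw [Matrix.mul_sub, Matrix.sub_mul, hXGX]
    rw [hadj, hadj', hsplit, hsplit', f3, f1, f2]
    module
  rw [le_iff, e]
  exact (q1.add (q2.smul (by norm_num))).add (q3.smul (by norm_num))

/-- A measurement built from a family of tests. -/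
lemma exists_measurement [Nonempty J] (T : J → Matrix A A ℂ) (hT : ∀ j, (T j).PosSemidef)
    (hT1 : ∀ j, T j ≤ 1) {c : ℝ} (hc : 0 < c) :
    ∃ Λ : J → Matrix A A ℂ, (∀ j, (Λ j).PosSemidef) ∧ ∑ j, Λ j = 1 ∧
      ∀ j, 1 - Λ j ≤ (2 : ℂ) • (1 - T j) + (4 : ℂ) • (∑ k ∈ Finset.univ.erase j, T k) + (c : ℂ) • 1 := by
  set N : ℝ := (Fintype.card J : ℝ)
  have hN : 0 < N := Nat.cast_pos.2 Fintype.card_pos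
  -- Mixing every test with a little identity makes the sum invertible; `η` is small enough for the
  -- extra error to fit into `c`.
  obtain ⟨η, hη0, hη1, hηc⟩ : ∃ η : ℝ, 0 < η ∧ η ≤ 1 ∧ 4 * (N * η) ≤ c :=
    ⟨min 1 (c / (4 * N)), lt_min one_pos (by positivity), min_le_left _ _, by
      calc 4 * (N * min 1 (c / (4 * N))) ≤ 4 * (N * (c / (4 * N))) := by
            gcongr; exact min_le_right _ _
        _ = c := by field_simp⟩
  set S : J → Matrix A A ℂ := fun j => ((1 - η : ℝ) : ℂ) • T j + (η : ℂ) • 1 with hSdef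
  have hS : ∀ j, (S j).PosDef := fun j =>
    posDef_add_smul_one (smul_posSemidef (hT j) (sub_nonneg.2 hη1)) hη0
  have hS1 : ∀ j, S j ≤ 1 := by
    intro j
    rw [le_iff]
    have : 1 - S j = ((1 - η : ℝ) : ℂ) • (1 - T j) := by
      rw [hSdef]; push_cast; module
    rw [this]
    exact smul_posSemidef (le_iff.1 (hT1 j)) (sub_nonneg.2 hη1)
  have hGS : ∀ j, ∑ k, S k - S j = ∑ k ∈ Finset.univ.erase j, S k := by
    intro j
    rw [← Finset.add_sum_erase _ _ (Finset.mem_univ j)]; abel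
  have hsum : ∀ j, (∑ k ∈ Finset.univ.erase j, S k).PosSemidef := fun j =>
    posSemidef_sum _ fun k _ => (hS k).posSemidef
  have hG : (∑ j, S j).PosDef := by
    obtain ⟨j⟩ := ‹Nonempty J›
    rw [← Finset.add_sum_erase _ _ (Finset.mem_univ j)]
    exact posDef_add (hS j) (hsum j)
  obtain ⟨X, hX, hXG, hHN⟩ := exists_inv_sqrt hG
  refine ⟨fun j => X * S j * X, fun j => ?_, ?_, fun j => ?_⟩
  · have := (hS j).posSemidef.conjTranspose_mul_mul_same X
    rwa [hX] at this
  · rw [← Matrix.sum_mul, ← Matrix.mul_sum, hXG]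
  · refine (hHN (S j) (hS j).posSemidef (hS1 j) (by rw [le_iff, hGS]; exact hsum j)).trans ?_
    rw [hGS, le_iff]
    have e1 : ∑ k ∈ Finset.univ.erase j, S k = ((1 - η : ℝ) : ℂ) • ∑ k ∈ Finset.univ.erase j, T k
        + (((N - 1) * η : ℝ) : ℂ) • (1 : Matrix A A ℂ) := by
      rw [hSdef, Finset.sum_add_distrib, ← Finset.smul_sum, Finset.sum_const,
        Finset.card_erase_of_mem (Finset.mem_univ j), Finset.card_univ, ← Nat.cast_smul_eq_nsmul ℂ,
        smul_smul, Nat.cast_sub Fintype.card_pos]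
      push_cast
      rfl
    have e2 : (2 : ℂ) • (1 - T j) + (4 : ℂ) • (∑ k ∈ Finset.univ.erase j, T k) + (c : ℂ) • 1
        - ((2 : ℂ) • (1 - S j) + (4 : ℂ) • ∑ k ∈ Finset.univ.erase j, S k)
        = ((2 * η : ℝ) : ℂ) • (1 - T j) + ((4 * η : ℝ) : ℂ) • (∑ k ∈ Finset.univ.erase j, T k)
          + ((c - 4 * ((N - 1) * η) : ℝ) : ℂ) • (1 : Matrix A A ℂ) := by
      rw [e1, hSdef]; push_cast; module
    rw [e2]
    refine ((smul_posSemidef (le_iff.1 (hT1 j)) (by positivity)).add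
      (smul_posSemidef (posSemidef_sum _ fun k _ => hT k) (by positivity))).add
      (smul_posSemidef PosSemidef.one ?_)
    nlinarith

end Measurement

/-! ### Expectations over independent codebooks -/

section RandomCodebook

variable {J X : Type*} [Fintype J] [DecidableEq J] [Fintype X] [DecidableEq X]

lemma sum_codebook_weight {w : X → ℝ} (hw1 : ∑ x, w x = 1) :
    ∑ c : J → X, ∏ j, w (c j) = 1 := by
  have := (Finset.prod_univ_sum (fun _ : J => (Finset.univ : Finset X)) (fun _ x => w x)).symm
  rw [Fintype.piFinset_univ] at this
  rw [this]; simp [hw1]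

/-- Exchangeability: one codeword may be resampled. -/
lemma sum_codebook_resample {w : X → ℝ} (hw1 : ∑ x, w x = 1) (j : J) (F : X → (J → X) → ℝ) :
    ∑ c : J → X, (∏ k, w (c k)) * F (c j) c
      = ∑ c : J → X, (∏ k, w (c k)) * ∑ x, w x * F x (Function.update c j x) := by
  have hswap : ∑ p : X × (J → X), w p.1 * (∏ k, w (p.2 k)) * F p.1 (Function.update p.2 j p.1)
      = ∑ p : X × (J → X), w p.1 * (∏ k, w (p.2 k)) * F (p.2 j) p.2 := by
    -- Exchanging the `j`-th codeword with an independent fresh one is an involution that preserves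
    -- the product weight.
    have hinv : Function.Involutive
        (fun p : X × (J → X) => (p.2 j, Function.update p.2 j p.1)) := by
      rintro ⟨x, c⟩; simp
    refine Fintype.sum_equiv hinv.toPerm _ _ ?_
    rintro ⟨x, c⟩
    change w x * (∏ k, w (c k)) * F x (Function.update c j x)
      = w (c j) * (∏ k, w (Function.update c j x k))
        * F (Function.update c j x j) (Function.update c j x)
    rw [Function.update_self]
    congr 1
    have he : ∏ k ∈ Finset.univ.erase j, w (Function.update c j x k)
        = ∏ k ∈ Finset.univ.erase j, w (c k) :=
      Finset.prod_congr rfl fun k hk => by rw [Function.update_of_ne (Finset.ne_of_mem_erase hk)]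
    rw [← Finset.mul_prod_erase _ _ (Finset.mem_univ j),
      ← Finset.mul_prod_erase Finset.univ (fun k => w (Function.update c j x k))
        (Finset.mem_univ j), Function.update_self, he]
    ring
  rw [Fintype.sum_prod_type, Fintype.sum_prod_type] at hswap
  simp only at hswap
  calc _ = ∑ x, w x * ∑ c : J → X, (∏ k, w (c k)) * F (c j) c := by
        rw [← Finset.sum_mul, hw1, one_mul]
    _ = ∑ x, ∑ c : J → X, w x * (∏ k, w (c k)) * F (c j) c := by
        simp_rw [Finset.mul_sum, mul_assoc]
    _ = _ := by
        rw [← hswap, Finset.sum_comm]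
        simp_rw [Finset.mul_sum]
        exact Finset.sum_congr rfl fun c _ => Finset.sum_congr rfl fun x _ => by ring

lemma sum_codebook_single {w : X → ℝ} (hw1 : ∑ x, w x = 1) (j : J) (f : X → ℝ) :
    ∑ c : J → X, (∏ k, w (c k)) * f (c j) = ∑ x, w x * f x := by
  rw [sum_codebook_resample hw1 j fun x _ => f x, ← Finset.sum_mul, sum_codebook_weight hw1, one_mul]

lemma sum_codebook_pair {w : X → ℝ} (hw1 : ∑ x, w x = 1) {j k : J} (hjk : k ≠ j)
    (f : X → X → ℝ) :
    ∑ c : J → X, (∏ i, w (c i)) * f (c j) (c k) = ∑ x, ∑ y, w x * w y * f x y := by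
  rw [sum_codebook_resample hw1 j fun x c => f x (c k)]
  simp only [Function.update_of_ne hjk]
  rw [sum_codebook_single hw1 k fun y => ∑ x, w x * f x y]
  simp_rw [Finset.mul_sum]
  rw [Finset.sum_comm]
  exact Finset.sum_congr rfl fun _ _ => Finset.sum_congr rfl fun _ _ => by ring

end RandomCodebook

/-! ### Random coding for the receiver -/

section RandomCoding

variable {A J X : Type*} [Fintype A] [DecidableEq A] [Fintype J] [DecidableEq J] [Nonempty J]
  [Fintype X] [DecidableEq X]

/-- Random coding bound on the decoding error of a codebook of independent codewords. -/
lemma exists_decoders {w : X → ℝ} (hw : ∀ x, 0 ≤ w x) (hw1 : ∑ x, w x = 1)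
    {ρ : X → Matrix A A ℂ} (hρ : ∀ x, IsDensity (ρ x)) {τ : Matrix A A ℂ}
    (hτ : ∑ x, (w x : ℂ) • ρ x = τ) {t : ℝ} (h0 : 0 ≤ t) (h1 : t ≤ 1) {c : ℝ} (hc : 0 < c) :
    ∃ Λ : (J → X) → J → Matrix A A ℂ, (∀ C j, (Λ C j).PosSemidef) ∧ (∀ C, ∑ j, Λ C j = 1) ∧
      ∑ C : J → X, (∏ j, w (C j)) * ∑ j, (Fintype.card J : ℝ)⁻¹ *
          (1 - (Λ C j * ρ (C j)).trace.re)
        ≤ 2 * (2 * Fintype.card J : ℝ) ^ t * ∑ x, w x * petz t (ρ x) τ + c := by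
  set N : ℝ := (Fintype.card J : ℝ) with hNdef
  have hN : 0 < N := Nat.cast_pos.2 Fintype.card_pos
  have hτp : τ.PosSemidef := by
    rw [← hτ]; exact sum_smul_posSemidef _ (fun x _ => hw x) fun x _ => (hρ x).1
  -- Audenaert's test against `(2 * N) • τ`: Hayashi-Nagaoka weighs the own miss by `2` and each of
  -- fewer than `N` competitors by `4`, so twice the test error covers both.
  choose T hT hT1 hTest using fun x => exists_test (hρ x).1
    (smul_posSemidef hτp (show 0 ≤ 2 * N by positivity)) h0 h1
  choose Λ hΛ hΛ1 hΛe using fun C : J → X => exists_measurement (fun j => T (C j))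
    (fun j => hT _) (fun j => hT1 _) hc
  refine ⟨Λ, hΛ, hΛ1, ?_⟩
  set W : (J → X) → ℝ := fun C => ∏ j, w (C j) with hW
  have hWn : ∀ C, 0 ≤ W C := fun C => Finset.prod_nonneg fun j _ => hw _
  set u : X → ℝ := fun x => ((1 - T x) * ρ x).trace.re with hu
  set v : X → X → ℝ := fun x y => (T y * ρ x).trace.re with hv
  have hv0 : ∀ x y, 0 ≤ v x y := fun x y => trace_mul_nonneg (hT y) (hρ x).1
  have herr : ∀ C j, 1 - (Λ C j * ρ (C j)).trace.re
      ≤ 2 * u (C j) + 4 * ∑ k ∈ Finset.univ.erase j, v (C j) (C k) + c := by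
    intro C j
    have h2 := trace_mul_le_of_le (hρ (C j)).1 (hΛe C j)
    rw [trace_mul_comm, trace_mul_comm (ρ (C j))] at h2
    simp only [Matrix.sub_mul, Matrix.add_mul, Matrix.smul_mul, Matrix.one_mul, trace_sub,
      trace_add, trace_smul, Complex.sub_re, Complex.add_re, smul_eq_mul, Matrix.sum_mul,
      trace_sum, Complex.re_ofReal_mul, (hρ (C j)).re_trace] at h2
    rw [show (2 : ℂ) = ((2 : ℝ) : ℂ) by norm_num, show (4 : ℂ) = ((4 : ℝ) : ℂ) by norm_num,
      Complex.re_ofReal_mul, Complex.re_ofReal_mul, Complex.re_sum, Complex.sub_re,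
      (hρ (C j)).re_trace] at h2
    simp only [hu, hv, Matrix.sub_mul, Matrix.one_mul, trace_sub, Complex.sub_re,
      (hρ (C j)).re_trace]
    linarith
  have hvτ : ∀ x, ∑ y, w y * v y x = (T x * τ).trace.re := by
    intro x
    rw [← hτ, Matrix.mul_sum, trace_sum, Complex.re_sum]
    exact Finset.sum_congr rfl fun y _ => by
      rw [Matrix.mul_smul, trace_smul, smul_eq_mul, Complex.re_ofReal_mul]
  -- A competitor is independent of the transmitted word, so its test sees the mean state `τ`.
  have hpair : ∑ x, ∑ y, w x * w y * v x y = ∑ x, w x * (T x * τ).trace.re := by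
    rw [Finset.sum_comm]
    refine Finset.sum_congr rfl fun x _ => ?_
    rw [← hvτ, Finset.mul_sum]
    exact Finset.sum_congr rfl fun y _ => by ring
  set s1 := ∑ x, w x * u x
  set s2 := ∑ x, w x * (T x * τ).trace.re with hs2
  have hs20 : 0 ≤ s2 := Finset.sum_nonneg fun x _ => mul_nonneg (hw x) (trace_mul_nonneg (hT x) hτp)
  have hmain : ∀ j, ∑ C : J → X, W C * (1 - (Λ C j * ρ (C j)).trace.re)
      ≤ 2 * s1 + 4 * (N * s2) + c := by
    intro j
    calc _ ≤ ∑ C : J → X, W C * (2 * u (C j) + 4 * ∑ k ∈ Finset.univ.erase j, v (C j) (C k) + c) :=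
          Finset.sum_le_sum fun C _ => mul_le_mul_of_nonneg_left (herr C j) (hWn C)
      _ = 2 * ∑ C : J → X, W C * u (C j)
          + 4 * ∑ k ∈ Finset.univ.erase j, ∑ C : J → X, W C * v (C j) (C k)
          + (∑ C : J → X, W C) * c := by
          rw [Finset.sum_comm, Finset.mul_sum, Finset.mul_sum, Finset.sum_mul,
            ← Finset.sum_add_distrib, ← Finset.sum_add_distrib]
          refine Finset.sum_congr rfl fun C _ => ?_
          rw [← Finset.mul_sum]; ring
      _ = 2 * s1 + 4 * ∑ _k ∈ Finset.univ.erase j, s2 + c := by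
          rw [sum_codebook_single hw1 j u, sum_codebook_weight hw1, one_mul,
            Finset.sum_congr rfl fun k hk =>
              (sum_codebook_pair hw1 (Finset.ne_of_mem_erase hk) v).trans hpair]
      _ ≤ _ := by
          rw [Finset.sum_const, nsmul_eq_mul]
          have : ((Finset.univ.erase j).card : ℝ) ≤ N := by
            rw [hNdef]; exact_mod_cast Finset.card_le_univ _
          gcongr
  have htest : 2 * s1 + 4 * (N * s2)
      ≤ 2 * (2 * N) ^ t * ∑ x, w x * petz t (ρ x) τ := by
    have : s1 + 2 * N * s2 ≤ ∑ x, w x * ((2 * N) ^ t * petz t (ρ x) τ) := by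
      rw [hs2, Finset.mul_sum, ← Finset.sum_add_distrib]
      refine Finset.sum_le_sum fun x _ => ?_
      have h2 := hTest x
      rw [petz_smul_right hτp (by positivity), Matrix.mul_smul, trace_smul, smul_eq_mul,
        Complex.re_ofReal_mul] at h2
      have := mul_le_mul_of_nonneg_left h2 (hw x)
      linarith
    have e : ∑ x, w x * ((2 * N) ^ t * petz t (ρ x) τ)
        = (2 * N) ^ t * ∑ x, w x * petz t (ρ x) τ := by
      rw [Finset.mul_sum]
      exact Finset.sum_congr rfl fun x _ => by ring
    rw [e] at this
    linarith
  calc _ = ∑ j, N⁻¹ * ∑ C : J → X, W C * (1 - (Λ C j * ρ (C j)).trace.re) := by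
        simp_rw [Finset.mul_sum]
        rw [Finset.sum_comm]
        exact Finset.sum_congr rfl fun _ _ => Finset.sum_congr rfl fun _ _ => by ring
    _ ≤ ∑ _j : J, N⁻¹ * (2 * s1 + 4 * (N * s2) + c) :=
        Finset.sum_le_sum fun j _ => mul_le_mul_of_nonneg_left (hmain j) (inv_nonneg.2 hN.le)
    _ = 2 * s1 + 4 * (N * s2) + c := by
        rw [Finset.sum_const, Finset.card_univ, nsmul_eq_mul, ← hNdef, ← mul_assoc,
          mul_inv_cancel₀ hN.ne', one_mul]
    _ ≤ _ := by linarith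

end RandomCoding

/-! ### Pinching -/

section Pinching

variable {A I K : Type*} [Fintype A] [DecidableEq A] [Fintype I] [DecidableEq I]
  [Fintype K] [DecidableEq K]

/-- Operator Cauchy-Schwarz: summing `(X k - X l)ᴴ * ρ * (X k - X l)` over all pairs gives twice the
gap. -/
lemma conj_sum_le {ρ : Matrix A A ℂ} (hρ : ρ.PosSemidef) (X : K → Matrix A A ℂ) :
    (∑ k, X k)ᴴ * ρ * (∑ k, X k) ≤ ((Fintype.card K : ℝ) : ℂ) • ∑ k, (X k)ᴴ * ρ * X k := by
  rw [le_iff]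
  have h : (∑ k, ∑ l, (X k - X l)ᴴ * ρ * (X k - X l)).PosSemidef :=
    posSemidef_sum _ fun k _ => posSemidef_sum _ fun l _ => hρ.conjTranspose_mul_mul_same _
  have e1 : ∀ k, ∑ l, (X k - X l)ᴴ * ρ * (X k - X l)
      = ((Fintype.card K : ℝ) : ℂ) • ((X k)ᴴ * ρ * X k) - (X k)ᴴ * ρ * (∑ l, X l)
        - (∑ l, X l)ᴴ * ρ * X k + ∑ l, (X l)ᴴ * ρ * X l := by
    intro k
    have : ∀ l, (X k - X l)ᴴ * ρ * (X k - X l)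
        = (X k)ᴴ * ρ * X k - (X k)ᴴ * ρ * X l - (X l)ᴴ * ρ * X k + (X l)ᴴ * ρ * X l := by
      intro l; rw [conjTranspose_sub]; noncomm_ring
    simp_rw [this, Finset.sum_add_distrib, Finset.sum_sub_distrib]
    rw [Finset.sum_const, Finset.card_univ, ← Nat.cast_smul_eq_nsmul ℂ, ← Matrix.mul_sum,
      ← Matrix.sum_mul, ← Matrix.sum_mul, ← conjTranspose_sum]
    push_cast
    rfl
  have e2 : ∑ k, ∑ l, (X k - X l)ᴴ * ρ * (X k - X l)
      = (2 : ℂ) • (((Fintype.card K : ℝ) : ℂ) • ∑ k, (X k)ᴴ * ρ * X k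
        - (∑ k, X k)ᴴ * ρ * (∑ k, X k)) := by
    simp_rw [e1, Finset.sum_add_distrib, Finset.sum_sub_distrib]
    rw [Finset.sum_const, Finset.card_univ, ← Nat.cast_smul_eq_nsmul ℂ, ← Matrix.mul_sum,
      ← Matrix.sum_mul, ← Matrix.sum_mul, ← conjTranspose_sum, ← Finset.smul_sum]
    push_cast
    module
  have e3 := smul_posSemidef h (show (0 : ℝ) ≤ 2⁻¹ by norm_num)
  rwa [e2, smul_smul, show (((2⁻¹ : ℝ) : ℂ) * 2) = 1 by norm_num, one_smul] at e3

lemma dg_one : dg (fun _ : I => 1) = 1 := by simp [dg]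

/-- Pinching: relative to a matrix whose eigenvalues take at most `card K` values, every positive
matrix is dominated by one that is diagonal in a common eigenbasis. -/
lemma exists_pinching {A K : Type*} [Fintype A] [DecidableEq A] [Fintype K] [DecidableEq K]
    {ρ τ U : Matrix A A ℂ} {t : A → ℝ} (hρ : ρ.PosSemidef) (hU : IsDiag τ U t)
    (f : A → K) (hf : ∀ i j, f i = f j → t i = t j) :
    ∃ (W : Matrix A (Σ k, {i // f i = k}) ℂ) (s p : (Σ k, {i // f i = k}) → ℝ),
      IsDiag τ W s ∧ W * Wᴴ = 1 ∧ (∀ j, 0 ≤ p j) ∧ (∀ j, ((Wᴴ * ρ * W) j j).re = p j) ∧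
      ρ ≤ ((Fintype.card K : ℝ) : ℂ) • (W * dg p * Wᴴ) := by
  set V : (k : K) → Matrix A {i // f i = k} ℂ := fun k => U.submatrix id Subtype.val with hV
  have hUU := hU.unitary
  have hVV : ∀ k, (V k)ᴴ * V k = 1 := by
    intro k
    ext i j
    have h1 := congrFun (congrFun hU.iso i.1) j.1
    rw [Matrix.mul_apply] at h1 ⊢
    simp only [conjTranspose_apply, hV, submatrix_apply, id] at h1 ⊢
    rw [h1]
    simp [Matrix.one_apply, Subtype.ext_iff]
  have hVV' : ∀ k l, k ≠ l → (V k)ᴴ * V l = 0 := by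
    intro k l hkl
    ext i j
    have h1 := congrFun (congrFun hU.iso i.1) j.1
    rw [Matrix.mul_apply] at h1 ⊢
    simp only [conjTranspose_apply, hV, submatrix_apply, id] at h1 ⊢
    rw [h1, Matrix.one_apply_ne]
    · rfl
    · intro h; exact hkl (by rw [← i.2, ← j.2, h])
  have hsum : ∀ a : A → ℝ, U * dg a * Uᴴ
      = ∑ k, V k * dg (fun i : {i // f i = k} => a i.1) * (V k)ᴴ := by
    intro a
    ext x y
    rw [Matrix.sum_apply, Matrix.mul_apply, ← (Equiv.sigmaFiberEquiv f).sum_comp,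
      Fintype.sum_sigma]
    refine Finset.sum_congr rfl fun k _ => ?_
    rw [Matrix.mul_apply]
    refine Finset.sum_congr rfl fun i _ => ?_
    simp [dg, Matrix.mul_diagonal, hV]
  have hone : ∑ k, V k * (V k)ᴴ = 1 := by
    have := hsum fun _ => 1
    simp only [dg_one, Matrix.mul_one, hUU] at this
    exact this.symm
  have hρk : ∀ k, ((V k)ᴴ * ρ * V k).PosSemidef := fun k => hρ.conjTranspose_mul_mul_same _
  -- Within a block `τ` is a multiple of the identity, so `ρ` may be diagonalized there without
  -- disturbing `τ`.
  choose R q hR using fun k => exists_isDiag (hρk k).1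
  set W : Matrix A (Σ k, {i // f i = k}) ℂ := Matrix.of fun a j => (V j.1 * R j.1) a j.2 with hW
  have hentry : ∀ (X : Matrix A A ℂ) (j l : Σ k, {i // f i = k}),
      (Wᴴ * X * W) j l = ((R j.1)ᴴ * ((V j.1)ᴴ * X * V l.1) * R l.1) j.2 l.2 := by
    intro X j l
    have : (R j.1)ᴴ * ((V j.1)ᴴ * X * V l.1) * R l.1 = (V j.1 * R j.1)ᴴ * X * (V l.1 * R l.1) := by
      rw [conjTranspose_mul]; simp only [Matrix.mul_assoc]
    rw [this, Matrix.mul_apply, Matrix.mul_apply]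
    refine Finset.sum_congr rfl fun x _ => ?_
    rw [Matrix.mul_apply, Matrix.mul_apply]
    rfl
  have hconj : ∀ a : (Σ k, {i // f i = k}) → ℝ, W * dg a * Wᴴ
      = ∑ k, V k * (R k * dg (fun i => a ⟨k, i⟩) * (R k)ᴴ) * (V k)ᴴ := by
    intro a
    have : ∀ k, V k * (R k * dg (fun i => a ⟨k, i⟩) * (R k)ᴴ) * (V k)ᴴ
        = (V k * R k) * dg (fun i => a ⟨k, i⟩) * (V k * R k)ᴴ := by
      intro k; rw [conjTranspose_mul]; simp only [Matrix.mul_assoc]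
    simp_rw [this]
    ext x y
    rw [Matrix.sum_apply, Matrix.mul_apply, Fintype.sum_sigma]
    refine Finset.sum_congr rfl fun k _ => ?_
    rw [Matrix.mul_apply]
    refine Finset.sum_congr rfl fun i _ => ?_
    simp [dg, Matrix.mul_diagonal, hW]
  have hiso : Wᴴ * W = 1 := by
    ext j l
    have h1 := hentry 1 j l
    rw [Matrix.mul_one] at h1
    rw [h1]
    rcases j with ⟨k, i⟩
    rcases l with ⟨k', i'⟩
    by_cases h : k = k'
    · subst h
      rw [Matrix.mul_one, hVV, Matrix.mul_one, (hR k).iso]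
      simp [Matrix.one_apply]
    · rw [Matrix.mul_one, hVV' k k' h, Matrix.mul_zero, Matrix.zero_mul, Matrix.one_apply_ne]
      · rfl
      · intro h'; exact h (congrArg Sigma.fst h')
  have hRR : ∀ k, R k * (R k)ᴴ = 1 := fun k => (hR k).unitary
  have hWW : W * Wᴴ = 1 := by
    have := hconj fun _ => 1
    simp only [dg_one, Matrix.mul_one, hRR, hone] at this
    exact this
  refine ⟨W, fun j => t j.2.1, fun j => q j.1 j.2, ⟨hiso, ?_⟩, hWW,
    fun j => (hR j.1).nonneg (hρk j.1) j.2, ?_, ?_⟩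
  · rw [hconj, hU.eq, hsum]
    refine Finset.sum_congr rfl fun k _ => ?_
    congr 2
    rcases isEmpty_or_nonempty {i // f i = k} with he | ⟨⟨i₀⟩⟩
    · exact Subsingleton.elim _ _
    · have hc : (fun i : {i // f i = k} => t i.1) = fun _ => t i₀.1 := by
        ext i; exact hf _ _ (i.2.trans i₀.2.symm)
      have hd : dg (fun _ : {i // f i = k} => t i₀.1) = (t i₀.1 : ℂ) • 1 := by
        rw [dg, Matrix.smul_one_eq_diagonal]
      rw [hc, hd, Matrix.mul_smul, Matrix.mul_one, Matrix.smul_mul, hRR]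
  · rintro ⟨k, i⟩
    rw [hentry, (hR k).apply_diag, Complex.ofReal_re]
  · rw [hconj]
    have h1 := conj_sum_le hρ fun k => V k * (V k)ᴴ
    rw [hone, conjTranspose_one, Matrix.one_mul, Matrix.mul_one] at h1
    refine h1.trans (le_of_eq ?_)
    congr 1
    refine Finset.sum_congr rfl fun k _ => ?_
    rw [← (hR k).eq, conjTranspose_mul, conjTranspose_conjTranspose]
    simp only [Matrix.mul_assoc]

end Pinching

/-! ### One-shot soft covering -/

section Covering

variable {A K J X : Type*} [Fintype A] [DecidableEq A] [Fintype K] [DecidableEq K]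
  [Fintype J] [DecidableEq J] [Fintype X] [DecidableEq X]

/-- From `(1 + z) ^ σ ≤ 1 + z ^ σ` and `log u ≤ u - 1`. It converts a logarithmic covering cost into
a power, hence into a quasi-entropy. -/
lemma log_one_add_le_rpow {z σ : ℝ} (hz : 0 ≤ z) (h0 : 0 < σ) (h1 : σ ≤ 1) :
    Real.log (1 + z) ≤ z ^ σ / σ := by
  have hzs : 0 ≤ z ^ σ := Real.rpow_nonneg hz σ
  have h2 : (1 + z) ^ σ ≤ 1 + z ^ σ := by
    have := Real.rpow_add_le_add_rpow zero_le_one hz h0.le h1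
    rwa [Real.one_rpow] at this
  have h3 : σ * Real.log (1 + z) ≤ z ^ σ := by
    rw [← Real.log_rpow (by linarith)]
    have := Real.log_le_sub_one_of_pos (Real.rpow_pos_of_pos (show 0 < 1 + z by linarith) σ)
    linarith
  rw [le_div_iff₀ h0]
  linarith

lemma mul_log_add_sub_log_le {p s c σ : ℝ} (hp : 0 ≤ p) (hs : 0 < s) (hc : 0 ≤ c) (h0 : 0 < σ)
    (h1 : σ ≤ 1) :
    p * (Real.log (c * p + s) - Real.log s) ≤ c ^ σ / σ * (p ^ (1 + σ) * s ^ (-σ)) := by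
  have hz : 0 ≤ c * p / s := by positivity
  have e : Real.log (c * p + s) - Real.log s = Real.log (1 + c * p / s) := by
    rw [← Real.log_div (by positivity) hs.ne']
    congr 1
    field_simp
    ring
  rw [e]
  refine (mul_le_mul_of_nonneg_left (log_one_add_le_rpow hz h0 h1) hp).trans (le_of_eq ?_)
  rw [Real.div_rpow (by positivity) hs.le, Real.mul_rpow hc hp, Real.rpow_neg hs.le,
    Real.rpow_add' hp (by linarith), Real.rpow_one]
  ring

/-- One-shot covering bound for a single codeword. -/
lemma crossLog_add_le_petz {ρ τ U : Matrix A A ℂ} {t : A → ℝ} (hρ : ρ.PosSemidef) (hτ : τ.PosDef)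
    (hU : IsDiag τ U t) (f : A → K) (hf : ∀ i j, f i = f j → t i = t j) {c σ : ℝ} (hc : 0 ≤ c)
    (h0 : 0 < σ) (h1 : σ ≤ 1) :
    crossLog ρ ((c : ℂ) • ρ + τ) - crossLog ρ τ
      ≤ (c * Fintype.card K) ^ σ / σ * petz (-σ) ρ τ := by
  obtain ⟨W, s, p, hW, hWW, hp, hpe, hle⟩ := exists_pinching hρ hU f hf
  obtain ⟨V, r, hV⟩ := exists_isDiag hρ.1
  set v : ℝ := (Fintype.card K : ℝ) with hv
  have hv0 : 0 ≤ v := Nat.cast_nonneg _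
  have hs : ∀ j, 0 < s j := by
    intro j
    obtain ⟨m, hm0, hm1⟩ := exists_smul_one_le hτ
    have h2 := posSemidef_diag_re_nonneg (le_iff.1 hm1) W j
    rw [Matrix.mul_sub, Matrix.sub_mul, Matrix.sub_apply, hW.apply_diag, Matrix.mul_smul,
      Matrix.smul_mul, Matrix.mul_one, hW.iso] at h2
    simp at h2
    linarith
  have hZd : IsDiag (((c * v : ℝ) : ℂ) • (W * dg p * Wᴴ) + τ) W fun j => c * v * p j + s j := by
    refine ⟨hW.iso, ?_⟩
    conv_lhs => rw [hW.eq]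
    rw [← Matrix.smul_mul, ← Matrix.mul_smul, ← Matrix.add_mul, ← Matrix.mul_add]
    congr 2
    ext i j; by_cases hij : i = j <;> simp [dg, hij]
  have hle2 : (c : ℂ) • ρ + τ ≤ ((c * v : ℝ) : ℂ) • (W * dg p * Wᴴ) + τ := by
    rw [le_iff]
    have e : ((c * v : ℝ) : ℂ) • (W * dg p * Wᴴ) + τ - ((c : ℂ) • ρ + τ)
        = (c : ℂ) • ((v : ℂ) • (W * dg p * Wᴴ) - ρ) := by push_cast; module
    rw [e]
    exact smul_posSemidef (le_iff.1 hle) hc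
  have hpd : ((c : ℂ) • ρ + τ).PosDef := by
    rw [add_comm]; exact posDef_add hτ (smul_posSemidef hρ hc)
  have m1 := crossLog_mono hρ hpd hle2
  have e2 : crossLog ρ (((c * v : ℝ) : ℂ) • (W * dg p * Wᴴ) + τ) - crossLog ρ τ
      = ∑ j, p j * (Real.log (c * v * p j + s j) - Real.log (s j)) := by
    rw [hZd.crossLog_eq, hW.crossLog_eq, ← Finset.sum_sub_distrib]
    exact Finset.sum_congr rfl fun j _ => by rw [hpe]; ring
  have e3 : petz (-σ) ρ τ = ∑ j, s j ^ (-σ) * ∑ i, r i ^ (1 + σ) * ov V W i j := by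
    have hd : IsDiag (mpow τ (-σ)) W fun j => s j ^ (-σ) := hW.cfc_of_unitary hWW _
    rw [petz, (hV.mpow _).trace_mul hd, Finset.sum_comm, sub_neg_eq_add]
    refine Finset.sum_congr rfl fun j _ => ?_
    rw [Finset.mul_sum]
    exact Finset.sum_congr rfl fun i _ => by ring
  -- Jensen: the pinched eigenvalue is an average of the `r i`, with overlaps as probability
  -- weights.
  have hj : ∀ j, p j ^ (1 + σ) ≤ ∑ i, r i ^ (1 + σ) * ov V W i j := by
    intro j
    have := Real.rpow_arith_mean_le_arith_mean_rpow Finset.univ (fun i => ov V W i j) r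
      (fun i _ => ov_nonneg _ _ _ _) (sum_ov_left hV.unitary hW.iso j)
      (fun i _ => hV.nonneg hρ i) (p := 1 + σ) (by linarith)
    rw [← hpe, ← hV.sum_overlap]
    simp_rw [mul_comm _ (ov _ _ _ _)]
    exact this
  have hcs : 0 ≤ (c * v) ^ σ / σ := by positivity
  calc _ ≤ ∑ j, p j * (Real.log (c * v * p j + s j) - Real.log (s j)) := by rw [← e2]; linarith
    _ ≤ ∑ j, (c * v) ^ σ / σ * (s j ^ (-σ) * ∑ i, r i ^ (1 + σ) * ov V W i j) := by
        refine Finset.sum_le_sum fun j _ => ?_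
        refine (mul_log_add_sub_log_le (hp j) (hs j) (by positivity) h0 h1).trans ?_
        rw [mul_comm (p j ^ (1 + σ))]
        exact mul_le_mul_of_nonneg_left
          (mul_le_mul_of_nonneg_left (hj j) (Real.rpow_nonneg (hs j).le _)) hcs
    _ = _ := by rw [e3, Finset.mul_sum]

/-- Soft covering: the expected divergence between the output of a random subcode and the output
of the random code distribution. -/
lemma sum_codebook_relEnt_le {w : X → ℝ} (hw : ∀ x, 0 ≤ w x) (hw1 : ∑ x, w x = 1)
    {ρ : X → Matrix A A ℂ} (hρ : ∀ x, IsDensity (ρ x)) {τ U : Matrix A A ℂ} {t : A → ℝ}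
    (hτ : ∑ x, (w x : ℂ) • ρ x = τ) (hpd : τ.PosDef) (hU : IsDiag τ U t) (f : A → K)
    (hf : ∀ i j, f i = f j → t i = t j) {S : Finset J} (hS : S.Nonempty) {σ : ℝ} (h0 : 0 < σ)
    (h1 : σ ≤ 1) :
    ∑ C : J → X, (∏ j, w (C j)) * relEnt (∑ j ∈ S, (((S.card : ℝ)⁻¹ : ℝ) : ℂ) • ρ (C j)) τ
      ≤ ((S.card : ℝ)⁻¹ * Fintype.card K) ^ σ / σ * ∑ x, w x * petz (-σ) (ρ x) τ := by
  set L : ℝ := (S.card : ℝ) with hL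
  have hL0 : 0 < L := Nat.cast_pos.2 hS.card_pos
  have hLi : 0 ≤ L⁻¹ := inv_nonneg.2 hL0.le
  set W : (J → X) → ℝ := fun C => ∏ j, w (C j) with hWd
  have hWn : ∀ C, 0 ≤ W C := fun C => Finset.prod_nonneg fun j _ => hw _
  have hW1 : ∑ C, W C = 1 := sum_codebook_weight hw1
  set m : (J → X) → Matrix A A ℂ := fun C => ∑ j ∈ S, ((L⁻¹ : ℝ) : ℂ) • ρ (C j) with hm
  obtain ⟨μ, hμ0, hμ⟩ := exists_smul_one_le hpd
  -- The shift regularizes the subcode state. Because `μ • 1 ≤ τ`, it fits into the share `L⁻¹ • τ`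
  -- left free when one codeword is held fixed.
  set η : ℝ := L⁻¹ * μ with hη
  have hη0 : 0 < η := mul_pos (inv_pos.2 hL0) hμ0
  have hmp : ∀ C, (m C).PosSemidef := fun C =>
    sum_smul_posSemidef S (fun _ _ => hLi) fun j _ => (hρ (C j)).1
  set F : X → (J → X) → ℝ := fun x C => crossLog (ρ x) (m C + (η : ℂ) • 1) - crossLog (ρ x) τ with hF
  have step1 : ∀ C, relEnt (m C) τ ≤ ∑ j ∈ S, L⁻¹ * F (C j) C := by
    intro C
    obtain ⟨V, r, hV⟩ := exists_isDiag (hmp C).1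
    have h2 : crossLog (m C) (m C) ≤ crossLog (m C) (m C + (η : ℂ) • 1) := by
      rw [hV.crossLog_self, (hV.add_one η).crossLog_eq]
      refine Finset.sum_le_sum fun i _ => ?_
      rw [hV.apply_diag, Complex.ofReal_re, mul_comm]
      rcases (hV.nonneg (hmp C) i).eq_or_lt with h | h
      · rw [← h]; simp
      · exact mul_le_mul_of_nonneg_right (Real.log_le_log h (by linarith)) h.le
    have h3 : ∀ Z, crossLog (m C) Z = ∑ j ∈ S, L⁻¹ * crossLog (ρ (C j)) Z := by
      intro Z
      rw [hm, crossLog_sum]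
      exact Finset.sum_congr rfl fun j _ => crossLog_smul _ _ _
    rw [relEnt]
    calc _ ≤ crossLog (m C) (m C + (η : ℂ) • 1) - crossLog (m C) τ := by linarith
      _ = _ := by
        rw [h3, h3, ← Finset.sum_sub_distrib]
        exact Finset.sum_congr rfl fun j _ => by rw [hF]; ring
  have step2 : ∀ j ∈ S, ∀ x, ∑ C, W C * F x (Function.update C j x)
      ≤ (L⁻¹ * Fintype.card K) ^ σ / σ * petz (-σ) (ρ x) τ := by
    intro j hj x
    have hpdC : ∀ C, (m (Function.update C j x) + (η : ℂ) • 1).PosDef := fun C =>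
      posDef_add_smul_one (hmp _) hη0
    have hmu : ∀ C, m (Function.update C j x)
        = ((L⁻¹ : ℝ) : ℂ) • ρ x + ∑ k ∈ S.erase j, ((L⁻¹ : ℝ) : ℂ) • ρ (C k) := by
      intro C
      rw [hm]
      simp only
      rw [← Finset.add_sum_erase _ _ hj, Function.update_self]
      congr 1
      exact Finset.sum_congr rfl fun k hk => by
        rw [Function.update_of_ne (Finset.ne_of_mem_erase hk)]
    have hmean : ∀ k : J, ∑ C : J → X, (W C : ℂ) • ρ (C k) = τ := by
      intro k
      rw [← hτ]
      ext a b
      rw [Matrix.sum_apply, Matrix.sum_apply]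
      simp only [Matrix.smul_apply, smul_eq_mul]
      refine Complex.ext ?_ ?_
      · simp only [Complex.re_sum, Complex.re_ofReal_mul]
        exact sum_codebook_single hw1 k fun x => (ρ x a b).re
      · simp only [Complex.im_sum, Complex.im_ofReal_mul]
        exact sum_codebook_single hw1 k fun x => (ρ x a b).im
    have havg : ∑ C, (W C : ℂ) • (m (Function.update C j x) + (η : ℂ) • 1)
        = ((L⁻¹ : ℝ) : ℂ) • ρ x + (((L - 1) * L⁻¹ : ℝ) : ℂ) • τ + (η : ℂ) • 1 := by
      simp_rw [smul_add, Finset.sum_add_distrib, ← Finset.sum_smul, hmu, smul_add,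
        Finset.sum_add_distrib, ← Finset.sum_smul, Finset.smul_sum]
      have hW1' : ∑ C, (W C : ℂ) = 1 := by exact_mod_cast hW1
      rw [hW1', one_smul, Finset.sum_comm]
      have : ∀ k ∈ S.erase j, ∑ C, (W C : ℂ) • ((L⁻¹ : ℝ) : ℂ) • ρ (C k) = ((L⁻¹ : ℝ) : ℂ) • τ := by
        intro k _
        rw [← hmean k, Finset.smul_sum]
        exact Finset.sum_congr rfl fun C _ => smul_comm _ _ _
      rw [Finset.sum_congr rfl this, Finset.sum_const, Finset.card_erase_of_mem hj,
        ← Nat.cast_smul_eq_nsmul ℂ, Nat.cast_sub hS.card_pos, smul_smul, ← smul_assoc]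
      have hLc : (S.card : ℂ) = ((L : ℝ) : ℂ) := by rw [hL, Complex.ofReal_natCast]
      rw [hLc]
      push_cast
      module
    -- With the `j`-th word fixed to `x`, concavity of the logarithm moves the expectation over the
    -- other words inside, where they average to `τ`.
    have hconc := sum_crossLog_le Finset.univ (hρ x).1 W (fun C _ => hWn C) hW1
      (fun C => m (Function.update C j x) + (η : ℂ) • 1) (fun C _ => hpdC C)
    rw [havg] at hconc
    have hpd2 : (((L⁻¹ : ℝ) : ℂ) • ρ x + (((L - 1) * L⁻¹ : ℝ) : ℂ) • τ + (η : ℂ) • 1).PosDef := by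
      refine posDef_add_smul_one ((smul_posSemidef (hρ x).1 hLi).add
        (smul_posSemidef hpd.posSemidef (mul_nonneg ?_ hLi))) hη0
      have : (1 : ℝ) ≤ L := by rw [hL]; exact_mod_cast hS.card_pos
      linarith
    have hle : ((L⁻¹ : ℝ) : ℂ) • ρ x + (((L - 1) * L⁻¹ : ℝ) : ℂ) • τ + (η : ℂ) • 1
        ≤ ((L⁻¹ : ℝ) : ℂ) • ρ x + τ := by
      rw [le_iff]
      have e : ((L⁻¹ : ℝ) : ℂ) • ρ x + τ
          - (((L⁻¹ : ℝ) : ℂ) • ρ x + (((L - 1) * L⁻¹ : ℝ) : ℂ) • τ + (η : ℂ) • 1)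
          = ((L⁻¹ : ℝ) : ℂ) • (τ - (μ : ℂ) • 1) := by
        have : (L - 1) * L⁻¹ = 1 - L⁻¹ := by field_simp
        rw [this, hη]; push_cast; module
      rw [e]
      exact smul_posSemidef (le_iff.1 hμ) hLi
    have hmono := crossLog_mono (hρ x).1 hpd2 hle
    have hcov := crossLog_add_le_petz (hρ x).1 hpd hU f hf hLi h0 h1
    have e4 : ∑ C, W C * F x (Function.update C j x)
        = ∑ C, W C * crossLog (ρ x) (m (Function.update C j x) + (η : ℂ) • 1)
          - crossLog (ρ x) τ := by
      rw [hF]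
      simp only [mul_sub, Finset.sum_sub_distrib]
      rw [← Finset.sum_mul, hW1, one_mul]
    rw [e4]
    linarith
  calc _ ≤ ∑ C : J → X, W C * ∑ j ∈ S, L⁻¹ * F (C j) C :=
        Finset.sum_le_sum fun C _ => mul_le_mul_of_nonneg_left (step1 C) (hWn C)
    _ = ∑ j ∈ S, L⁻¹ * ∑ C : J → X, W C * F (C j) C := by
        simp_rw [Finset.mul_sum]
        rw [Finset.sum_comm]
        exact Finset.sum_congr rfl fun _ _ => Finset.sum_congr rfl fun _ _ => by ring
    _ = ∑ j ∈ S, L⁻¹ * ∑ x, w x * ∑ C, W C * F x (Function.update C j x) := by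
        refine Finset.sum_congr rfl fun j _ => ?_
        rw [sum_codebook_resample hw1 j F]
        congr 1
        simp_rw [Finset.mul_sum]
        rw [Finset.sum_comm]
        exact Finset.sum_congr rfl fun _ _ => Finset.sum_congr rfl fun _ _ => by ring
    _ ≤ ∑ _j ∈ S, L⁻¹ * ∑ x, w x * ((L⁻¹ * Fintype.card K) ^ σ / σ * petz (-σ) (ρ x) τ) := by
        refine Finset.sum_le_sum fun j hj => mul_le_mul_of_nonneg_left ?_ hLi
        exact Finset.sum_le_sum fun x _ => mul_le_mul_of_nonneg_left (step2 j hj x) (hw x)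
    _ = _ := by
        rw [Finset.sum_const, nsmul_eq_mul, ← hL, ← mul_assoc, mul_inv_cancel₀ hL0.ne', one_mul,
          Finset.mul_sum]
        exact Finset.sum_congr rfl fun x _ => by ring

end Covering

/-! ### Bernoulli inputs and types -/

section Iid

variable {A : Type*} [Fintype A] [DecidableEq A] {n : ℕ} {o : Fin 2 → Matrix A A ℂ}

/-- Bernoulli weights on the input alphabet. -/
def bern (α : ℝ) : Fin 2 → ℝ := ![1 - α, α]

/-- The product law of Bernoulli inputs. -/
def iidWeight (α : ℝ) (x : Fin n → Fin 2) : ℝ := ∏ i, bern α (x i)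

lemma bern_nonneg {α : ℝ} (h0 : 0 ≤ α) (h1 : α ≤ 1) (a : Fin 2) : 0 ≤ bern α a := by
  fin_cases a
  · exact sub_nonneg.2 h1
  · exact h0

lemma iidWeight_nonneg {α : ℝ} (h0 : 0 ≤ α) (h1 : α ≤ 1) (x : Fin n → Fin 2) :
    0 ≤ iidWeight α x := Finset.prod_nonneg fun _ _ => bern_nonneg h0 h1 _

lemma sum_iidWeight (α : ℝ) : ∑ x : Fin n → Fin 2, iidWeight α x = 1 := by
  have := sum_prod_eq (n := n) (fun _ => bern α)
  refine this.trans ?_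
  simp [bern, Fin.sum_univ_two]

lemma mix_eq_sum (o : Fin 2 → Matrix A A ℂ) (α : ℝ) : ∑ a, (bern α a : ℂ) • o a = mix o α := by
  rw [Fin.sum_univ_two]; rfl

lemma sum_iidWeight_wordState (o : Fin 2 → Matrix A A ℂ) (α : ℝ) :
    ∑ x : Fin n → Fin 2, (iidWeight α x : ℂ) • wordState o x = tensorPow (mix o α) n := by
  rw [tensorPow_eq, ← mix_eq_sum]
  exact sum_weight_tensorFam (bern α) o

/-- Both the weight and the quasi-entropy are multiplicative over letters, so the expectation is a
single-letter quantity to the power `n`. -/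
lemma sum_iidWeight_petz (ho : ∀ a, IsDensity (o a)) {τ : Matrix A A ℂ} (hτ : τ.PosSemidef)
    (α t : ℝ) :
    ∑ x : Fin n → Fin 2, iidWeight α x * petz t (wordState o x) (tensorPow τ n)
      = ((1 - α) * petz t (o 0) τ + α * petz t (o 1) τ) ^ n := by
  have h := sum_prod_eq (n := n) (fun _ a => bern α a * petz t (o a) τ)
  rw [Finset.prod_const, Finset.card_univ, Fintype.card_fin, Fin.sum_univ_two] at h
  rw [show (1 - α) * petz t (o 0) τ + α * petz t (o 1) τ
    = bern α 0 * petz t (o 0) τ + bern α 1 * petz t (o 1) τ from rfl, ← h]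
  refine Finset.sum_congr rfl fun x _ => ?_
  rw [iidWeight, wordState, tensorPow_eq, petz_tensorFam (fun i => (ho _).1) (fun _ => hτ),
    Finset.prod_mul_distrib]

/-- The type of a sequence. -/
def typeOf (j : Fin n → A) (a : A) : Fin (n + 1) :=
  ⟨(Finset.univ.filter fun i => j i = a).card,
    Nat.lt_succ_of_le ((Finset.card_le_univ _).trans_eq (Fintype.card_fin n))⟩

/-- An eigenvalue of a tensor power depends only on the type of its index, so types serve as
pinching labels; their number bound is polynomial in `n`. -/
lemma prod_eq_of_typeOf_eq (t : A → ℝ) {j k : Fin n → A} (h : typeOf j = typeOf k) :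
    ∏ i, t (j i) = ∏ i, t (k i) := by
  have key : ∀ j : Fin n → A, ∏ i, t (j i) = ∏ a, t a ^ (typeOf j a : ℕ) := by
    intro j
    rw [← Finset.prod_fiberwise Finset.univ j]
    refine Finset.prod_congr rfl fun a _ => ?_
    rw [Finset.prod_congr rfl (g := fun _ => t a) fun i hi => by
      rw [(Finset.mem_filter.1 hi).2], Finset.prod_const]
    rfl
  rw [key, key, h]

lemma card_types : (Fintype.card (A → Fin (n + 1)) : ℝ) = ((n : ℝ) + 1) ^ Fintype.card A := by
  simp

end Iid

/-! ### Error exponent at the receiver -/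

section Bob

variable {A J : Type*} [Fintype A] [DecidableEq A] [Fintype J] [DecidableEq J] [Nonempty J]
  {n : ℕ} {o : Fin 2 → Matrix A A ℂ}

lemma exists_le_smul_of_supp {o : Fin 2 → Matrix A A ℂ} (ho : ∀ a, IsDensity (o a))
    (hs : supp (o 1) ≤ supp (o 0)) : ∃ c : ℝ, 0 ≤ c ∧ o 1 ≤ (c : ℂ) • o 0 := by
  obtain ⟨s, V, o', hV, he, ho', hpd⟩ := exists_compression ho hs
  obtain ⟨m, hm0, hm⟩ := exists_smul_one_le hpd
  refine ⟨m⁻¹, (inv_pos.2 hm0).le, ?_⟩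
  have h1 : o' 1 ≤ ((m⁻¹ : ℝ) : ℂ) • o' 0 :=
    (le_one_of_isDensity (ho' 1)).trans (le_inv_smul_of_smul_le hm0 hm)
  rw [le_iff, he 0, he 1, ← Matrix.smul_mul, ← Matrix.mul_smul, ← Matrix.sub_mul, ← Matrix.mul_sub]
  have := (le_iff.1 h1).mul_mul_conjTranspose_same V
  exact this

-- A two-sided first-order expansion at `0`: positive arguments serve decoding, negative ones serve
-- covering.
open Filter Topology in
lemma eventually_petz (ho : ∀ a, IsDensity (o a)) (hs : supp (o 1) ≤ supp (o 0)) {η : ℝ}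
    (hη : 0 < η) : ∀ᶠ t in 𝓝 (0 : ℝ),
      |petz t (o 1) (o 0) - 1 + t * relEnt (o 1) (o 0)| ≤ η * |t| := by
  obtain ⟨W, s, hW⟩ := exists_isDiag (ho 0).1.1
  have h := (hasDerivAt_petz (ho 1).1 (ho 0).1 hW (absCont_of_supp hW hs)).isLittleO.def hη
  filter_upwards [h] with t ht
  simp only [petz_zero (ho 1).1 (ho 0).1, (ho 1).re_trace, sub_zero, Real.norm_eq_abs,
    smul_eq_mul] at ht
  rwa [mul_neg, sub_neg_eq_add] at ht

open Filter Topology in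
/-- Random coding over the legitimate channel with sparse inputs. -/
lemma exists_bob_exponent {B : Type*} [Fintype B] [DecidableEq B] {o : Fin 2 → Matrix B B ℂ}
    (ho : ∀ a, IsDensity (o a)) (hs : supp (o 1) ≤ supp (o 0)) {η : ℝ} (hη : 0 < η) :
    ∃ t K : ℝ, 0 < t ∧ t ≤ 1 ∧ 0 ≤ K ∧ ∀ α : ℝ, 0 ≤ α → α ≤ 1 → ∀ n : ℕ,
      ∑ x : Fin n → Fin 2, iidWeight α x * petz t (wordState o x) (tensorPow (mix o α) n)
        ≤ Real.exp (-(n * α * (t * (relEnt (o 1) (o 0) - η))) + n * α ^ 2 * K) := by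
  obtain ⟨c, hc0, hc⟩ := exists_le_smul_of_supp ho hs
  have hev : ∀ᶠ t in 𝓝[>] (0 : ℝ),
      |petz t (o 1) (o 0) - 1 + t * relEnt (o 1) (o 0)| ≤ η * |t| :=
    (eventually_petz ho hs hη).filter_mono nhdsWithin_le_nhds
  obtain ⟨t, ht, ht0, ht1⟩ := (hev.and (Ioo_mem_nhdsGT (show (0 : ℝ) < 1 by norm_num))).exists
  refine ⟨t, c, ht0, ht1.le, hc0, fun α h0 h1 n => ?_⟩
  rw [sum_iidWeight_petz ho (mix_isDensity ho h0 h1).1]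
  have q0 : petz t (o 0) (mix o α) ≤ 1 := petz_le_one (ho 0) (mix_isDensity ho h0 h1) ht0.le ht1.le
  -- The mixture is replaced by the innocent state at relative cost `α * c`; weighted by the
  -- probability `α` of the letter `1` this is of order `α ^ 2`.
  have hmix : mix o α ≤ ((1 + α * c : ℝ) : ℂ) • o 0 := by
    rw [le_iff]
    have e : ((1 + α * c : ℝ) : ℂ) • o 0 - mix o α
        = (α : ℂ) • o 0 + (α : ℂ) • ((c : ℂ) • o 0 - o 1) := by
      rw [mix]; push_cast; module
    rw [e]
    exact (smul_posSemidef (ho 0).1 h0).add (smul_posSemidef (le_iff.1 hc) h0)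
  have hα : 1 ≤ 1 + α * c := le_add_of_nonneg_right (mul_nonneg h0 hc0)
  have q1 : petz t (o 1) (mix o α) ≤ (1 + α * c) * petz t (o 1) (o 0) := by
    refine (petz_mono_right (ho 1).1 (mix_isDensity ho h0 h1).1 hmix ht0.le ht1.le).trans ?_
    rw [petz_smul_right (ho 0).1 (by linarith)]
    refine mul_le_mul_of_nonneg_right ?_ (petz_nonneg (ho 1).1 (ho 0).1 t)
    calc _ ≤ (1 + α * c) ^ (1 : ℝ) := Real.rpow_le_rpow_of_exponent_le hα ht1.le
      _ = _ := Real.rpow_one _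
  have q2 : petz t (o 1) (o 0) ≤ 1 := petz_le_one (ho 1) (ho 0) ht0.le ht1.le
  have q3 : petz t (o 1) (o 0) ≤ 1 - t * (relEnt (o 1) (o 0) - η) := by
    rw [abs_of_pos ht0] at ht
    have := (abs_le.1 ht).2
    linarith
  set D := relEnt (o 1) (o 0)
  have hbase : (1 - α) * petz t (o 0) (mix o α) + α * petz t (o 1) (mix o α)
      ≤ -(α * (t * (D - η))) + α ^ 2 * c + 1 := by
    have a1 := mul_le_mul_of_nonneg_left q0 (sub_nonneg.2 h1)
    have a2 := mul_le_mul_of_nonneg_left q1 h0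
    have a3 := mul_le_mul_of_nonneg_left q3 h0
    have a4 := mul_le_mul_of_nonneg_left q2 (show 0 ≤ α ^ 2 * c by positivity)
    nlinarith
  have hnn : 0 ≤ (1 - α) * petz t (o 0) (mix o α) + α * petz t (o 1) (mix o α) :=
    add_nonneg (mul_nonneg (sub_nonneg.2 h1) (petz_nonneg (ho 0).1 (mix_isDensity ho h0 h1).1 t))
      (mul_nonneg h0 (petz_nonneg (ho 1).1 (mix_isDensity ho h0 h1).1 t))
  calc _ ≤ Real.exp (-(α * (t * (D - η))) + α ^ 2 * c) ^ n :=
        pow_le_pow_left₀ hnn (hbase.trans (Real.add_one_le_exp _)) n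
    _ = _ := by rw [← Real.exp_nat_mul]; congr 1; ring

end Bob

/-! ### Resolvability exponent at the adversary -/

section Willie

variable {A : Type*} [Fintype A] [DecidableEq A] {o : Fin 2 → Matrix A A ℂ}

/-- Bernoulli's inequality for `(r / t) ^ s`, with the remainder written as a square. -/
lemma rpow_mul_rpow_neg_le {r t m s : ℝ} (hr : 0 ≤ r) (hm : 0 < m) (ht : m ≤ t) (h0 : 0 < s)
    (h1 : s ≤ 1) : r ^ (1 + s) * t ^ (-s) ≤ r + s * (r - t) + s / m * (r - t) ^ 2 := by
  have ht0 : 0 < t := hm.trans_le ht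
  have e : r ^ (1 + s) * t ^ (-s) = r * (r / t) ^ s := by
    rw [Real.rpow_add' hr (by linarith), Real.rpow_one, Real.rpow_neg ht0.le,
      Real.div_rpow hr ht0.le]
    ring
  have hb : (r / t) ^ s ≤ 1 + s * (r / t - 1) := by
    have := rpow_one_add_le_one_add_mul_self (s := r / t - 1) (p := s)
      (by have : 0 ≤ r / t := by positivity
          linarith) h0.le h1
    rwa [add_sub_cancel] at this
  rw [e]
  calc r * (r / t) ^ s ≤ r * (1 + s * (r / t - 1)) := mul_le_mul_of_nonneg_left hb hr
    _ = r + s * (r - t) + s * ((r - t) ^ 2 / t) := by field_simp; ring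
    _ ≤ r + s * (r - t) + s * ((r - t) ^ 2 / m) := by gcongr
    _ = _ := by ring

/-- The linear terms cancel because both traces are `1`. So the frequent letter `0`, whose state
differs from the mixture by order `α`, contributes only order `α ^ 2`. -/
lemma petz_neg_le {ρ τ : Matrix A A ℂ} (hρ : IsDensity ρ) (hτ : IsDensity τ) {m : ℝ} (hm : 0 < m)
    (hspec : spectrum ℝ τ ⊆ Set.Ici m) {s : ℝ} (h0 : 0 < s) (h1 : s ≤ 1) :
    petz (-s) ρ τ ≤ 1 + s / m * ((ρ - τ) * (ρ - τ)).trace.re := by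
  obtain ⟨V, r, hV⟩ := exists_isDiag hρ.1.1
  obtain ⟨W, t, hW⟩ := exists_isDiag hτ.1.1
  have e1 : ∑ i, r i = 1 := by rw [← hV.trace_re, hρ.re_trace]
  have e2 : ∑ j, t j = 1 := by rw [← hW.trace_re, hτ.re_trace]
  have a1 : ∑ i, ∑ j, r i * ov V W i j = 1 := by
    simp_rw [← Finset.mul_sum, sum_ov_right hV.iso hW.unitary, mul_one, e1]
  have a2 : ∑ i, ∑ j, t j * ov V W i j = 1 := by
    rw [Finset.sum_comm]
    simp_rw [← Finset.mul_sum, sum_ov_left hV.unitary hW.iso, mul_one, e2]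
  have sq : ∀ {σ S : Matrix A A ℂ} {q : A → ℝ}, IsDiag σ S q → (σ * σ).trace.re = ∑ i, q i * q i := by
    intro σ S q h
    have : IsDiag (σ * σ) S fun i => q i * q i := by
      refine ⟨h.iso, ?_⟩
      conv_lhs => rw [h.eq]
      exact conj_dg_mul h.iso _ _
    exact this.trace_re
  have a3 : ∑ i, ∑ j, (r i - t j) ^ 2 * ov V W i j = ((ρ - τ) * (ρ - τ)).trace.re := by
    have b1 : ∑ i, ∑ j, r i * r i * ov V W i j = (ρ * ρ).trace.re := by
      simp_rw [← Finset.mul_sum, sum_ov_right hV.iso hW.unitary, mul_one, sq hV]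
    have b2 : ∑ i, ∑ j, t j * t j * ov V W i j = (τ * τ).trace.re := by
      rw [Finset.sum_comm]
      simp_rw [← Finset.mul_sum, sum_ov_left hV.unitary hW.iso, mul_one, sq hW]
    have b3 := hV.trace_mul hW
    rw [Matrix.sub_mul, Matrix.mul_sub, Matrix.mul_sub]
    simp only [trace_sub, Complex.sub_re]
    rw [trace_mul_comm τ ρ, b3, ← b1, ← b2]
    simp only [← Finset.sum_sub_distrib]
    exact Finset.sum_congr rfl fun i _ => Finset.sum_congr rfl fun j _ => by ring
  rw [hV.petz_eq hW, sub_neg_eq_add]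
  calc _ ≤ ∑ i, ∑ j, (r i + s * (r i - t j) + s / m * (r i - t j) ^ 2) * ov V W i j :=
        Finset.sum_le_sum fun i _ => Finset.sum_le_sum fun j _ =>
          mul_le_mul_of_nonneg_right (rpow_mul_rpow_neg_le (hV.nonneg hρ.1 i) hm
            (hspec (hW.mem_spectrum j)) h0 h1) (ov_nonneg _ _ _ _)
    _ = ∑ i, ∑ j, r i * ov V W i j
        + s * (∑ i, ∑ j, r i * ov V W i j - ∑ i, ∑ j, t j * ov V W i j)
        + s / m * ∑ i, ∑ j, (r i - t j) ^ 2 * ov V W i j := by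
        simp only [Finset.mul_sum, ← Finset.sum_sub_distrib, ← Finset.sum_add_distrib]
        exact Finset.sum_congr rfl fun i _ => Finset.sum_congr rfl fun j _ => by ring
    _ = _ := by rw [a1, a2, a3]; ring

open Filter Topology in
/-- Resolvability exponent of the adversary's channel with sparse inputs. -/
lemma exists_willie_exponent (ho : ∀ a, IsDensity (o a)) (hpd : (o 0).PosDef)
    (hs : supp (o 1) ≤ supp (o 0)) {η : ℝ} (hη : 0 < η) :
    ∃ s K : ℝ, 0 < s ∧ s ≤ 1 ∧ 0 ≤ K ∧ ∀ᶠ α in 𝓝[>] (0 : ℝ), ∀ n : ℕ,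
      ∑ x : Fin n → Fin 2, iidWeight α x * petz (-s) (wordState o x) (tensorPow (mix o α) n)
        ≤ Real.exp (n * α * (s * (relEnt (o 1) (o 0) + η)) + n * α ^ 2 * K) := by
  obtain ⟨m, hm, hspec⟩ := exists_spectrum_mix_subset ho hpd
  have hneg : Tendsto (fun s : ℝ => -s) (𝓝[>] 0) (𝓝 0) := by
    have : Tendsto (fun s : ℝ => -s) (𝓝 0) (𝓝 (-0)) := tendsto_id.neg
    rw [neg_zero] at this
    exact this.mono_left nhdsWithin_le_nhds
  have hev := hneg.eventually (eventually_petz ho hs (half_pos hη))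
  obtain ⟨s, hs', hs0, hs1⟩ := (hev.and (Ioo_mem_nhdsGT (show (0 : ℝ) < 1 by norm_num))).exists
  set D := relEnt (o 1) (o 0)
  set H := o 1 - o 0 with hH
  have hHH : 0 ≤ (H * H).trace.re := by
    have h1 : H.IsHermitian := (ho 1).1.1.sub (ho 0).1.1
    have h2 := posSemidef_conjTranspose_mul_self H
    rw [h1] at h2
    exact (Complex.le_def.1 h2.trace_nonneg).1
  set K := s / m * (H * H).trace.re with hK
  have hK0 : 0 ≤ K := by positivity
  refine ⟨s, K, hs0, hs1.le, hK0, ?_⟩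
  -- The expansion was taken with `η / 2`; the strict slack allows `o 0` to be replaced by `mix o α`
  -- for small `α`.
  have hq : petz (-s) (o 1) (o 0) < 1 + s * (D + η) := by
    rw [abs_neg, abs_of_pos hs0] at hs'
    have := (abs_le.1 hs').2
    nlinarith
  have hcont : Tendsto (fun α => petz (-s) (o 1) (mix o α)) (𝓝[>] 0) (𝓝 (petz (-s) (o 1) (o 0))) := by
    have hc : Continuous fun X : Matrix A A ℂ => (mpow (o 1) (1 - -s) * X).trace.re :=
      Complex.continuous_re.comp (by fun_prop)
    exact (hc.tendsto _).comp (tendsto_cfc_mix ho hpd (f := fun x => x ^ (-s))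
      (continuousOn_id.rpow_const fun x hx => Or.inl (ne_of_gt hx)))
  filter_upwards [hcont.eventually (gt_mem_nhds hq),
    Ioo_mem_nhdsGT (show (0 : ℝ) < 1 / 2 by norm_num)] with α hα hα' n
  have h0 : 0 ≤ α := hα'.1.le
  have h1 : α ≤ 1 := hα'.2.le.trans (by norm_num)
  have hmd := mix_isDensity ho h0 h1
  rw [sum_iidWeight_petz ho hmd.1]
  have q0 : petz (-s) (o 0) (mix o α) ≤ 1 + α ^ 2 * K := by
    refine (petz_neg_le (ho 0) hmd hm
      (fun x hx => (hspec α h0 hα'.2.le hx).1) hs0 hs1.le).trans (le_of_eq ?_)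
    have : o 0 - mix o α = -((α : ℂ) • H) := by rw [← mix_sub, neg_sub]
    rw [this, neg_mul_neg, Matrix.smul_mul, Matrix.mul_smul, trace_smul, trace_smul, smul_eq_mul,
      smul_eq_mul, Complex.re_ofReal_mul, Complex.re_ofReal_mul, hK]
    ring
  have hbase : (1 - α) * petz (-s) (o 0) (mix o α) + α * petz (-s) (o 1) (mix o α)
      ≤ α * (s * (D + η)) + α ^ 2 * K + 1 := by
    have a1 := mul_le_mul_of_nonneg_left q0 (sub_nonneg.2 h1)
    have a2 := mul_le_mul_of_nonneg_left hα.le h0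
    have a3 : 0 ≤ α * (α ^ 2 * K) := by positivity
    nlinarith
  have hnn : 0 ≤ (1 - α) * petz (-s) (o 0) (mix o α) + α * petz (-s) (o 1) (mix o α) :=
    add_nonneg (mul_nonneg (sub_nonneg.2 h1) (petz_nonneg (ho 0).1 hmd.1 _))
      (mul_nonneg h0 (petz_nonneg (ho 1).1 hmd.1 _))
  calc _ ≤ Real.exp (α * (s * (D + η)) + α ^ 2 * K) ^ n :=
        pow_le_pow_left₀ hnn (hbase.trans (Real.add_one_le_exp _)) n
    _ = _ := by rw [← Real.exp_nat_mul]; congr 1; ring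

/-- Soft covering for product channels, with the type classes as pinching labels. -/
lemma sum_codebook_relEnt_word_le {J : Type*} [Fintype J] [DecidableEq J]
    (ho : ∀ a, IsDensity (o a)) (hpd : (o 0).PosDef) {α : ℝ} (h0 : 0 ≤ α) (h1 : α < 1) (n : ℕ)
    {S : Finset J} (hS : S.Nonempty) {s : ℝ} (hs0 : 0 < s) (hs1 : s ≤ 1) :
    ∑ C : J → Fin n → Fin 2, (∏ j, iidWeight α (C j)) *
        relEnt (∑ j ∈ S, (((S.card : ℝ)⁻¹ : ℝ) : ℂ) • wordState o (C j)) (tensorPow (mix o α) n)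
      ≤ ((S.card : ℝ)⁻¹ * ((n : ℝ) + 1) ^ Fintype.card A) ^ s / s *
        ∑ x : Fin n → Fin 2, iidWeight α x * petz (-s) (wordState o x) (tensorPow (mix o α) n) := by
  have hm := mix_posDef ho hpd h0 h1
  obtain ⟨U, t, hU⟩ := exists_isDiag hm.1
  rw [← card_types]
  exact sum_codebook_relEnt_le (iidWeight_nonneg h0 h1.le) (sum_iidWeight α)
    (wordState_isDensity ho) (sum_iidWeight_wordState o α) (tensorFam_posDef fun _ => hm)
    (IsDiag.tensorFam fun _ => hU) typeOf (fun i j h => prod_eq_of_typeOf_eq t h) hS hs0 hs1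

end Willie

/-! ### Selecting one codebook -/

section Selection

variable {A B I : Type*} [Fintype A] [DecidableEq A] [Fintype B] [DecidableEq B]
  [Fintype I] [DecidableEq I] {M L n : ℕ}

lemma supp_conj_le_of_posDef {V : Matrix A I ℂ} (hV : Vᴴ * V = 1) (ρ : Matrix I I ℂ)
    {τ : Matrix I I ℂ} (hτ : τ.PosDef) : supp (V * ρ * Vᴴ) ≤ supp (V * τ * Vᴴ) := by
  rintro _ ⟨u, rfl⟩
  refine ⟨(V * τ⁻¹ * ρ * Vᴴ) *ᵥ u, ?_⟩
  have hdet : IsUnit τ.det := (Matrix.isUnit_iff_isUnit_det τ).1 hτ.isUnit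
  have h1 : V * τ * Vᴴ * (V * τ⁻¹ * ρ * Vᴴ) = V * ρ * Vᴴ := by
    calc _ = V * τ * (Vᴴ * V) * τ⁻¹ * ρ * Vᴴ := by simp only [Matrix.mul_assoc]
      _ = V * (τ * τ⁻¹) * ρ * Vᴴ := by rw [hV, Matrix.mul_one]; simp only [Matrix.mul_assoc]
      _ = _ := by rw [Matrix.mul_nonsing_inv _ hdet, Matrix.mul_one]
  rw [mulVecLin_apply, mulVecLin_apply, mulVec_mulVec, h1]

/-- The output of the subcode of a message. -/
def subcodeState (o : Fin 2 → Matrix A A ℂ) (c : Fin M × Fin L → Fin n → Fin 2) (m : Fin M) :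
    Matrix (Fin n → A) (Fin n → A) ℂ :=
  ∑ l, (((L : ℝ)⁻¹ : ℝ) : ℂ) • wordState o (c (m, l))

/-- The average output of a codebook. -/
def codeState (o : Fin 2 → Matrix A A ℂ) (c : Fin M × Fin L → Fin n → Fin 2) :
    Matrix (Fin n → A) (Fin n → A) ℂ :=
  ∑ m, (((M : ℝ)⁻¹ : ℝ) : ℂ) • subcodeState o c m

variable {o : Fin 2 → Matrix A A ℂ}

lemma sum_inv_card (hL : 0 < L) : ∑ _l : Fin L, (L : ℝ)⁻¹ = 1 := by
  have : (L : ℝ) ≠ 0 := by exact_mod_cast hL.ne'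
  simp [this]

lemma isDensity_average {L : ℕ} (hL : 0 < L) {ρ : Fin L → Matrix A A ℂ}
    (hρ : ∀ l, IsDensity (ρ l)) : IsDensity (∑ l, (((L : ℝ)⁻¹ : ℝ) : ℂ) • ρ l) := by
  refine ⟨sum_smul_posSemidef _ (fun _ _ => by positivity) fun l _ => (hρ l).1, ?_⟩
  rw [trace_sum]
  simp_rw [trace_smul, (hρ _).2, smul_eq_mul, mul_one]
  exact_mod_cast sum_inv_card hL

lemma subcodeState_isDensity (ho : ∀ a, IsDensity (o a)) (hL : 0 < L)
    (c : Fin M × Fin L → Fin n → Fin 2) (m : Fin M) : IsDensity (subcodeState o c m) :=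
  isDensity_average hL fun _ => wordState_isDensity ho _

lemma codeState_isDensity (ho : ∀ a, IsDensity (o a)) (hM : 0 < M) (hL : 0 < L)
    (c : Fin M × Fin L → Fin n → Fin 2) : IsDensity (codeState o c) :=
  isDensity_average hM fun m => subcodeState_isDensity ho hL c m

lemma crossLog_codeState (c : Fin M × Fin L → Fin n → Fin 2)
    (Z : Matrix (Fin n → A) (Fin n → A) ℂ) :
    crossLog (codeState o c) Z
      = ∑ m, (M : ℝ)⁻¹ * ∑ l, (L : ℝ)⁻¹ * crossLog (wordState o (c (m, l))) Z := by
  rw [codeState, crossLog_sum]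
  refine Finset.sum_congr rfl fun m _ => ?_
  rw [crossLog_smul, subcodeState, crossLog_sum]
  congr 1
  exact Finset.sum_congr rfl fun l _ => crossLog_smul _ _ _

/-- The quantity is linear in the code state, whose expectation is exactly the product mixture. -/
lemma sum_crossLog_codeState (hM : 0 < M) (hL : 0 < L) (α : ℝ)
    (Z : Matrix (Fin n → A) (Fin n → A) ℂ) :
    ∑ c : Fin M × Fin L → Fin n → Fin 2, (∏ j, iidWeight α (c j)) * crossLog (codeState o c) Z
      = crossLog (tensorPow (mix o α) n) Z := by
  have h1 : crossLog (tensorPow (mix o α) n) Z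
      = ∑ x : Fin n → Fin 2, iidWeight α x * crossLog (wordState o x) Z := by
    rw [← sum_iidWeight_wordState, crossLog_sum]
    exact Finset.sum_congr rfl fun x _ => crossLog_smul _ _ _
  simp_rw [crossLog_codeState]
  calc _ = ∑ m : Fin M, (M : ℝ)⁻¹ * ∑ l : Fin L, (L : ℝ)⁻¹ *
        ∑ c : Fin M × Fin L → Fin n → Fin 2,
          (∏ j, iidWeight α (c j)) * crossLog (wordState o (c (m, l))) Z := by
        simp_rw [Finset.mul_sum]
        rw [Finset.sum_comm]
        refine Finset.sum_congr rfl fun m _ => ?_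
        rw [Finset.sum_comm]
        exact Finset.sum_congr rfl fun _ _ => Finset.sum_congr rfl fun _ _ => by ring
    _ = ∑ _m : Fin M, (M : ℝ)⁻¹ * ∑ _l : Fin L, (L : ℝ)⁻¹ * crossLog (tensorPow (mix o α) n) Z := by
        refine Finset.sum_congr rfl fun m _ => ?_
        congr 1
        refine Finset.sum_congr rfl fun l _ => ?_
        rw [h1, ← sum_codebook_single (sum_iidWeight α) (m, l) fun x => crossLog (wordState o x) Z]
    _ = _ := by
        rw [← Finset.sum_mul, sum_inv_card hM, one_mul, ← Finset.sum_mul, sum_inv_card hL, one_mul]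

/-- Convexity of the divergence in its first argument: subcodes close to the target make the whole
code close as well. -/
lemma relEnt_codeState_le (ho : ∀ a, IsDensity (o a)) (hM : 0 < M) (hL : 0 < L)
    (c : Fin M × Fin L → Fin n → Fin 2) (Z : Matrix (Fin n → A) (Fin n → A) ℂ) :
    relEnt (codeState o c) Z ≤ ∑ m, (M : ℝ)⁻¹ * relEnt (subcodeState o c m) Z := by
  have h1 := crossLog_self_sum_le Finset.univ (fun _ _ => by positivity) (sum_inv_card hM)
    (fun m _ => (subcodeState_isDensity ho hL c m).1)
  have h2 : crossLog (codeState o c) Z = ∑ m, (M : ℝ)⁻¹ * crossLog (subcodeState o c m) Z := by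
    rw [codeState, crossLog_sum]
    exact Finset.sum_congr rfl fun m _ => crossLog_smul _ _ _
  simp only [relEnt, mul_sub, Finset.sum_sub_distrib]
  rw [h2]
  exact sub_le_sub_right h1 _

lemma relEnt_tensorPow_mix (ho : ∀ a, IsDensity (o a)) (hpd : (o 0).PosDef) {α : ℝ} (h0 : 0 ≤ α)
    (h1 : α ≤ 1) :
    relEnt (tensorPow (mix o α) n) (tensorPow (o 0) n) = n * relEnt (mix o α) (o 0) := by
  have hm := mix_isDensity ho h0 h1
  obtain ⟨W, s, hW⟩ := exists_isDiag (ho 0).1.1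
  have hs := hW.pos hpd
  rw [relEnt, tensorPow_eq, tensorPow_eq, crossLog_self_tensorFam (fun _ => hm.1.1)
    (fun _ => hm.re_trace), crossLog_tensorFam (fun _ => hm.1.1) (fun _ => hm.re_trace)
    (fun _ => hW) (fun i j hj => absurd hj (hs j).ne'), relEnt]
  simp
  ring

/-- The random coding argument: one codebook is simultaneously reliable, covert and secret. -/
lemma exists_codebook {o' : Fin 2 → Matrix B B ℂ} (ho : ∀ a, IsDensity (o a))
    (hpd : (o 0).PosDef) (ho' : ∀ a, IsDensity (o' a)) (hM : 0 < M) (hL : 0 < L) {α : ℝ}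
    (h0 : 0 ≤ α) (h1 : α < 1) {t s κ η : ℝ} (ht0 : 0 ≤ t) (ht1 : t ≤ 1) (hs0 : 0 < s)
    (hs1 : s ≤ 1) (hκ : 0 ≤ κ) (hη : 0 < η) :
    ∃ (c : Fin M × Fin L → Fin n → Fin 2)
      (Λ : Fin M × Fin L → Matrix (Fin n → B) (Fin n → B) ℂ),
      (∀ j, (Λ j).PosSemidef) ∧ ∑ j, Λ j = 1 ∧
      crossLog (codeState o c) (tensorPow (mix o α) n)
          - crossLog (codeState o c) (tensorPow (o 0) n)
        + κ * (∑ j, ((M : ℝ) * L)⁻¹ * (1 - (Λ j * wordState o' (c j)).trace.re)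
          + ∑ m, (M : ℝ)⁻¹ * relEnt (subcodeState o c m) (tensorPow (mix o α) n))
      ≤ n * relEnt (mix o α) (o 0)
        + κ * ((2 * (2 * ((M : ℝ) * L)) ^ t * ∑ x : Fin n → Fin 2,
            iidWeight α x * petz t (wordState o' x) (tensorPow (mix o' α) n) + η)
          + ((L : ℝ)⁻¹ * ((n : ℝ) + 1) ^ Fintype.card A) ^ s / s * ∑ x : Fin n → Fin 2,
            iidWeight α x * petz (-s) (wordState o x) (tensorPow (mix o α) n)) := by
  have : Nonempty (Fin M × Fin L) := ⟨(⟨0, hM⟩, ⟨0, hL⟩)⟩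
  have hw := iidWeight_nonneg (n := n) h0 h1.le
  obtain ⟨Λ, hΛ, hΛ1, hB⟩ := exists_decoders (J := Fin M × Fin L) hw (sum_iidWeight α)
    (wordState_isDensity ho') (sum_iidWeight_wordState o' α) ht0 ht1 hη
  have hcard : (Fintype.card (Fin M × Fin L) : ℝ) = (M : ℝ) * L := by simp
  rw [hcard] at hB
  set EB := 2 * (2 * ((M : ℝ) * L)) ^ t * ∑ x : Fin n → Fin 2,
            iidWeight α x * petz t (wordState o' x) (tensorPow (mix o' α) n) + η
  set EW := ((L : ℝ)⁻¹ * ((n : ℝ) + 1) ^ Fintype.card A) ^ s / s * ∑ x : Fin n → Fin 2,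
            iidWeight α x * petz (-s) (wordState o x) (tensorPow (mix o α) n) with hEW
  set τ := tensorPow (mix o α) n
  set W : (Fin M × Fin L → Fin n → Fin 2) → ℝ := fun c => ∏ j, iidWeight α (c j) with hWd
  have hWn : ∀ c, 0 ≤ W c := fun c => Finset.prod_nonneg fun j _ => hw _
  have hW1 : ∑ c, W c = 1 := sum_codebook_weight (sum_iidWeight α)
  have hm : ∀ m, ∑ c, W c * relEnt (subcodeState o c m) τ ≤ EW := by
    intro m
    have hS : (({m} : Finset (Fin M)) ×ˢ (Finset.univ : Finset (Fin L))).Nonempty :=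
      ⟨(m, ⟨0, hL⟩), by simp⟩
    have h2 := sum_codebook_relEnt_word_le (J := Fin M × Fin L) ho hpd h0 h1 n hS hs0 hs1
    have hc : ((({m} : Finset (Fin M)) ×ˢ (Finset.univ : Finset (Fin L))).card : ℝ) = L := by simp
    simp only [hc, Finset.sum_product, Finset.sum_singleton] at h2
    exact h2
  have hR : ∑ c, W c * ∑ m, (M : ℝ)⁻¹ * relEnt (subcodeState o c m) τ ≤ EW := by
    calc _ = ∑ m, (M : ℝ)⁻¹ * ∑ c, W c * relEnt (subcodeState o c m) τ := by
          simp_rw [Finset.mul_sum]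
          rw [Finset.sum_comm]
          exact Finset.sum_congr rfl fun _ _ => Finset.sum_congr rfl fun _ _ => by ring
      _ ≤ ∑ _m : Fin M, (M : ℝ)⁻¹ * EW :=
          Finset.sum_le_sum fun m _ => mul_le_mul_of_nonneg_left (hm m) (by positivity)
      _ = EW := by rw [← Finset.sum_mul, sum_inv_card hM, one_mul]
  -- One scalar cost for all three requirements, so a single expectation bound suffices. The first
  -- difference is the linear part of the covertness divergence; it must enter with weight one to
  -- keep the sharp constant.
  set F : (Fin M × Fin L → Fin n → Fin 2) → ℝ := fun c =>
    crossLog (codeState o c) τ - crossLog (codeState o c) (tensorPow (o 0) n)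
        + κ * (∑ j, ((M : ℝ) * L)⁻¹ * (1 - (Λ c j * wordState o' (c j)).trace.re)
          + ∑ m, (M : ℝ)⁻¹ * relEnt (subcodeState o c m) τ) with hF
  have hsum : ∑ c, W c * F c ≤ n * relEnt (mix o α) (o 0) + κ * (EB + EW) := by
    have e : ∑ c, W c * F c = (∑ c, W c * crossLog (codeState o c) τ
        - ∑ c, W c * crossLog (codeState o c) (tensorPow (o 0) n))
        + κ * (∑ c, W c * ∑ j, ((M : ℝ) * L)⁻¹ * (1 - (Λ c j * wordState o' (c j)).trace.re)
          + ∑ c, W c * ∑ m, (M : ℝ)⁻¹ * relEnt (subcodeState o c m) τ) := by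
      rw [← Finset.sum_sub_distrib, ← Finset.sum_add_distrib, Finset.mul_sum,
        ← Finset.sum_add_distrib]
      exact Finset.sum_congr rfl fun c _ => by rw [hF]; ring
    rw [e, sum_crossLog_codeState hM hL, sum_crossLog_codeState hM hL,
      ← relEnt_tensorPow_mix ho hpd h0 h1.le]
    have := mul_le_mul_of_nonneg_left (add_le_add hB hR) hκ
    exact add_le_add le_rfl this
  obtain ⟨c, hc⟩ : ∃ c, F c ≤ n * relEnt (mix o α) (o 0) + κ * (EB + EW) := by
    by_contra! hcon
    obtain ⟨c₀, hc₀⟩ : ∃ c₀, 0 < W c₀ := by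
      by_contra! hn
      have : ∑ c, W c ≤ 0 := Finset.sum_nonpos fun c _ => hn c
      linarith
    have : ∑ c, W c * (n * relEnt (mix o α) (o 0) + κ * (EB + EW)) < ∑ c, W c * F c :=
      Finset.sum_lt_sum (fun c _ => mul_le_mul_of_nonneg_left (hcon c).le (hWn c))
        ⟨c₀, Finset.mem_univ _, mul_lt_mul_of_pos_left (hcon c₀) hc₀⟩
    rw [← Finset.sum_mul, hW1, one_mul] at this
    linarith
  exact ⟨c, Λ c, hΛ c, hΛ1 c, hc⟩

end Selection

/-! ### Achievability -/

section Achievability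

variable {B W I : Type*} [Fintype B] [DecidableEq B] [Fintype W] [DecidableEq W]
  [Fintype I] [DecidableEq I] {M L n : ℕ} {P : CQChannel (Fin 2) B W}

/-- A codebook with small total cost is a reliable, covert and secret code. -/
lemma exists_code {V : Matrix W I ℂ} {o : Fin 2 → Matrix I I ℂ} (hV : Vᴴ * V = 1)
    (he : ∀ a, P.willie a = V * o a * Vᴴ) (ho : ∀ a, IsDensity (o a)) (hpd : (o 0).PosDef)
    (hM : 0 < M) (hL : 0 < L) {α : ℝ} (h0 : 0 ≤ α) (h1 : α < 1)
    (c : Fin M × Fin L → Fin n → Fin 2) (Λ : Fin M × Fin L → Matrix (Fin n → B) (Fin n → B) ℂ)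
    (hΛ : ∀ j, (Λ j).PosSemidef) (hΛ1 : ∑ j, Λ j = 1) {ε δ δ' κ : ℝ} (hδ' : 0 < δ')
    (hκ : 1 < κ) (hε : δ ≤ (κ - 1) * ε) (hκδ : δ ≤ (κ - 1) * (δ' ^ 2 / 4))
    (hcost : crossLog (codeState o c) (tensorPow (mix o α) n)
          - crossLog (codeState o c) (tensorPow (o 0) n)
        + κ * (∑ j, ((M : ℝ) * L)⁻¹ * (1 - (Λ j * wordState P.bob (c j)).trace.re)
          + ∑ m, (M : ℝ)⁻¹ * relEnt (subcodeState o c m) (tensorPow (mix o α) n)) ≤ δ) :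
    ∃ C : SecrecyCode (Fin 2) B M L 1 n, C.Reliable P ε ∧ C.Covert P δ ∧ C.Secret P δ' := by
  set τ := tensorPow (mix o α) n with hτd
  set err := ∑ j, ((M : ℝ) * L)⁻¹ * (1 - (Λ j * wordState P.bob (c j)).trace.re) with herr
  set R := ∑ m, (M : ℝ)⁻¹ * relEnt (subcodeState o c m) τ with hR
  have hmd := mix_isDensity ho h0 h1.le
  have hτ : IsDensity τ := tensorPow_isDensity hmd n
  have hτp : τ.PosDef := tensorFam_posDef fun _ => mix_posDef ho hpd h0 h1
  have hτ0 : IsDensity (tensorPow (o 0) n) := tensorPow_isDensity (ho 0) n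
  have hτ0p : (tensorPow (o 0) n).PosDef := tensorFam_posDef fun _ => hpd
  have hcs := codeState_isDensity ho hM hL c
  have hsc := fun m => subcodeState_isDensity ho hL c m
  have herr0 : 0 ≤ err := by
    refine Finset.sum_nonneg fun j _ => mul_nonneg (by positivity) ?_
    have h2 : Λ j ≤ 1 := by
      rw [le_iff, ← hΛ1, ← Finset.add_sum_erase _ _ (Finset.mem_univ j), add_sub_cancel_left]
      exact posSemidef_sum _ fun k _ => hΛ k
    have h3 := trace_mul_le_of_le (wordState_isDensity P.bob_isDensity (c j)).1 h2
    rw [Matrix.mul_one, (wordState_isDensity P.bob_isDensity (c j)).re_trace, trace_mul_comm] at h3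
    linarith
  have hR0 : ∀ m, 0 ≤ relEnt (subcodeState o c m) τ := by
    intro m
    have := klein_posDef (hsc m).1 hτp
    rwa [(hsc m).re_trace, hτ.re_trace, sub_self] at this
  have hRn : 0 ≤ R := Finset.sum_nonneg fun m _ => mul_nonneg (by positivity) (hR0 m)
  have hD0 : 0 ≤ relEnt (codeState o c) (tensorPow (o 0) n) := by
    have := klein_posDef hcs.1 hτ0p
    rwa [hcs.re_trace, hτ0.re_trace, sub_self] at this
  have hD : relEnt (codeState o c) (tensorPow (o 0) n)
      ≤ R + (crossLog (codeState o c) τ - crossLog (codeState o c) (tensorPow (o 0) n)) := by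
    have := relEnt_codeState_le ho hM hL c τ
    rw [relEnt] at this ⊢
    linarith
  have hκ0 : 0 < κ - 1 := sub_pos.2 hκ
  -- The linear part of the cost is at least `-R`, since adding `R` bounds a non-negative
  -- divergence. Hence a large `κ` forces both `err` and `R` to be small.
  have hmain : (κ - 1) * (err + R) ≤ δ := by nlinarith
  have hDδ : relEnt (codeState o c) (tensorPow (o 0) n) ≤ δ := by nlinarith
  have herrε : err ≤ ε := by
    refine le_of_mul_le_mul_left ?_ hκ0
    nlinarith
  have hRδ : R ≤ δ' ^ 2 / 4 := by
    refine le_of_mul_le_mul_left ?_ hκ0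
    nlinarith
  set VV : Matrix (Fin n → W) (Fin n → I) ℂ := tensorFam fun _ => V with hVVd
  have hVV : VVᴴ * VV = 1 := by
    rw [hVVd, tensorFam_conjTranspose, tensorFam_mul]
    simp only [hV]
    exact tensorFam_one
  have hconj : ∀ ρ : Fin n → Matrix I I ℂ,
      (tensorFam fun i => V * ρ i * Vᴴ) = VV * tensorFam ρ * VVᴴ := by
    intro ρ
    rw [hVVd, tensorFam_conjTranspose, tensorFam_mul, tensorFam_mul]
  have hword : ∀ x : Fin n → Fin 2, wordState P.willie x = VV * wordState o x * VVᴴ := by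
    intro x
    rw [wordState, wordState, ← hconj]
    congr 1
    ext1 i
    exact he _
  let C : SecrecyCode (Fin 2) B M L 1 n :=
    { enc := fun m l _ => c (m, l)
      dec := fun _ => Λ
      dec_posSemidef := fun _ => hΛ
      dec_sum := fun _ => hΛ1 }
  have hgiven : ∀ m, C.willieGiven P m = VV * subcodeState o c m * VVᴴ := by
    intro m
    rw [C.willieGiven_eq, subcodeState, Matrix.mul_sum, Matrix.sum_mul]
    refine Finset.sum_congr rfl fun l _ => ?_
    rw [Matrix.mul_smul, Matrix.smul_mul, ← hword]
    rfl
  have havg : C.willieAvg P = VV * codeState o c * VVᴴ := by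
    rw [C.willieAvg_eq, codeState, Matrix.mul_sum, Matrix.sum_mul]
    refine Finset.sum_congr rfl fun m _ => ?_
    rw [Matrix.mul_smul, Matrix.smul_mul, ← hgiven]
  have hpow : tensorPow (P.willie 0) n = VV * tensorPow (o 0) n * VVᴴ := by
    rw [tensorPow_eq, he 0]
    exact hconj _
  refine ⟨C, ?_, ?_, VV * τ * VVᴴ, ?_, ?_⟩
  · rw [SecrecyCode.Reliable, C.avgError_eq]
    exact herrε
  · rw [SecrecyCode.Covert, havg, hpow, relEntropy_of_supp (supp_conj_le_of_posDef hVV _ hτ0p),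
      relEnt_conj hVV hcs.1.1 hτ0.1.1]
    exact_mod_cast hDδ
  · exact ⟨hτ.1.mul_mul_conjTranspose_same VV, by rw [trace_conj hVV, hτ.2]⟩
  · obtain ⟨U, q, hU⟩ := exists_isDiag hτ.1.1
    have hq := hU.pos hτp
    -- The weight `4 / δ'` in the Pinsker bound leaves `δ' / 2` for the constant, and the divergence
    -- term is at most `δ' / 2` because `R ≤ δ' ^ 2 / 4`.
    have hpin : ∀ m, traceNorm (C.willieGiven P m - VV * τ * VVᴴ)
        ≤ (4 / δ') / 2 * relEnt (subcodeState o c m) τ + 2 / (4 / δ') := by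
      intro m
      rw [hgiven, ← Matrix.sub_mul, ← Matrix.mul_sub, traceNorm_conj hVV]
      exact traceNorm_le_relEnt (hsc m).1 hτ.1 (hsc m).re_trace hτ.re_trace hU
        (fun j hj => absurd hj (hq j).ne') (by positivity)
    have hM' : (0 : ℝ) < M := by exact_mod_cast hM
    calc _ ≤ 1 / (M : ℝ) * ∑ m, ((4 / δ') / 2 * relEnt (subcodeState o c m) τ + 2 / (4 / δ')) :=
          mul_le_mul_of_nonneg_left (Finset.sum_le_sum fun m _ => hpin m) (by positivity)
      _ = 2 / δ' * R + δ' / 2 := by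
          rw [Finset.sum_add_distrib, Finset.sum_const, Finset.card_univ, Fintype.card_fin,
            nsmul_eq_mul, hR, ← Finset.mul_sum, ← Finset.mul_sum]
          field_simp
          ring
      _ ≤ 2 / δ' * (δ' ^ 2 / 4) + δ' / 2 := by gcongr
      _ = δ' := by field_simp; ring

open Filter Topology in
lemma tendsto_pow_mul_exp_neg_sqrt (d : ℕ) {b : ℝ} (hb : 0 < b) :
    Tendsto (fun n : ℕ => ((n : ℝ) + 1) ^ d * Real.exp (-(b * Real.sqrt n))) atTop (𝓝 0) := by
  have h1 := (tendsto_rpow_mul_exp_neg_mul_atTop_nhds_zero ((2 * d : ℕ) : ℝ) b hb).comp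
    ((tendsto_atTop_add_const_right atTop 1
      (Real.tendsto_sqrt_atTop.comp tendsto_natCast_atTop_atTop)))
  have h2 := h1.const_mul (Real.exp b)
  rw [mul_zero] at h2
  refine squeeze_zero (fun n => by positivity) (fun n => ?_) h2
  simp only [Function.comp]
  rw [Real.rpow_natCast, pow_mul]
  have h3 : (n : ℝ) + 1 ≤ (Real.sqrt n + 1) ^ 2 := by
    have := Real.sq_sqrt (Nat.cast_nonneg (α := ℝ) n)
    have := Real.sqrt_nonneg (n : ℝ)
    nlinarith
  have h4 : Real.exp b * (((Real.sqrt n + 1) ^ 2) ^ d * Real.exp (-b * (Real.sqrt n + 1)))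
      = ((Real.sqrt n + 1) ^ 2) ^ d * Real.exp (-(b * Real.sqrt n)) := by
    rw [mul_left_comm, ← Real.exp_add]
    congr 2
    ring
  rw [h4]
  gcongr

lemma natCeil_exp_le {x : ℝ} (hx : 0 ≤ x) : (⌈Real.exp x⌉₊ : ℝ) ≤ 2 * Real.exp x := by
  have h1 := (Nat.ceil_lt_add_one (Real.exp_pos x).le).le
  have h2 := Real.one_le_exp hx
  linarith

/-- The base `8` is the factor `2` of the test threshold times one `2` for each rounded-up message
set. -/
lemma random_coding_le {M L x y t S E F : ℝ} (hM : M ≤ 2 * Real.exp x) (hL : L ≤ 2 * Real.exp y)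
    (hM0 : 0 ≤ M) (hL0 : 0 ≤ L) (ht : 0 ≤ t) (hS : S ≤ Real.exp E) (hF : t * (x + y) + E ≤ F) :
    2 * (2 * (M * L)) ^ t * S ≤ 2 * 8 ^ t * Real.exp F := by
  have hML : 2 * (M * L) ≤ 8 * Real.exp (x + y) := by
    rw [Real.exp_add]
    have := mul_le_mul hM hL hL0 (by positivity)
    linarith
  have hpow : (2 * (M * L)) ^ t ≤ 8 ^ t * Real.exp (t * (x + y)) := by
    calc _ ≤ (8 * Real.exp (x + y)) ^ t := Real.rpow_le_rpow (by positivity) hML ht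
      _ = _ := by
        rw [Real.mul_rpow (by norm_num) (Real.exp_pos _).le, ← Real.exp_mul, mul_comm (x + y)]
  calc _ ≤ 2 * (2 * (M * L)) ^ t * Real.exp E := by gcongr
    _ ≤ 2 * (8 ^ t * Real.exp (t * (x + y))) * Real.exp E := by gcongr
    _ = 2 * 8 ^ t * Real.exp (t * (x + y) + E) := by rw [Real.exp_add (t * (x + y))]; ring
    _ ≤ _ := by gcongr

lemma covering_le {L y s S E F q : ℝ} (hL : Real.exp y ≤ L) (hs0 : 0 < s) (hs1 : s ≤ 1)
    (hq : 1 ≤ q) (hS : S ≤ Real.exp E) (hF : -(s * y) + E ≤ F) :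
    (L⁻¹ * q) ^ s / s * S ≤ q / s * Real.exp F := by
  have hL0 : 0 < L := (Real.exp_pos y).trans_le hL
  have hLy : L⁻¹ ≤ Real.exp (-y) := by
    rw [Real.exp_neg]
    exact inv_anti₀ (Real.exp_pos y) hL
  have hpow : (L⁻¹ * q) ^ s ≤ Real.exp (-(s * y)) * q := by
    calc _ ≤ (Real.exp (-y) * q) ^ s := Real.rpow_le_rpow (by positivity) (by gcongr) hs0.le
      _ = Real.exp (-(s * y)) * q ^ s := by
          rw [Real.mul_rpow (Real.exp_pos _).le (by positivity), ← Real.exp_mul]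
          congr 2
          ring
      _ ≤ Real.exp (-(s * y)) * q ^ (1 : ℝ) := by
          gcongr
      _ = _ := by rw [Real.rpow_one]
  calc _ ≤ (L⁻¹ * q) ^ s / s * Real.exp E := by gcongr
    _ ≤ Real.exp (-(s * y)) * q / s * Real.exp E := by gcongr
    _ = q / s * Real.exp (-(s * y) + E) := by rw [Real.exp_add (-(s * y))]; ring
    _ ≤ _ := by gcongr

-- The parameter choice: `α = a / √n` with `a` just below the covertness limit, `log M` at the
-- required rate, and `log L` above the resolvability threshold while `log M + log L` stays below
-- the decoding threshold.
open Filter Topology in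
lemma achievable_of_lt (hB : supp (P.bob 1) ≤ supp (P.bob 0))
    (hW : supp (P.willie 1) ≤ supp (P.willie 0)) (hne : P.willie 1 ≠ P.willie 0) {r : ℝ}
    (hr : 0 < r) (h : r < (relEnt (P.bob 1) (P.bob 0) - relEnt (P.willie 1) (P.willie 0))
      / Real.sqrt (1 / 2 * chiSq (P.willie 1) (P.willie 0))) : P.Achievable r := by
  obtain ⟨hc, _, hφ⟩ := second_order P.willie_isDensity hW hne
  set χ := chiSq (P.willie 1) (P.willie 0)
  set DB := relEnt (P.bob 1) (P.bob 0) with hDB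
  set DW := relEnt (P.willie 1) (P.willie 0) with hDW
  have hDW0 : 0 ≤ DW := relEnt_nonneg_of_supp (P.willie_isDensity 1) (P.willie_isDensity 0) hW
  intro ε δ δ' hε hδ hδ'
  have hs2 : 0 < Real.sqrt (1 / 2 * χ) := Real.sqrt_pos.2 (by positivity)
  rw [lt_div_iff₀ hs2] at h
  have hD : 0 < DB - DW := lt_of_le_of_lt (by positivity) h
  have hsδ : 0 < Real.sqrt δ := Real.sqrt_pos.2 hδ
  -- The lower limit leaves room for the secret rate, the upper one for covertness; the assumption
  -- on `r` says precisely that they are in this order.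
  obtain ⟨a, ha1, ha2⟩ : ∃ a, Real.sqrt δ * r / (DB - DW) < a
      ∧ a < Real.sqrt δ / Real.sqrt (1 / 2 * χ) := by
    refine exists_between ?_
    rw [div_lt_div_iff₀ hD hs2, mul_assoc]
    exact mul_lt_mul_of_pos_left h hsδ
  have ha0 : 0 < a := lt_of_le_of_lt (by positivity) ha1
  rw [div_lt_iff₀ hD] at ha1
  rw [lt_div_iff₀ hs2] at ha2
  have haδ : a ^ 2 * (χ / 2) < δ := by
    have h2 := mul_self_lt_mul_self (by positivity) ha2
    rw [Real.mul_self_sqrt hδ.le] at h2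
    have h3 := Real.mul_self_sqrt (show 0 ≤ 1 / 2 * χ by positivity)
    nlinarith
  -- The gap `a * (DB - DW) - √δ * r` is shared equally among four margins `a * η`. The exponents
  -- lose one `η` on each side, so one `η` per side remains as exponential decay.
  obtain ⟨η, hη0, hη⟩ : ∃ η : ℝ, 0 < η ∧ Real.sqrt δ * r + a * (DW + 2 * η) ≤ a * (DB - 2 * η) := by
    refine ⟨(a * (DB - DW) - Real.sqrt δ * r) / (4 * a), div_pos (sub_pos.2 ha1) (by positivity), ?_⟩
    have : a * (4 * ((a * (DB - DW) - Real.sqrt δ * r) / (4 * a)))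
      = a * (DB - DW) - Real.sqrt δ * r := by field_simp
    nlinarith
  obtain ⟨e, V, o, hV, he, ho, hpd⟩ := exists_compression P.willie_isDensity hW
  have hrel : relEnt (o 1) (o 0) = DW := by
    rw [hDW, he 0, he 1, relEnt_conj hV (ho 1).1.1 (ho 0).1.1]
  have hso : supp (o 1) ≤ supp (o 0) := by
    have := supp_conj_le_of_posDef (V := (1 : Matrix {i // e i ≠ 0} {i // e i ≠ 0} ℂ)) (by simp) (o 1) hpd
    simpa using this
  obtain ⟨t, K, ht0, ht1, hK, hbob⟩ := exists_bob_exponent P.bob_isDensity hB hη0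
  obtain ⟨s, K', hs0, hs1, hK', hwil⟩ := exists_willie_exponent ho hpd hso hη0
  rw [hrel] at hwil
  have hα : Tendsto (fun n : ℕ => a / Real.sqrt n) atTop (𝓝[>] 0) := by
    refine tendsto_nhdsWithin_iff.2 ⟨tendsto_const_nhds.div_atTop
      (Real.tendsto_sqrt_atTop.comp tendsto_natCast_atTop_atTop), ?_⟩
    filter_upwards [eventually_gt_atTop 0] with n hn
    exact div_pos ha0 (Real.sqrt_pos.2 (by exact_mod_cast hn))
  obtain ⟨κ, hκ1, hκε, hκδ⟩ : ∃ κ : ℝ, 1 < κ ∧ δ ≤ (κ - 1) * ε ∧ δ ≤ (κ - 1) * (δ' ^ 2 / 4) := by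
    refine ⟨1 + (δ / ε + δ / (δ' ^ 2 / 4)), by
      have : 0 < δ / ε + δ / (δ' ^ 2 / 4) := by positivity
      linarith, ?_, ?_⟩
    · rw [add_sub_cancel_left, add_mul, div_mul_cancel₀ _ hε.ne']
      have : 0 ≤ δ / (δ' ^ 2 / 4) * ε := by positivity
      linarith
    · rw [add_sub_cancel_left, add_mul, div_mul_cancel₀ _ (by positivity)]
      have : 0 ≤ δ / ε * (δ' ^ 2 / 4) := by positivity
      linarith
  set d := Fintype.card {i // e i ≠ 0}
  -- The cost bound in closed form: error and covering terms decay like `exp (-const * √n)` up to a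
  -- polynomial, the auxiliary decoding slack like `1 / (n + 1)`, and the limit `a ^ 2 * (χ / 2)`
  -- lies strictly below `δ`.
  have hlim : Tendsto (fun n : ℕ => a ^ 2 * (relEnt (mix P.willie (a / Real.sqrt n)) (P.willie 0)
        / (a / Real.sqrt n) ^ 2)
      + κ * ((2 * 8 ^ t * Real.exp (a ^ 2 * K)
            * (((n : ℝ) + 1) ^ 0 * Real.exp (-(t * a * η * Real.sqrt n))) + 1 / ((n : ℝ) + 1))
        + Real.exp (a ^ 2 * K') / s
            * (((n : ℝ) + 1) ^ d * Real.exp (-(s * a * η * Real.sqrt n))))) atTop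
      (𝓝 (a ^ 2 * (χ / 2) + κ * ((2 * 8 ^ t * Real.exp (a ^ 2 * K) * 0 + 0)
        + Real.exp (a ^ 2 * K') / s * 0))) := by
    refine ((hφ.comp hα).const_mul _).add (Tendsto.const_mul _ (Tendsto.add (Tendsto.add
      ((tendsto_pow_mul_exp_neg_sqrt 0 (by positivity)).const_mul _)
      tendsto_one_div_add_atTop_nhds_zero_nat)
      ((tendsto_pow_mul_exp_neg_sqrt d (by positivity)).const_mul _)))
  simp only [mul_zero, add_zero] at hlim
  filter_upwards [hlim.eventually (gt_mem_nhds haδ), hα.eventually hwil,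
    hα.eventually (Ioo_mem_nhdsGT (show (0 : ℝ) < 1 by norm_num)), eventually_gt_atTop 0]
    with n hn hwn hα1 hn0
  have hn' : (0 : ℝ) < n := by exact_mod_cast hn0
  have hsn : 0 < Real.sqrt n := Real.sqrt_pos.2 hn'
  set α := a / Real.sqrt n with hαd
  have hnα : n * α = a * Real.sqrt n := by
    rw [hαd]; field_simp; rw [Real.sq_sqrt hn'.le]
  have hnα2 : n * α ^ 2 = a ^ 2 := by
    rw [hαd, div_pow, Real.sq_sqrt hn'.le]; field_simp
  set x := Real.sqrt (n * δ) * r with hx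
  set y := a * Real.sqrt n * (DW + 2 * η) with hy
  have hx0 : 0 ≤ x := by positivity
  have hy0 : 0 ≤ y := by positivity
  have hxe : x = Real.sqrt n * (Real.sqrt δ * r) := by
    rw [hx, Real.sqrt_mul hn'.le]; ring
  set M := ⌈Real.exp x⌉₊ with hMd
  set L := ⌈Real.exp y⌉₊ with hLd
  have hM : 0 < M := Nat.ceil_pos.2 (Real.exp_pos x)
  have hL : 0 < L := Nat.ceil_pos.2 (Real.exp_pos y)
  have hM' : (0 : ℝ) < M := by exact_mod_cast hM
  have hL' : (0 : ℝ) < L := by exact_mod_cast hL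
  refine ⟨M, L, hM, hL, ?_, ?_⟩
  · rw [Real.le_log_iff_exp_le hM']
    exact Nat.le_ceil _
  obtain ⟨c, Λ, hΛ, hΛ1, hcost⟩ := exists_codebook (n := n) ho hpd P.bob_isDensity hM hL hα1.1.le
    hα1.2 ht0.le ht1 hs0 hs1 (zero_le_one.trans hκ1.le)
    (show (0 : ℝ) < 1 / ((n : ℝ) + 1) by positivity)
  refine exists_code hV he ho hpd hM hL hα1.1.le hα1.2 c Λ hΛ hΛ1 hδ' hκ1 hκε hκδ
    (hcost.trans (le_trans ?_ hn.le))
  have t1 : n * relEnt (mix o α) (o 0)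
      = a ^ 2 * (relEnt (mix P.willie α) (P.willie 0) / α ^ 2) := by
    rw [mix_conj V P.willie o he, he 0,
      relEnt_conj hV (mix_isDensity ho hα1.1.le hα1.2.le).1.1 (ho 0).1.1, ← hnα2]
    have : α ≠ 0 := hα1.1.ne'
    field_simp
  have t2 : 2 * (2 * ((M : ℝ) * L)) ^ t * ∑ x : Fin n → Fin 2,
        iidWeight α x * petz t (wordState P.bob x) (tensorPow (mix P.bob α) n)
      ≤ 2 * 8 ^ t * Real.exp (a ^ 2 * K)
            * (((n : ℝ) + 1) ^ 0 * Real.exp (-(t * a * η * Real.sqrt n))) := by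
    have hexp : t * (x + y) + (-(n * α * (t * (DB - η))) + n * α ^ 2 * K)
        ≤ a ^ 2 * K + -(t * a * η * Real.sqrt n) := by
      rw [hnα, hnα2, hxe, hy]
      calc _ = t * Real.sqrt n * (Real.sqrt δ * r + a * (DW + 2 * η))
            + (-(a * Real.sqrt n * (t * (DB - η))) + a ^ 2 * K) := by ring
        _ ≤ t * Real.sqrt n * (a * (DB - 2 * η))
            + (-(a * Real.sqrt n * (t * (DB - η))) + a ^ 2 * K) :=
          add_le_add_left (mul_le_mul_of_nonneg_left hη (mul_pos ht0 hsn).le) _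
        _ = _ := by ring
    refine (random_coding_le (natCeil_exp_le hx0) (natCeil_exp_le hy0) hM'.le hL'.le ht0.le
      (hbob α hα1.1.le hα1.2.le n) hexp).trans (le_of_eq ?_)
    rw [Real.exp_add]; ring
  have t3 : ((L : ℝ)⁻¹ * ((n : ℝ) + 1) ^ d) ^ s / s * ∑ x : Fin n → Fin 2,
        iidWeight α x * petz (-s) (wordState o x) (tensorPow (mix o α) n)
      ≤ Real.exp (a ^ 2 * K') / s
            * (((n : ℝ) + 1) ^ d * Real.exp (-(s * a * η * Real.sqrt n))) := by
    have hexp : -(s * y) + (n * α * (s * (DW + η)) + n * α ^ 2 * K')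
        = a ^ 2 * K' + -(s * a * η * Real.sqrt n) := by
      rw [hnα, hnα2, hy]; ring
    refine (covering_le (Nat.le_ceil _) hs0 hs1 (one_le_pow₀ (by linarith)) (hwn n)
      hexp.le).trans (le_of_eq ?_)
    rw [Real.exp_add]; ring
  rw [t1]
  have := mul_le_mul_of_nonneg_left (add_le_add (add_le_add_left t2 (1 / ((n : ℝ) + 1))) t3)
    (zero_le_one.trans hκ1.le)
  linarith

end Achievability

end

end CovertSecrecy

/-! ### The capacity formula -/

namespace CovertSecrecy

/-- The covert secrecy capacity formula, with a converse under weak secrecy. -/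
lemma capacity_eq {B W : Type*} [Fintype B] [DecidableEq B] [Fintype W] [DecidableEq W]
    (P : CQChannel (Fin 2) B W)
    (hB : supp (P.bob 1) ≤ supp (P.bob 0))
    (hW : supp (P.willie 1) ≤ supp (P.willie 0))
    (hne : P.willie 1 ≠ P.willie 0) :
    P.capacity =
        ENNReal.ofReal
          (max 0 ((relEntropy (P.bob 1) (P.bob 0)).toReal
              - (relEntropy (P.willie 1) (P.willie 0)).toReal)
            / Real.sqrt (1 / 2 * chiSq (P.willie 1) (P.willie 0))) ∧
      P.weakCapacity ≤
        ENNReal.ofReal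
          (max 0 ((relEntropy (P.bob 1) (P.bob 0)).toReal
              - (relEntropy (P.willie 1) (P.willie 0)).toReal)
            / Real.sqrt (1 / 2 * chiSq (P.willie 1) (P.willie 0))) := by
  rw [relEntropy_of_supp hB, relEntropy_of_supp hW, EReal.toReal_coe, EReal.toReal_coe]
  refine ⟨le_antisymm ?_ ?_, ?_⟩
  · exact iSup_le fun r => ENNReal.ofReal_le_ofReal (r.2.2.rate_le hB hW hne)
  · by_contra hlt
    obtain ⟨r, hr0, hr1, hr2⟩ := ENNReal.lt_iff_exists_real_btwn.1 (not_le.1 hlt)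
    rcases hr0.eq_or_lt with rfl | hr
    · simp at hr1
    have h := (ENNReal.ofReal_lt_ofReal_iff_of_nonneg hr0).1 hr2
    rcases le_total (relEnt (P.bob 1) (P.bob 0) - relEnt (P.willie 1) (P.willie 0)) 0 with hd | hd
    · rw [max_eq_left hd, zero_div] at h
      exact absurd h hr0.not_gt
    rw [max_eq_right hd] at h
    refine absurd hr1 (not_lt.2 ?_)
    exact le_iSup (fun r : {r : ℝ // 0 < r ∧ P.Achievable r} => ENNReal.ofReal r.1)
      ⟨r, hr, achievable_of_lt hB hW hne hr h⟩
  · exact iSup_le fun r => ENNReal.ofReal_le_ofReal (r.2.2.rate_le hB hW hne)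

end CovertSecrecy

theorem theorem3 {B W : Type*} [Fintype B] [DecidableEq B] [Fintype W] [DecidableEq W]
    (P : CovertSecrecy.CQChannel (Fin 2) B W)
    (hB : CovertSecrecy.supp (P.bob 1) ≤ CovertSecrecy.supp (P.bob 0))
    (hW : CovertSecrecy.supp (P.willie 1) ≤ CovertSecrecy.supp (P.willie 0))
    (hne : P.willie 1 ≠ P.willie 0) :
    P.capacity =
        ENNReal.ofReal
          (max 0 ((CovertSecrecy.relEntropy (P.bob 1) (P.bob 0)).toReal
              - (CovertSecrecy.relEntropy (P.willie 1) (P.willie 0)).toReal)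
            / Real.sqrt (1 / 2 * CovertSecrecy.chiSq (P.willie 1) (P.willie 0))) ∧
      P.weakCapacity ≤
        ENNReal.ofReal
          (max 0 ((CovertSecrecy.relEntropy (P.bob 1) (P.bob 0)).toReal
              - (CovertSecrecy.relEntropy (P.willie 1) (P.willie 0)).toReal)
            / Real.sqrt (1 / 2 * CovertSecrecy.chiSq (P.willie 1) (P.willie 0))) :=
  CovertSecrecy.capacity_eq P hB hW hne
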